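/- All manifolds are smooth, finite-dimensional, Hausdorff and second countable, and vector bundles are smooth of finite rank. Let $E\to M$ be a vector bundle and let $(q,q_M):(E\to M)\to(\tilde E\to\tilde M)$ be a simple quotient of $E$: a vector bundle morphism such that $q_M$ is a surjective submersion with connected fibres and $q$ is fibrewise surjective. Let $A=(E,\rho,[\cdot,\cdot])$ be a Lie algebroid structure on $E$, and let $\omega\in\Omega^k(E)$ ($k\ge 0$) be linear, i.e. $h_\lambda^*\omega=\lambda\omega$ for all $\lambda\in\mathbb R$, where $h_\lambda$ is fibrewise multiplication by $\lambda$. A linear $k$-form $\omega$ is called $A$-morphic if the map $T^{\oplus k}E=TE\oplus_E\cdots\oplus_E TE\to\mathbb R$, $(V_1,\dots,V_k)\mapsto\omega(V_1,\dots,V_k)$, is a Lie algebroid morphism from the direct sum $T^{\oplus k}A$ of tangent algebroids (over $T^{\oplus k}M$) to the Lie algebra $\mathbb R\to\star$. The components of a linear $k$-form $\omega$ are the vector bundle morphisms $\mu:E\to\Lambda^{k-1}T^*M$ and $\eta:E\to\Lambda^kT^*M$ over $\mathrm{id}_M$ given, for $e\in E_x$ and $v_i\in T_xM$, by $$\mu(e)(v_1,\dots,v_{k-1})=\omega|_{0_x}\big(\tfrac{d}{dt}\big|_{t=0}te,\,T0(v_1),\dots,T0(v_{k-1})\big),\qquad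 \eta(e)(v_1,\dots,v_k)=(d\omega)|_{0_x}\big(\tfrac{d}{dt}\big|_{t=0}te,\,T0(v_1),\dots,T0(v_k)\big),$$ where $0:M\to E$ is the zero section (and $\mu=0$ when $k=0$). Suppose that $\omega$ is $A$-morphic, that $A$ is $q$-basic, i.e. there is a Lie algebroid structure $\tilde A$ on $\tilde E$ for which $q:A\to\tilde A$ is a Lie algebroid morphism, and that $\omega$ is $q$-basic, i.e. there is $\tilde\omega\in\Omega^k(\tilde E)$ with $\omega=q^*\tilde\omega$. Then $\tilde A=:q_*A$ and $\tilde\omega=:q_*\omega$ are unique, and $q_*\omega$ is a linear $k$-form which is $(q_*A)$-morphic. Moreover, writing $(\mu,\eta)$ and $(\tilde\mu,\tilde\eta)$ for the components of $\omega$ and of $q_*\omega$, one has $q_*\omega=d\Lambda_{\tilde\mu}+\Lambda_{\tilde\eta}$, where $\Lambda_\nu|_{\tilde e}(V_1,\dots)=\nu(\tilde e)(Tp\,V_1,\dots)$ with $p:\tilde E\to\tilde M$ the projection (for $k=0$ there is no $\mu$-term), the components are related by $$\mu(e)=(T_xq_M)^*\,\tilde\mu(q(e)),\qquad \eta(e)=(T_xq_M)^*\,\tilde\eta(q(e))\qquad(e\in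 E_x,\ x\in M),$$ and $(\tilde\mu,\tilde\eta)$ is an IM $k$-form on $q_*A$: with $\tilde\rho$ and $[\cdot,\cdot]$ the anchor and bracket of $q_*A$, for all $e_1,e_2\in\Gamma(\tilde E)$, $$i_{\tilde\rho(e_1)}\tilde\mu(e_2)=-i_{\tilde\rho(e_2)}\tilde\mu(e_1),$$ $$\tilde\mu([e_1,e_2])=L_{\tilde\rho(e_1)}\tilde\mu(e_2)-i_{\tilde\rho(e_2)}d\tilde\mu(e_1)-i_{\tilde\rho(e_2)}\tilde\eta(e_1),$$ $$\tilde\eta([e_1,e_2])=L_{\tilde\rho(e_1)}\tilde\eta(e_2)-i_{\tilde\rho(e_2)}d\tilde\eta(e_1).$$ -/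

import Mathlib

open Bundle Set
open scoped Manifold ContDiff Topology Bundle

noncomputable section

namespace SimpleQuotients

/-! ### Differential forms on manifolds without boundary -/

section Forms

variable {V : Type*} [NormedAddCommGroup V] [NormedSpace ℝ V] {H : Type*} [TopologicalSpace H]
  (I : ModelWithCorners ℝ V H) {N : Type*} [TopologicalSpace N] [ChartedSpace H N]
  {V' : Type*} [NormedAddCommGroup V'] [NormedSpace ℝ V'] {H' : Type*} [TopologicalSpace H']
  (I' : ModelWithCorners ℝ V' H') {N' : Type*} [TopologicalSpace N'] [ChartedSpace H' N']

/-- The derivative of a real function `f` at `x` along the tangent vector `v`. -/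
def dirDeriv (f : N → ℝ) (x : N) (v : TangentSpace I x) : ℝ :=
  mfderiv I 𝓘(ℝ, ℝ) f x v

/-- The fibre at `x` of `Λⁿ T*N`. -/
abbrev CotangentPower (n : ℕ) (x : N) : Type _ := (TangentSpace I x) [⋀^Fin n]→L[ℝ] ℝ

/-- A (not necessarily smooth) `n`-form on `N`. -/
abbrev Form (N : Type*) [TopologicalSpace N] [ChartedSpace H N] (n : ℕ) : Type _ :=
  ∀ x : N, CotangentPower I n x

variable {I} in
/-- The expression of an `n`-form in the preferred chart around `x₀`, that is, its pullback along
the inverse of the chart. -/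
def Form.inChart {n : ℕ} (θ : Form I N n) (x₀ : N) : V → V [⋀^Fin n]→L[ℝ] ℝ := fun y =>
  (θ ((extChartAt I x₀).symm y)).compContinuousLinearMap
    (mfderiv 𝓘(ℝ, V) I (extChartAt I x₀).symm y)

variable {I} in
/-- Smoothness of an `n`-form: its coefficients in every chart are smooth. -/
def Form.IsSmooth {n : ℕ} (θ : Form I N n) : Prop :=
  ∀ x₀ : N, ContDiffOn ℝ ∞ (Form.inChart θ x₀) (extChartAt I x₀).target

variable {I} in
/-- The exterior derivative, computed at `x` in the preferred chart around `x`.  (`TangentSpace I x`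
is by definition the model space `V`, seen through this chart.) -/
def Form.extDer {n : ℕ} (θ : Form I N n) : Form I N (n + 1) := fun x =>
  (extDeriv (Form.inChart θ x) (extChartAt I x x) : V [⋀^Fin (n + 1)]→L[ℝ] ℝ)

/-- Contraction of an alternating form of positive degree with a vector, in the first slot. -/
def contractSucc {W : Type*} [AddCommGroup W] [Module ℝ W] [TopologicalSpace W] {n : ℕ}
    (α : W [⋀^Fin (n + 1)]→L[ℝ] ℝ) (v : W) : W [⋀^Fin n]→L[ℝ] ℝ :=
  { α.toAlternatingMap.curryLeft v with
    cont := α.cont.comp (by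
      refine continuous_pi fun i => ?_
      refine Fin.cases ?_ (fun j => ?_) i
      · simpa using continuous_const
      · simpa using continuous_apply j) }

/-- Contraction of an alternating form with a vector, in the first slot; the contraction of a
`0`-form is zero. -/
def contract {W : Type*} [AddCommGroup W] [Module ℝ W] [TopologicalSpace W] :
    {n : ℕ} → W [⋀^Fin n]→L[ℝ] ℝ → W → W [⋀^Fin (n - 1)]→L[ℝ] ℝ
  | 0, _, _ => 0
  | _ + 1, α, v => contractSucc α v

variable {I} in
/-- The interior product of a form of positive degree with a vector field. -/
def Form.interiorSucc {n : ℕ} (X : ∀ x : N, TangentSpace I x) (θ : Form I N (n + 1)) :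
    Form I N n :=
  fun x => contractSucc (θ x) (X x)

variable {I} in
/-- The interior product of a form with a vector field; it is zero on `0`-forms. -/
def Form.interior {n : ℕ} (X : ∀ x : N, TangentSpace I x) (θ : Form I N n) : Form I N (n - 1) :=
  fun x => contract (θ x) (X x)

variable {I} in
/-- The Lie derivative of a form along a vector field, `L_X = d i_X + i_X d`. -/
def Form.lieDer (X : ∀ x : N, TangentSpace I x) : {n : ℕ} → Form I N n → Form I N n
  | 0, θ => Form.interiorSucc X (Form.extDer θ)
  | _ + 1, θ => Form.extDer (Form.interiorSucc X θ) + Form.interiorSucc X (Form.extDer θ)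

variable {I I'} in
/-- The pullback of a form along a map. -/
def Form.pullback {n : ℕ} (φ : N → N') (θ : Form I' N' n) : Form I N n := fun x =>
  (θ (φ x)).compContinuousLinearMap (mfderiv I I' φ x)

end Forms

/-! ### Vector bundles, Lie algebroids and their simple quotients -/

section Bundles

variable {B : Type*} [NormedAddCommGroup B] [NormedSpace ℝ B]
  {M : Type*} [TopologicalSpace M] [ChartedSpace B M] [IsManifold 𝓘(ℝ, B) 1 M]
  (F : Type*) [NormedAddCommGroup F] [NormedSpace ℝ F]
  (E : M → Type*) [TopologicalSpace (TotalSpace F E)] [∀ x, AddCommGroup (E x)]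
  [∀ x, Module ℝ (E x)] [∀ x, TopologicalSpace (E x)] [FiberBundle F E] [VectorBundle ℝ F E]
  {B' : Type*} [NormedAddCommGroup B'] [NormedSpace ℝ B']
  {M' : Type*} [TopologicalSpace M'] [ChartedSpace B' M'] [IsManifold 𝓘(ℝ, B') 1 M']
  (F' : Type*) [NormedAddCommGroup F'] [NormedSpace ℝ F']
  (E' : M' → Type*) [TopologicalSpace (TotalSpace F' E')] [∀ x, AddCommGroup (E' x)]
  [∀ x, Module ℝ (E' x)] [∀ x, TopologicalSpace (E' x)] [FiberBundle F' E'] [VectorBundle ℝ F' E']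

/-- Smooth global sections of `E → M`. -/
abbrev Sec : Type _ := Cₛ^∞⟮𝓘(ℝ, B); F, E⟯

/-- The manifold structure of the total space of a vector bundle is modelled on `B × F`. -/
abbrev totModel (B F : Type*) [NormedAddCommGroup B] [NormedSpace ℝ B] [NormedAddCommGroup F]
    [NormedSpace ℝ F] : ModelWithCorners ℝ (B × F) (ModelProd B F) :=
  𝓘(ℝ, B).prod 𝓘(ℝ, F)

variable {F E} in
/-- The product of a smooth function and a smooth section. -/
def Sec.fsmul (f : C^∞⟮𝓘(ℝ, B), M; ℝ⟯) (e : Sec (B := B) F E) : Sec (B := B) F E where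
  toFun x := f x • e x
  contMDiff_toFun := f.contMDiff.smul_section e.contMDiff

/-- A Lie algebroid structure on the vector bundle `E → M`. -/
structure LieAlgebroid where
  /-- the anchor, a vector bundle morphism `E → TM` over the identity -/
  anchor : ∀ x : M, E x →ₗ[ℝ] TangentSpace 𝓘(ℝ, B) x
  anchor_smooth : ContMDiff (totModel B F) (totModel B B) ∞
    (fun p : TotalSpace F E => (⟨p.1, anchor p.1 p.2⟩ : TangentBundle 𝓘(ℝ, B) M))
  /-- the Lie bracket on smooth sections -/
  bracket : Sec (B := B) F E → Sec (B := B) F E → Sec (B := B) F E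
  bracket_add : ∀ e e₁ e₂, bracket e (e₁ + e₂) = bracket e e₁ + bracket e e₂
  bracket_smul : ∀ (c : ℝ) (e e₁), bracket e (c • e₁) = c • bracket e e₁
  bracket_skew : ∀ e₁ e₂, bracket e₁ e₂ = -bracket e₂ e₁
  jacobi : ∀ e₁ e₂ e₃, bracket e₁ (bracket e₂ e₃) =
    bracket (bracket e₁ e₂) e₃ + bracket e₂ (bracket e₁ e₃)
  leibniz : ∀ (e₁ : Sec (B := B) F E) (f : C^∞⟮𝓘(ℝ, B), M; ℝ⟯) (e₂ : Sec (B := B) F E) (x : M),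
    bracket e₁ (Sec.fsmul f e₂) x =
      f x • bracket e₁ e₂ x + dirDeriv 𝓘(ℝ, B) f x (anchor x (e₁ x)) • e₂ x

variable {F E F' E'}

/-- The vector field `ρ(e)` on `M`. -/
def LieAlgebroid.rho (A : LieAlgebroid (B := B) F E) (e : Sec (B := B) F E) :
    ∀ x : M, TangentSpace 𝓘(ℝ, B) x := fun x => A.anchor x (e x)

variable (B F E B' F' E') in
/-- Vector bundle morphisms `(E → M) → (E' → M')`. -/
structure BundleMorphism where
  base : M → M'
  fiber : ∀ x : M, E x →ₗ[ℝ] E' (base x)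
  smooth_base : ContMDiff 𝓘(ℝ, B) 𝓘(ℝ, B') ∞ base
  smooth_total : ContMDiff (totModel B F) (totModel B' F') ∞
    (fun p : TotalSpace F E => (⟨base p.1, fiber p.1 p.2⟩ : TotalSpace F' E'))

/-- The map of total spaces underlying a vector bundle morphism. -/
def BundleMorphism.total (q : BundleMorphism B F E B' F' E') :
    TotalSpace F E → TotalSpace F' E' :=
  fun p => ⟨q.base p.1, q.fiber p.1 p.2⟩

/-- `q` is a simple quotient of the vector bundle `E → M`: its base map is a surjective submersion
with connected fibres, and it is fibrewise surjective. -/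
structure BundleMorphism.IsSimpleQuotient (q : BundleMorphism B F E B' F' E') : Prop where
  base_surjective : Function.Surjective q.base
  base_submersion : Manifold.IsSubmersion 𝓘(ℝ, B) 𝓘(ℝ, B') ∞ q.base
  base_fibers_connected : ∀ y : M', IsConnected (q.base ⁻¹' {y})
  fiber_surjective : ∀ x : M, Function.Surjective (q.fiber x)

/-- A vector bundle morphism is a Lie algebroid morphism if it is compatible with the anchors, and
compatible with the brackets in terms of decompositions `q ∘ e = ∑ fᵢ (sᵢ ∘ q_M)`. -/
structure IsLieAlgebroidMorphism (A : LieAlgebroid (B := B) F E)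
    (A' : LieAlgebroid (B := B') F' E') (q : BundleMorphism B F E B' F' E') : Prop where
  anchor_comp : ∀ (x : M) (u : E x), mfderiv 𝓘(ℝ, B) 𝓘(ℝ, B') q.base x (A.anchor x u) =
    A'.anchor (q.base x) (q.fiber x u)
  bracket_comp : ∀ (e₁ e₂ : Sec (B := B) F E) (m n : ℕ)
    (f : Fin m → C^∞⟮𝓘(ℝ, B), M; ℝ⟯) (s : Fin m → Sec (B := B') F' E')
    (g : Fin n → C^∞⟮𝓘(ℝ, B), M; ℝ⟯) (t : Fin n → Sec (B := B') F' E'),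
    (∀ x, q.fiber x (e₁ x) = ∑ i, f i x • s i (q.base x)) →
    (∀ x, q.fiber x (e₂ x) = ∑ j, g j x • t j (q.base x)) →
    ∀ x, q.fiber x (A.bracket e₁ e₂ x) =
      (∑ i, ∑ j, (f i x * g j x) • A'.bracket (s i) (t j) (q.base x)) +
      (∑ j, dirDeriv 𝓘(ℝ, B) (g j) x (A.rho e₁ x) • t j (q.base x)) -
      (∑ i, dirDeriv 𝓘(ℝ, B) (f i) x (A.rho e₂ x) • s i (q.base x))

/-- `A' = q_* A`: the map `q` is a Lie algebroid morphism from `A` to the structure `A'` on the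
quotient bundle. -/
def LieAlgebroid.IsPushforward (q : BundleMorphism B F E B' F' E')
    (A : LieAlgebroid (B := B) F E) (A' : LieAlgebroid (B := B') F' E') : Prop :=
  IsLieAlgebroidMorphism A A' q

/-- `A` is `q`-basic. -/
def LieAlgebroid.IsBasic (q : BundleMorphism B F E B' F' E') (A : LieAlgebroid (B := B) F E) :
    Prop :=
  ∃ A' : LieAlgebroid (B := B') F' E', LieAlgebroid.IsPushforward q A A'

variable (B F E) in
/-- Differential forms on the total space of `E → M`. -/
abbrev TotForm (k : ℕ) : Type _ := Form (totModel B F) (TotalSpace F E) k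

/-- `θ' = q_* θ`: `θ'` is a smooth form on the total space of the quotient with `θ = q^* θ'`. -/
def TotForm.IsPushforward {k : ℕ} (q : BundleMorphism B F E B' F' E')
    (θ : TotForm B F E k) (θ' : TotForm B' F' E' k) : Prop :=
  Form.IsSmooth θ' ∧ θ = Form.pullback q.total θ'

/-- `θ` is `q`-basic. -/
def TotForm.IsBasic {k : ℕ} (q : BundleMorphism B F E B' F' E') (θ : TotForm B F E k) : Prop :=
  ∃ θ' : TotForm B' F' E' k, TotForm.IsPushforward q θ θ'

/-- `θ` is linear: `h_c^* θ = c θ`, where `h_c` is multiplication by `c` in the fibres of `E`. -/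
def TotForm.IsLinear {k : ℕ} (θ : TotForm B F E k) : Prop :=
  ∀ c : ℝ, Form.pullback (fun p : TotalSpace F E => (⟨p.1, c • p.2⟩ : TotalSpace F E)) θ = c • θ

/-! ### Components of linear forms, and IM forms -/

variable (F) in
/-- The vertical vector `d/dt (t u)` at `t = 0`, tangent to `E` at the zero of the fibre of `u`. -/
def verticalAtZero {x : M} (u : E x) : TangentSpace (totModel B F) (⟨x, 0⟩ : TotalSpace F E) :=
  (mfderiv 𝓘(ℝ, ℝ) (totModel B F) (fun t : ℝ => (⟨x, t • u⟩ : TotalSpace F E)) 0 (1 : ℝ) : B × F)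

variable (B F E) in
/-- The tangent map of the zero section at `x`. -/
def zeroTangent (x : M) :
    TangentSpace 𝓘(ℝ, B) x →L[ℝ] TangentSpace (totModel B F) (⟨x, 0⟩ : TotalSpace F E) :=
  mfderiv 𝓘(ℝ, B) (totModel B F) (fun y : M => (⟨y, 0⟩ : TotalSpace F E)) x

/-- The component `μ : E → Λ^{k-1} T*M` of a linear `k`-form `θ`:
`μ(u)(v₁, …) = θ(d/dt (t u), T0 v₁, …)`.  For `k = 0` this is zero. -/
def TotForm.mu {k : ℕ} (θ : TotForm B F E k) (x : M) (u : E x) :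
    CotangentPower 𝓘(ℝ, B) (k - 1) x :=
  (contract (θ ⟨x, 0⟩) (verticalAtZero F u)).compContinuousLinearMap (zeroTangent B F E x)

/-- The component `η : E → Λ^k T*M` of a linear `k`-form `θ`:
`η(u)(v₁, …) = dθ(d/dt (t u), T0 v₁, …)`. -/
def TotForm.eta {k : ℕ} (θ : TotForm B F E k) (x : M) (u : E x) :
    CotangentPower 𝓘(ℝ, B) k x :=
  (contractSucc (Form.extDer θ ⟨x, 0⟩) (verticalAtZero F u)).compContinuousLinearMap
    (zeroTangent B F E x)

variable (F) in
/-- The form `Λ_μ` on `E`: `Λ_μ(V₁, …)` at `u` is `μ(u)(Tp V₁, …)`, the pullback along `μ` of the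
tautological form. -/
def liftForm {n : ℕ} (μ : ∀ x : M, E x → CotangentPower 𝓘(ℝ, B) n x) : TotForm B F E n :=
  fun p => (μ p.1 p.2).compContinuousLinearMap
    (mfderiv (totModel B F) 𝓘(ℝ, B) (TotalSpace.proj : TotalSpace F E → M) p)

variable (F) in
/-- `μ : E → Λⁿ T*M` is a (smooth) vector bundle morphism over the identity of `M`. -/
structure IsFormValuedMorphism {n : ℕ} (μ : ∀ x : M, E x → CotangentPower 𝓘(ℝ, B) n x) : Prop where
  map_add : ∀ (x : M) (u v : E x), μ x (u + v) = μ x u + μ x v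
  map_smul : ∀ (x : M) (c : ℝ) (u : E x), μ x (c • u) = c • μ x u
  smooth : ∀ e : Sec (B := B) F E,
    Form.IsSmooth (fun x => μ x (e x) : Form 𝓘(ℝ, B) M n)

/-- `θ = dΛ_μ + Λ_η`; for `0`-forms there is no `μ`, and the equation reads `θ = Λ_η`. -/
def TotForm.HasComponents : {k : ℕ} → (θ : TotForm B F E k) →
    (μ : ∀ x : M, E x → CotangentPower 𝓘(ℝ, B) (k - 1) x) →
    (η : ∀ x : M, E x → CotangentPower 𝓘(ℝ, B) k x) → Prop
  | 0, θ, _, η => θ = liftForm F η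
  | k + 1, θ, μ, η => θ = Form.extDer (n := k) (liftForm F (n := k) μ) + liftForm F η

/-- `(μ, η)` is an IM `k`-form on the Lie algebroid `A`. -/
structure IsIMForm (A : LieAlgebroid (B := B) F E) {k : ℕ}
    (μ : ∀ x : M, E x → CotangentPower 𝓘(ℝ, B) (k - 1) x)
    (η : ∀ x : M, E x → CotangentPower 𝓘(ℝ, B) k x) : Prop where
  mu_morphism : IsFormValuedMorphism F μ
  eta_morphism : IsFormValuedMorphism F η
  im_skew : ∀ e₁ e₂ : Sec (B := B) F E,
    Form.interior (A.rho e₁) (fun x => μ x (e₂ x)) =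
      -Form.interior (A.rho e₂) (fun x => μ x (e₁ x))
  im_mu : ∀ e₁ e₂ : Sec (B := B) F E,
    (fun x => μ x (A.bracket e₁ e₂ x)) =
      Form.lieDer (A.rho e₁) (fun x => μ x (e₂ x))
        - Form.interiorSucc (A.rho e₂) (Form.extDer (fun x => μ x (e₁ x)))
        - Form.interior (A.rho e₂) (fun x => η x (e₁ x))
  im_eta : ∀ e₁ e₂ : Sec (B := B) F E,
    (fun x => η x (A.bracket e₁ e₂ x)) =
      Form.lieDer (A.rho e₁) (fun x => η x (e₂ x))
        - Form.interiorSucc (A.rho e₂) (Form.extDer (fun x => η x (e₁ x)))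

/-! ### The Lie algebroid `T^{⊕k} A` and morphic forms -/

variable (B M) in
/-- The manifold `T^{⊕k} M = TM ⊕ … ⊕ TM`, as the total space of the bundle of linear maps
`ℝᵏ → T_x M`; the `i`-th vector of such a tuple is the image of the `i`-th basis vector. -/
abbrev TangentPower (k : ℕ) : Type _ :=
  TotalSpace ((Fin k → ℝ) →L[ℝ] B)
    (fun x : M => Bundle.Trivial M (Fin k → ℝ) x →L[ℝ] TangentSpace 𝓘(ℝ, B) x)

/-- The model of the manifold `T^{⊕k} M`. -/
abbrev powModel (B : Type*) [NormedAddCommGroup B] [NormedSpace ℝ B] (k : ℕ) :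
    ModelWithCorners ℝ (B × ((Fin k → ℝ) →L[ℝ] B)) (ModelProd B ((Fin k → ℝ) →L[ℝ] B)) :=
  𝓘(ℝ, B).prod 𝓘(ℝ, (Fin k → ℝ) →L[ℝ] B)

/-- The `i`-th tangent vector of a point of `T^{⊕k} M`. -/
def TangentPower.vec {k : ℕ} (b : TangentPower B M k) (i : Fin k) : TangentSpace 𝓘(ℝ, B) b.1 :=
  b.2 (Pi.single i (1 : ℝ) : Fin k → ℝ)

variable (F E) in
/-- The fibre of the vector bundle `T^{⊕k} E → T^{⊕k} M` over `(v₁, …, v_k)`, `vᵢ ∈ T_x M`.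

Its points are the tuples `(V₁, …, V_k)` of tangent vectors of `E` at a common point `u ∈ E_x`, with
`Tp Vᵢ = vᵢ`.  The preferred chart of the total space of `E` at `u` is the trivialization at `x`
followed by the preferred chart of `M` at `x`; it is the same for all `u ∈ E_x`, and in it
`Vᵢ = (vᵢ, fᵢ)` with `fᵢ ∈ F`.  So the point is given by `(u, f)`.  As the trivialization is
linear in the fibres, the vector space structure (the tangent of the addition and of the scalar
multiplication of `E`) is the componentwise one. -/
abbrev PowFiber {k : ℕ} (b : TangentPower B M k) : Type _ := E b.1 × (Fin k → F)

/-- The `i`-th vector `Vᵢ`, tangent to the total space of `E`, of an element of the fibre of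
`T^{⊕k} E → T^{⊕k} M` over `b`. -/
def PowFiber.vec {k : ℕ} {b : TangentPower B M k} (w : PowFiber F E b) (i : Fin k) :
    TangentSpace (totModel B F) (⟨b.1, w.1⟩ : TotalSpace F E) :=
  ((b.vec i : B), w.2 i)

variable (F E) in
/-- (Set-theoretic) sections of the vector bundle `T^{⊕k} E → T^{⊕k} M`. -/
abbrev PowSec (B : Type*) [NormedAddCommGroup B] [NormedSpace ℝ B] [ChartedSpace B M]
    [IsManifold 𝓘(ℝ, B) 1 M] (k : ℕ) : Type _ := ∀ b : TangentPower B M k, PowFiber F E b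

/-- The section `T e` of `T^{⊕k} E → T^{⊕k} M`, `(v₁, …, v_k) ↦ (Te(v₁), …, Te(v_k))`, induced by a
section `e` of `E`. -/
def tangentLift (k : ℕ) (e : Sec (B := B) F E) : PowSec F E B k := fun b =>
  (e b.1, fun i =>
    ((mfderiv 𝓘(ℝ, B) (totModel B F) (fun y : M => (⟨y, e y⟩ : TotalSpace F E)) b.1
      (b.vec i)) : B × F).2)

/-- The section `ê` of `T^{⊕k} E → T^{⊕k} M` in the `j`-th slot, induced by a section `e` of `E`:
`(v₁, …, v_k) ↦ (T0(v₁), …, T0(v_j) + d/dt (t e), …, T0(v_k))`. -/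
def coreLift {k : ℕ} (j : Fin k) (e : Sec (B := B) F E) : PowSec F E B k := fun b =>
  (0, fun i =>
    ((zeroTangent B F E b.1 (b.vec i)) : B × F).2 +
      if i = j then ((verticalAtZero (B := B) F (e b.1)) : B × F).2 else 0)

/-- For a vector `W` tangent to the total space of `E`, with `Tρ(W) = (v, z)` in `T(TM)`, the
component `z` (in the preferred chart of `TM`). -/
def LieAlgebroid.anchorTangent (A : LieAlgebroid (B := B) F E) {p : TotalSpace F E}
    (W : TangentSpace (totModel B F) p) : B :=
  ((mfderiv (totModel B F) (totModel B B)
    (fun r : TotalSpace F E => (⟨r.1, A.anchor r.1 r.2⟩ : TangentBundle 𝓘(ℝ, B) M)) p W) : B × B).2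

/-- The anchor of `T^{⊕k} A`.  On each summand it is the tangent map of the anchor
`ρ : E → TM` followed by the canonical involution of `TTM`: if `Tρ(Vᵢ) = (vᵢ, zᵢ)` in
`T(TM)` at `ρ(u)`, then `(V₁, …, V_k)` is sent to the vector `(ρ(u), (z₁, …, z_k))`
tangent to `T^{⊕k} M` at `(v₁, …, v_k)`. -/
def LieAlgebroid.powAnchor (A : LieAlgebroid (B := B) F E) {k : ℕ} (b : TangentPower B M k)
    (w : PowFiber F E b) : TangentSpace (powModel B k) b :=
  ((A.anchor b.1 w.1 : B),
    ∑ i : Fin k, (ContinuousLinearMap.proj (R := ℝ) (φ := fun _ : Fin k => ℝ) i).smulRight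
      (A.anchorTangent (PowFiber.vec w i)))

/-- The bracket of the Lie algebroid `T^{⊕k} A = TA ⊕ … ⊕ TA`, as a relation:
`PowBracket A S₁ S₂ S₃` says that `S₃ = [S₁, S₂]`.  It is determined by its values on the sections
`T e` and `ê`, which generate the module of all smooth sections, by skew-symmetry, by additivity
and by the Leibniz rule. -/
inductive LieAlgebroid.PowBracket (A : LieAlgebroid (B := B) F E) {k : ℕ} :
    PowSec F E B k → PowSec F E B k → PowSec F E B k → Prop
  | tangent_tangent (e₁ e₂ : Sec (B := B) F E) :
      A.PowBracket (tangentLift k e₁) (tangentLift k e₂) (tangentLift k (A.bracket e₁ e₂))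
  | tangent_core (j : Fin k) (e₁ e₂ : Sec (B := B) F E) :
      A.PowBracket (tangentLift k e₁) (coreLift j e₂) (coreLift j (A.bracket e₁ e₂))
  | core_core (i j : Fin k) (e₁ e₂ : Sec (B := B) F E) :
      A.PowBracket (coreLift i e₁) (coreLift j e₂) 0
  | skew {S₁ S₂ S₃ : PowSec F E B k} (h : A.PowBracket S₁ S₂ S₃) : A.PowBracket S₂ S₁ (-S₃)
  | add {S S₁ S₂ R₁ R₂ : PowSec F E B k} (h₁ : A.PowBracket S S₁ R₁) (h₂ : A.PowBracket S S₂ R₂) :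
      A.PowBracket S (S₁ + S₂) (R₁ + R₂)
  | leibniz {S₁ S₂ S₃ : PowSec F E B k} (f : C^∞⟮powModel B k, TangentPower B M k; ℝ⟯)
      (h : A.PowBracket S₁ S₂ S₃) :
      A.PowBracket S₁ (fun b => f b • S₂ b)
        (fun b => f b • S₃ b + dirDeriv (powModel B k) f b (A.powAnchor b (S₁ b)) • S₂ b)

/-- The map `T^{⊕k} E → ℝ`, `(V₁, …, V_k) ↦ θ(V₁, …, V_k)`. -/
def TotForm.eval {k : ℕ} (θ : TotForm B F E k) (b : TangentPower B M k) (w : PowFiber F E b) : ℝ :=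
  θ ⟨b.1, w.1⟩ w.vec

/-- A linear `k`-form is `A`-morphic if `(V₁, …, V_k) ↦ θ(V₁, …, V_k)` is a Lie algebroid morphism
from `T^{⊕k} A → T^{⊕k} M` to the Lie algebra `ℝ → ⋆`: it is linear in the fibres over `T^{⊕k} M`,
and a section `S` of `T^{⊕k} E` being mapped to the function `θ(S)`, that is, to `θ(S)` times the
generator of `ℝ`, the compatibility with the brackets reads
`θ([S₁, S₂]) = L_{S₁} θ(S₂) - L_{S₂} θ(S₁)` (the bracket of `ℝ` and the anchor of `ℝ → ⋆`
vanish). -/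
structure TotForm.IsMorphic (A : LieAlgebroid (B := B) F E) {k : ℕ} (θ : TotForm B F E k) :
    Prop where
  smooth : Form.IsSmooth θ
  linear : TotForm.IsLinear θ
  eval_add : ∀ (b : TangentPower B M k) (w w' : PowFiber F E b),
    θ.eval b (w + w') = θ.eval b w + θ.eval b w'
  eval_smul : ∀ (b : TangentPower B M k) (c : ℝ) (w : PowFiber F E b),
    θ.eval b (c • w) = c * θ.eval b w
  eval_bracket : ∀ S₁ S₂ S₃ : PowSec F E B k, A.PowBracket S₁ S₂ S₃ →
    ∀ b : TangentPower B M k, θ.eval b (S₃ b) =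
      dirDeriv (powModel B k) (fun c => θ.eval c (S₂ c)) b (A.powAnchor b (S₁ b)) -
      dirDeriv (powModel B k) (fun c => θ.eval c (S₁ c)) b (A.powAnchor b (S₂ b))

end Bundles

end SimpleQuotients

end

set_option linter.unusedSectionVars false

/-! Being morphic is a condition on sections of `T^{⊕k} A`, which do not transport well along the
quotient map. For linear forms it is equivalent to the IM equations for the components, and these
are identities between differential forms on the base. The equations descend because pullback along
a surjective submersion is injective. The proof therefore goes from morphic upstairs to IM upstairs,
to IM downstairs, to morphic downstairs.

The decomposition of a linear form θ comes from the Euler field 𝓔. Differentiating `h_c^* θ = c θ`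
at `c = 1` gives `L_𝓔 θ = θ`, and homogeneity shows that `i_𝓔 θ = Λ_μ` and, applied to the linear
form `dθ`, that `i_𝓔 dθ = Λ_η`. Cartan's formula then reads `θ = dΛ_μ + Λ_η`. Pulling back along a
section `e` yields `e^* θ = dμ(e) + η(e)`.

For the equivalence, θ is evaluated on the two kinds of generators. On `T e` it gives `e^* θ`, and
on the core lift of `e` in slot `j` it gives `(-1)^j μ(e)` on the remaining vectors. The anchor
sends `T e` to the tangent lift of `ρ(e)`, along which the derivative of an evaluation is a Lie
derivative. It sends a core lift to a vertical lift, along which the derivative inserts `ρ(e)` into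
one slot. The brackets core-core, tangent-core and tangent-tangent thus become the skew-symmetry
equation, the equation for `μ` and, modulo the equation for `μ`, the one for `η`
(`TotForm.IsMorphic.isIMForm`, `IsIMForm.isMorphic`). Fibrewise linearity needs no separate input: a
function that is differentiable at 0 and homogeneous of degree one is linear.

For the descent, `q` and `Tq` are surjective, which gives uniqueness and linearity of the quotient
form. Every section of the quotient bundle lifts to a section of `E`
(`BundleMorphism.IsSimpleQuotient.exists_lift`). On lifts the morphism property says that brackets
and anchors are `q`-related, which gives uniqueness of the quotient algebroid and lets each IM
equation be written as a pullback (`IsIMForm.of_pullback`). -/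

namespace SimpleQuotients

/-! ### Differential forms in charts: pullback, smoothness, exterior derivative. -/

section FormsLibrary

variable {V : Type*} [NormedAddCommGroup V] [NormedSpace ℝ V] {H : Type*} [TopologicalSpace H]
  {I : ModelWithCorners ℝ V H} {N : Type*} [TopologicalSpace N] [ChartedSpace H N]
  {V' : Type*} [NormedAddCommGroup V'] [NormedSpace ℝ V'] {H' : Type*} [TopologicalSpace H']
  {I' : ModelWithCorners ℝ V' H'} {N' : Type*} [TopologicalSpace N'] [ChartedSpace H' N']
  {V'' : Type*} [NormedAddCommGroup V''] [NormedSpace ℝ V''] {H'' : Type*} [TopologicalSpace H'']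
  {I'' : ModelWithCorners ℝ V'' H''} {N'' : Type*} [TopologicalSpace N''] [ChartedSpace H'' N'']

/-- All tangent spaces are the model space by definition, so base point and arguments can be
replaced together without casts between fibres. -/
theorem Form.apply_congr {n : ℕ} (θ : Form I N n) {x x' : N} (h : x = x') {v v' : Fin n → V}
    (hv : v = v') : (θ x : V [⋀^Fin n]→L[ℝ] ℝ) v = (θ x' : V [⋀^Fin n]→L[ℝ] ℝ) v' := by
  subst h hv; rfl

theorem Form.inChart_apply {n : ℕ} (θ : Form I N n) (x₀ : N) (y : V) (v : Fin n → V) :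
    Form.inChart θ x₀ y v = (θ ((extChartAt I x₀).symm y) : V [⋀^Fin n]→L[ℝ] ℝ)
      (fun i => (mfderiv 𝓘(ℝ, V) I (extChartAt I x₀).symm y (v i) : V)) := rfl

theorem Form.pullback_apply {n : ℕ} (φ : N → N') (θ : Form I' N' n) (x : N) (v : Fin n → V) :
    (Form.pullback (I := I) φ θ x : V [⋀^Fin n]→L[ℝ] ℝ) v = (θ (φ x) : V' [⋀^Fin n]→L[ℝ] ℝ)
      (fun i => (mfderiv I I' φ x (v i) : V')) := rfl

theorem Form.pullback_id {n : ℕ} (θ : Form I N n) : Form.pullback (I := I) id θ = θ := by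
  funext x
  refine ContinuousAlternatingMap.ext fun v => ?_
  refine (Form.pullback_apply (I := I) id θ x v).trans ?_
  rw [mfderiv_id]; rfl

variable [I.Boundaryless] [I'.Boundaryless] [IsManifold I ∞ N] [IsManifold I' ∞ N']

theorem contMDiffAt_extChartAt_symm {x₀ : N} {y : V} (hy : y ∈ (extChartAt I x₀).target) :
    ContMDiffAt 𝓘(ℝ, V) I ∞ (extChartAt I x₀).symm y :=
  (contMDiffOn_extChartAt_symm x₀).contMDiffAt ((isOpen_extChartAt_target x₀).mem_nhds hy)

theorem mdifferentiableAt_extChartAt_symm {x₀ : N} {y : V} (hy : y ∈ (extChartAt I x₀).target) :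
    MDifferentiableAt 𝓘(ℝ, V) I (extChartAt I x₀).symm y :=
  (contMDiffAt_extChartAt_symm hy).mdifferentiableAt (by simp)

theorem mfderiv_extChartAt_symm_self (x : N) :
    mfderiv 𝓘(ℝ, V) I (extChartAt I x).symm (extChartAt I x x) = ContinuousLinearMap.id ℝ V := by
  have := mfderivWithin_range_extChartAt_symm (I := I) (x := x)
  rwa [I.range_eq_univ, mfderivWithin_univ] at this

theorem Form.inChart_self {n : ℕ} (θ : Form I N n) (x : N) :
    Form.inChart θ x (extChartAt I x x) = θ x := by
  refine ContinuousAlternatingMap.ext fun v => ?_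
  rw [Form.inChart_apply]
  refine Form.apply_congr θ (extChartAt_to_inv x) ?_
  funext i
  rw [mfderiv_extChartAt_symm_self]; rfl

theorem contDiffAt_locRep {φ : N → N'} {x₀ : N} {x₀' : N'} {y : V}
    (hy : y ∈ (extChartAt I x₀).target)
    (hφ : ContMDiffAt I I' ∞ φ ((extChartAt I x₀).symm y))
    (hx : φ ((extChartAt I x₀).symm y) ∈ (extChartAt I' x₀').source) :
    ContDiffAt ℝ ∞ (extChartAt I' x₀' ∘ φ ∘ (extChartAt I x₀).symm) y := by
  rw [← contMDiffAt_iff_contDiffAt]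
  have h1 : ContMDiffAt 𝓘(ℝ, V) I' ∞ (φ ∘ (extChartAt I x₀).symm) y :=
    ContMDiffAt.comp y hφ (contMDiffAt_extChartAt_symm hy)
  exact ContMDiffAt.comp y (contMDiffAt_extChartAt' (by simpa using hx)) h1

theorem eventually_symm_locRep {φ : N → N'} {x₀ : N} {x₀' : N'} {y : V}
    (hy : y ∈ (extChartAt I x₀).target)
    (hφ : ContinuousAt φ ((extChartAt I x₀).symm y))
    (hx : φ ((extChartAt I x₀).symm y) ∈ (extChartAt I' x₀').source) :
    ∀ᶠ z in 𝓝 y, z ∈ (extChartAt I x₀).target ∧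
      φ ((extChartAt I x₀).symm z) ∈ (extChartAt I' x₀').source := by
  have hc : ContinuousAt (φ ∘ (extChartAt I x₀).symm) y :=
    hφ.comp (mdifferentiableAt_extChartAt_symm hy).continuousAt
  exact Filter.Eventually.and ((isOpen_extChartAt_target x₀).mem_nhds hy)
    (hc.preimage_mem_nhds ((isOpen_extChartAt_source x₀').mem_nhds hx))

/-- Both sides are the derivative of `φ` composed with the inverse chart of the source; the two
factorizations agree only near `y`, which is enough. -/
theorem mfderiv_symm_locRep {φ : N → N'} {x₀ : N} {x₀' : N'} {y : V}
    (hy : y ∈ (extChartAt I x₀).target)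
    (hφ : ContMDiffAt I I' ∞ φ ((extChartAt I x₀).symm y))
    (hx : φ ((extChartAt I x₀).symm y) ∈ (extChartAt I' x₀').source) (v : V) :
    (mfderiv 𝓘(ℝ, V') I' (extChartAt I' x₀').symm
        (extChartAt I' x₀' (φ ((extChartAt I x₀).symm y)))
      (fderiv ℝ (extChartAt I' x₀' ∘ φ ∘ (extChartAt I x₀).symm) y v) : V') =
    (mfderiv I I' φ ((extChartAt I x₀).symm y) (mfderiv 𝓘(ℝ, V) I (extChartAt I x₀).symm y v) :
      V') := by
  have hd : MDifferentiableAt 𝓘(ℝ, V) 𝓘(ℝ, V')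
      (extChartAt I' x₀' ∘ φ ∘ (extChartAt I x₀).symm) y :=
    ((contDiffAt_locRep hy hφ hx).differentiableAt (by simp)).mdifferentiableAt
  have ht : (extChartAt I' x₀' (φ ((extChartAt I x₀).symm y))) ∈ (extChartAt I' x₀').target :=
    (extChartAt I' x₀').map_source hx
  have e1 : mfderiv 𝓘(ℝ, V) I' ((extChartAt I' x₀').symm ∘
      (extChartAt I' x₀' ∘ φ ∘ (extChartAt I x₀).symm)) y =
      (mfderiv 𝓘(ℝ, V') I' (extChartAt I' x₀').symm
        (extChartAt I' x₀' (φ ((extChartAt I x₀).symm y)))).comp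
      (mfderiv 𝓘(ℝ, V) 𝓘(ℝ, V') (extChartAt I' x₀' ∘ φ ∘ (extChartAt I x₀).symm) y) :=
    mfderiv_comp y (mdifferentiableAt_extChartAt_symm ht) hd
  have e2 : mfderiv 𝓘(ℝ, V) I' (φ ∘ (extChartAt I x₀).symm) y =
      (mfderiv I I' φ ((extChartAt I x₀).symm y)).comp
        (mfderiv 𝓘(ℝ, V) I (extChartAt I x₀).symm y) :=
    mfderiv_comp y (hφ.mdifferentiableAt (by simp)) (mdifferentiableAt_extChartAt_symm hy)
  have e3 : ((extChartAt I' x₀').symm ∘ (extChartAt I' x₀' ∘ φ ∘ (extChartAt I x₀).symm)) =ᶠ[𝓝 y]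
      φ ∘ (extChartAt I x₀).symm := by
    filter_upwards [eventually_symm_locRep hy hφ.continuousAt hx] with z hz
    exact (extChartAt I' x₀').left_inv hz.2
  have e4 := e3.mfderiv_eq (I := 𝓘(ℝ, V)) (I' := I')
  have key : ∀ w : V, (mfderiv 𝓘(ℝ, V) I' ((extChartAt I' x₀').symm ∘
      (extChartAt I' x₀' ∘ φ ∘ (extChartAt I x₀).symm)) y w : V') =
      (mfderiv 𝓘(ℝ, V) I' (φ ∘ (extChartAt I x₀).symm) y w : V') := fun w =>
    congrArg (fun L : V →L[ℝ] V' => L w) e4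
  have k := key v
  rw [e1, e2] at k
  rw [mfderiv_eq_fderiv] at k
  exact k

/-- This reduces statements about forms on manifolds to statements about forms on open subsets of
normed spaces; with `φ = id` it is the change of charts. -/
theorem Form.inChart_pullback {n : ℕ} (θ : Form I' N' n) {φ : N → N'} {x₀ : N} {x₀' : N'} {y : V}
    (hy : y ∈ (extChartAt I x₀).target)
    (hφ : ContMDiffAt I I' ∞ φ ((extChartAt I x₀).symm y))
    (hx : φ ((extChartAt I x₀).symm y) ∈ (extChartAt I' x₀').source) :
    Form.inChart (Form.pullback (I := I) φ θ) x₀ y =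
      (Form.inChart θ x₀' ((extChartAt I' x₀' ∘ φ ∘ (extChartAt I x₀).symm) y)
        ).compContinuousLinearMap (fderiv ℝ (extChartAt I' x₀' ∘ φ ∘ (extChartAt I x₀).symm) y) := by
  refine ContinuousAlternatingMap.ext fun v => ?_
  rw [Form.inChart_apply]
  refine (Form.pullback_apply (I := I) φ θ _ _).trans ?_
  rw [ContinuousAlternatingMap.compContinuousLinearMap_apply, Form.inChart_apply]
  refine Form.apply_congr θ ((extChartAt I' x₀').left_inv hx).symm ?_
  funext i
  exact (mfderiv_symm_locRep hy hφ hx (v i)).symm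

theorem Form.inChart_change {n : ℕ} (θ : Form I N n) {x₀ x₁ : N} {y : V}
    (hy : y ∈ (extChartAt I x₀).target) (hx : (extChartAt I x₀).symm y ∈ (extChartAt I x₁).source) :
    Form.inChart θ x₀ y =
      (Form.inChart θ x₁ ((extChartAt I x₁ ∘ (extChartAt I x₀).symm) y)).compContinuousLinearMap
        (fderiv ℝ (extChartAt I x₁ ∘ (extChartAt I x₀).symm) y) := by
  have := Form.inChart_pullback θ (φ := id) hy contMDiffAt_id hx
  rw [Form.pullback_id] at this
  exact this

/-- Induction on the degree: currying the first slot is continuous linear and leaves a form of lower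
degree. -/
theorem contDiffAt_alternating_apply {n : ℕ} {α : V → V' [⋀^Fin n]→L[ℝ] ℝ}
    {v : V → Fin n → V'} {y : V} (hα : ContDiffAt ℝ ∞ α y)
    (hv : ∀ i, ContDiffAt ℝ ∞ (fun z => v z i) y) : ContDiffAt ℝ ∞ (fun z => α z (v z)) y := by
  induction n with
  | zero =>
    have h : (fun z => α z (v z)) =
        fun z => ContinuousAlternatingMap.apply ℝ V' ℝ (0 : Fin 0 → V') (α z) := by
      funext z
      exact congrArg (α z) (Subsingleton.elim _ _)
    rw [h]
    exact (ContinuousAlternatingMap.apply ℝ V' ℝ (0 : Fin 0 → V')).contDiff.contDiffAt.comp y hα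
  | succ n ih =>
    let L : (V' [⋀^Fin (n + 1)]→L[ℝ] ℝ) →L[ℝ] (V' →L[ℝ] V' [⋀^Fin n]→L[ℝ] ℝ) :=
      (ContinuousAlternatingMap.curryLeftLI (𝕜 := ℝ) (E := V') (F := ℝ)
        (n := n)).toContinuousLinearMap
    have hL : ContDiff ℝ ∞ L := ContinuousLinearMap.contDiff (𝕜 := ℝ)
      (E := V' [⋀^Fin (n + 1)]→L[ℝ] ℝ) (F := V' →L[ℝ] V' [⋀^Fin n]→L[ℝ] ℝ) L
    have hc : ContDiffAt ℝ ∞ (fun z => L (α z)) y := hL.contDiffAt.comp y hα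
    have h := ih (α := fun z => L (α z) (v z 0)) (v := fun z => Fin.tail (v z))
      (hc.clm_apply (hv 0)) (fun i => hv i.succ)
    refine h.congr_of_eventuallyEq (Filter.Eventually.of_forall fun z => ?_)
    refine (congrArg (α z) (Fin.cons_self_tail (v z)).symm)

/-- In finite dimension a form is determined by its values on tuples of basis vectors, and a linear
left inverse of this injection recovers it from these values. -/
theorem contDiffAt_alternating_of_apply [FiniteDimensional ℝ V'] {n : ℕ}
    {α : V → V' [⋀^Fin n]→L[ℝ] ℝ} {y : V}
    (h : ∀ v : Fin n → V', ContDiffAt ℝ ∞ (fun z => α z v) y) : ContDiffAt ℝ ∞ α y := by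
  let b := Module.finBasis ℝ V'
  let ev : (V' [⋀^Fin n]→L[ℝ] ℝ) →ₗ[ℝ] ((Fin n → Fin (Module.finrank ℝ V')) → ℝ) :=
    { toFun := fun f w => f (fun i => b (w i))
      map_add' := fun _ _ => rfl
      map_smul' := fun _ _ => rfl }
  have hinj : LinearMap.ker ev = ⊥ := by
    refine LinearMap.ker_eq_bot'.2 fun f hf => ?_
    refine ContinuousAlternatingMap.toAlternatingMap_injective ?_
    refine AlternatingMap.coe_multilinearMap_injective ?_
    exact Module.Basis.ext_multilinear (fun _ => b) fun w => congrFun hf w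
  obtain ⟨g, hg⟩ := LinearMap.exists_leftInverse_of_injective ev hinj
  have he : α = fun z => LinearMap.toContinuousLinearMap g (fun w => α z (fun i => b (w i))) := by
    funext z
    exact (congrArg (fun L : (V' [⋀^Fin n]→L[ℝ] ℝ) →ₗ[ℝ] _ => L (α z)) hg).symm
  rw [he]
  exact (LinearMap.toContinuousLinearMap g).contDiff.contDiffAt.comp y
    (contDiffAt_pi.2 fun w => h _)

theorem contDiffAt_compContinuousLinearMap [FiniteDimensional ℝ V] {n : ℕ}
    {α : V → V' [⋀^Fin n]→L[ℝ] ℝ}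
    {g : V → V →L[ℝ] V'} {y : V} (hα : ContDiffAt ℝ ∞ α y) (hg : ContDiffAt ℝ ∞ g y) :
    ContDiffAt ℝ ∞ (fun z => (α z).compContinuousLinearMap (g z)) y :=
  contDiffAt_alternating_of_apply fun v =>
    contDiffAt_alternating_apply (v := fun z i => g z (v i)) hα fun _ =>
      hg.clm_apply contDiffAt_const

variable [FiniteDimensional ℝ V]

theorem Form.IsSmooth.contDiffAt {n : ℕ} {θ : Form I N n} (hθ : Form.IsSmooth θ) {x₀ : N} {y : V}
    (hy : y ∈ (extChartAt I x₀).target) : ContDiffAt ℝ ∞ (Form.inChart θ x₀) y :=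
  (hθ x₀).contDiffAt ((isOpen_extChartAt_target x₀).mem_nhds hy)

/-- Smoothness at the centre of every preferred chart suffices, because transition maps carry it to
the other points of a chart. -/
theorem Form.isSmooth_of_contDiffAt {n : ℕ} {θ : Form I N n}
    (h : ∀ x, ContDiffAt ℝ ∞ (Form.inChart θ x) (extChartAt I x x)) : Form.IsSmooth θ := by
  intro x₀ y hy
  refine ContDiffAt.contDiffWithinAt ?_
  set x₁ := (extChartAt I x₀).symm y
  have hx : x₁ ∈ (extChartAt I x₁).source := mem_extChartAt_source x₁
  have hcd : ContDiffAt ℝ ∞ (extChartAt I x₁ ∘ (extChartAt I x₀).symm) y :=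
    contDiffAt_locRep (φ := id) hy contMDiffAt_id hx
  have h2 : ContDiffAt ℝ ∞ (fun z =>
      (Form.inChart θ x₁ ((extChartAt I x₁ ∘ (extChartAt I x₀).symm) z)).compContinuousLinearMap
        (fderiv ℝ (extChartAt I x₁ ∘ (extChartAt I x₀).symm) z)) y :=
    contDiffAt_compContinuousLinearMap (ContDiffAt.comp (g := Form.inChart θ x₁) y (h x₁) hcd)
      (hcd.fderiv_right (m := ∞) (by simp))
  refine h2.congr_of_eventuallyEq ?_
  filter_upwards [eventually_symm_locRep (φ := id) hy continuousAt_id hx] with z hz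
  exact Form.inChart_change θ hz.1 hz.2

theorem Form.IsSmooth.pullback [FiniteDimensional ℝ V'] {n : ℕ} {θ : Form I' N' n} (hθ : Form.IsSmooth θ) {φ : N → N'}
    (hφ : ContMDiff I I' ∞ φ) : Form.IsSmooth (Form.pullback (I := I) φ θ) := by
  refine Form.isSmooth_of_contDiffAt fun x => ?_
  have hy := mem_extChartAt_target (I := I) x
  have hx : φ ((extChartAt I x).symm (extChartAt I x x)) ∈ (extChartAt I' (φ x)).source := by
    rw [extChartAt_to_inv]; exact mem_extChartAt_source _
  have hcd := contDiffAt_locRep hy (hφ _) hx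
  have h2 := contDiffAt_compContinuousLinearMap (ContDiffAt.comp (g := Form.inChart θ (φ x)) (extChartAt I x x)
    (hθ.contDiffAt ((extChartAt I' (φ x)).map_source hx)) hcd)
      (hcd.fderiv_right (m := ∞) (by simp))
  refine h2.congr_of_eventuallyEq ?_
  filter_upwards [eventually_symm_locRep hy (hφ _).continuousAt hx] with z hz
  exact Form.inChart_pullback θ hz.1 (hφ _) hz.2

/-- The exterior derivative is defined at each point in the chart centred there. Naturality of
`extDeriv` under transition maps shows that any other chart computes the same form. -/
theorem Form.inChart_extDer {n : ℕ} {θ : Form I N n} (hθ : Form.IsSmooth θ) {x₀ : N} {y : V}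
    (hy : y ∈ (extChartAt I x₀).target) :
    Form.inChart (Form.extDer θ) x₀ y = extDeriv (Form.inChart θ x₀) y := by
  set x₁ := (extChartAt I x₀).symm y with hx₁
  have hx : x₁ ∈ (extChartAt I x₁).source := mem_extChartAt_source x₁
  have hcd : ContDiffAt ℝ ∞ (extChartAt I x₁ ∘ (extChartAt I x₀).symm) y :=
    contDiffAt_locRep (φ := id) hy contMDiffAt_id hx
  have e1 : Form.inChart θ x₀ =ᶠ[𝓝 y] fun z =>
      (Form.inChart θ x₁ ((extChartAt I x₁ ∘ (extChartAt I x₀).symm) z)).compContinuousLinearMap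
        (fderiv ℝ (extChartAt I x₁ ∘ (extChartAt I x₀).symm) z) := by
    filter_upwards [eventually_symm_locRep (φ := id) hy continuousAt_id hx] with z hz
    exact Form.inChart_change θ hz.1 hz.2
  have hd : DifferentiableAt ℝ (Form.inChart θ x₁)
      ((extChartAt I x₁ ∘ (extChartAt I x₀).symm) y) :=
    (hθ.contDiffAt ((extChartAt I x₁).map_source hx)).differentiableAt (by simp)
  rw [e1.extDeriv_eq, extDeriv_pullback hd hcd (by simpa using ENat.LEInfty.out)]
  rw [Form.inChart_change (Form.extDer θ) hy hx]
  congr 1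
  exact Form.inChart_self (Form.extDer θ) x₁

theorem Form.extDer_eq {n : ℕ} (θ : Form I N n) (x : N) :
    Form.extDer θ x = (extDeriv (Form.inChart θ x) (extChartAt I x x) : V [⋀^Fin (n + 1)]→L[ℝ] ℝ) :=
  rfl

theorem contDiffAt_extDeriv {n : ℕ} {α : V → V [⋀^Fin n]→L[ℝ] ℝ} {y : V}
    (hα : ContDiffAt ℝ ∞ α y) : ContDiffAt ℝ ∞ (extDeriv α) y := by
  let L : (V →L[ℝ] V [⋀^Fin n]→L[ℝ] ℝ) →L[ℝ] V [⋀^Fin (n + 1)]→L[ℝ] ℝ :=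
    ContinuousAlternatingMap.alternatizeUncurryFinCLM ℝ V ℝ
  have h : ContDiffAt ℝ ∞ (fderiv ℝ α) y := hα.fderiv_right (m := ∞) (by simp)
  exact (L.contDiff.contDiffAt (x := fderiv ℝ α y)).comp y h

theorem Form.IsSmooth.extDer {n : ℕ} {θ : Form I N n} (hθ : Form.IsSmooth θ) :
    Form.IsSmooth (Form.extDer θ) := by
  intro x₀ y hy
  refine ((contDiffAt_extDeriv (hθ.contDiffAt hy)).congr_of_eventuallyEq ?_).contDiffWithinAt
  filter_upwards [(isOpen_extChartAt_target x₀).mem_nhds hy] with z hz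
  exact Form.inChart_extDer hθ hz

theorem Form.extDer_pullback [FiniteDimensional ℝ V'] {n : ℕ} {θ : Form I' N' n} (hθ : Form.IsSmooth θ) {φ : N → N'}
    (hφ : ContMDiff I I' ∞ φ) :
    Form.extDer (Form.pullback (I := I) φ θ) = Form.pullback (I := I) φ (Form.extDer θ) := by
  funext x
  have hy := mem_extChartAt_target (I := I) x
  have hx : φ ((extChartAt I x).symm (extChartAt I x x)) ∈ (extChartAt I' (φ x)).source := by
    rw [extChartAt_to_inv]; exact mem_extChartAt_source _
  have hcd := contDiffAt_locRep hy (hφ _) hx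
  rw [← Form.inChart_self (Form.pullback φ (Form.extDer θ)) x, Form.inChart_pullback _ hy (hφ _) hx]
  have ht := (extChartAt I' (φ x)).map_source hx
  have e := Form.inChart_extDer hθ ht
  have e1 : Form.inChart (Form.pullback (I := I) φ θ) x =ᶠ[𝓝 (extChartAt I x x)] fun z =>
      (Form.inChart θ (φ x) ((extChartAt I' (φ x) ∘ φ ∘ (extChartAt I x).symm) z)
        ).compContinuousLinearMap
          (fderiv ℝ (extChartAt I' (φ x) ∘ φ ∘ (extChartAt I x).symm) z) := by
    filter_upwards [eventually_symm_locRep hy (hφ _).continuousAt hx] with z hz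
    exact Form.inChart_pullback θ hz.1 (hφ _) hz.2
  have hd : DifferentiableAt ℝ (Form.inChart θ (φ x))
      ((extChartAt I' (φ x) ∘ φ ∘ (extChartAt I x).symm) (extChartAt I x x)) :=
    (hθ.contDiffAt ht).differentiableAt (by simp)
  rw [Form.extDer_eq, e1.extDeriv_eq, extDeriv_pullback hd hcd (by simpa using ENat.LEInfty.out)]
  congr 1
  exact e.symm

theorem Form.extDer_extDer {n : ℕ} {θ : Form I N n} (hθ : Form.IsSmooth θ) :
    Form.extDer (Form.extDer θ) = 0 := by
  funext x
  have hy := mem_extChartAt_target (I := I) x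
  have e1 : Form.inChart (Form.extDer θ) x =ᶠ[𝓝 (extChartAt I x x)]
      extDeriv (Form.inChart θ x) := by
    filter_upwards [(isOpen_extChartAt_target x).mem_nhds hy] with z hz
    exact Form.inChart_extDer hθ hz
  rw [Form.extDer_eq, e1.extDeriv_eq, extDeriv_extDeriv_apply (hθ.contDiffAt hy)
    (by simpa using ENat.LEInfty.out)]
  rfl

theorem Form.inChart_add {n : ℕ} (θ θ' : Form I N n) (x₀ : N) :
    Form.inChart (θ + θ') x₀ = Form.inChart θ x₀ + Form.inChart θ' x₀ := rfl

theorem Form.inChart_smul {n : ℕ} (c : ℝ) (θ : Form I N n) (x₀ : N) :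
    Form.inChart (c • θ) x₀ = c • Form.inChart θ x₀ := rfl

theorem Form.IsSmooth.add {n : ℕ} {θ θ' : Form I N n} (hθ : Form.IsSmooth θ)
    (hθ' : Form.IsSmooth θ') : Form.IsSmooth (θ + θ') := fun x => by
  rw [Form.inChart_add]; exact (hθ x).add (hθ' x)

theorem Form.IsSmooth.const_smul {n : ℕ} {θ : Form I N n} (c : ℝ) (hθ : Form.IsSmooth θ) :
    Form.IsSmooth (c • θ) := fun x => by
  rw [Form.inChart_smul]; exact contDiffOn_const.smul (hθ x)

theorem Form.isSmooth_zero {n : ℕ} : Form.IsSmooth (0 : Form I N n) := fun x => by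
  have : Form.inChart (0 : Form I N n) x = 0 := rfl
  rw [this]; exact contDiffOn_const

theorem Form.IsSmooth.neg {n : ℕ} {θ : Form I N n} (hθ : Form.IsSmooth θ) :
    Form.IsSmooth (-θ) := by
  have := hθ.const_smul (-1)
  rwa [neg_one_smul ℝ θ] at this

theorem Form.IsSmooth.sub {n : ℕ} {θ θ' : Form I N n} (hθ : Form.IsSmooth θ)
    (hθ' : Form.IsSmooth θ') : Form.IsSmooth (θ - θ') := by
  rw [sub_eq_add_neg]; exact hθ.add hθ'.neg

theorem Form.extDer_add {n : ℕ} {θ θ' : Form I N n} (hθ : Form.IsSmooth θ)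
    (hθ' : Form.IsSmooth θ') : Form.extDer (θ + θ') = Form.extDer θ + Form.extDer θ' := by
  funext x
  have hy := mem_extChartAt_target (I := I) x
  exact extDeriv_add ((hθ.contDiffAt hy).differentiableAt (by simp))
    ((hθ'.contDiffAt hy).differentiableAt (by simp))

theorem Form.extDer_smul {n : ℕ} (c : ℝ) (θ : Form I N n) :
    Form.extDer (c • θ) = c • Form.extDer θ := by
  funext x
  exact extDeriv_smul c (Form.inChart θ x)

theorem Form.extDer_zero {n : ℕ} : Form.extDer (0 : Form I N n) = 0 := by
  have := Form.extDer_smul (0 : ℝ) (0 : Form I N n)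
  rwa [zero_smul, zero_smul] at this

theorem Form.extDer_neg {n : ℕ} (θ : Form I N n) :
    Form.extDer (-θ) = -Form.extDer θ := by
  have := Form.extDer_smul (-1) θ
  rwa [neg_one_smul ℝ θ, neg_one_smul ℝ (Form.extDer θ)] at this

theorem Form.extDer_sub {n : ℕ} {θ θ' : Form I N n} (hθ : Form.IsSmooth θ)
    (hθ' : Form.IsSmooth θ') : Form.extDer (θ - θ') = Form.extDer θ - Form.extDer θ' := by
  rw [sub_eq_add_neg, Form.extDer_add hθ hθ'.neg, Form.extDer_neg, ← sub_eq_add_neg]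

/-- Every point and every tuple of tangent vectors of the target is an image, so the pullback sees
all values of the form. The uniqueness and descent arguments rest on this. -/
theorem Form.pullback_injective {n : ℕ} {φ : N → N'} (hs : Function.Surjective φ)
    (hd : ∀ x, Function.Surjective (mfderiv I I' φ x)) :
    Function.Injective (Form.pullback (I := I) (I' := I') (n := n) φ) := by
  intro θ θ' h
  funext z
  obtain ⟨x, rfl⟩ := hs z
  refine ContinuousAlternatingMap.ext fun v => ?_
  choose w hw using fun i => hd x (v i)
  have := congrArg (fun L : V [⋀^Fin n]→L[ℝ] ℝ => L w) (congrFun h x)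
  have h1 := (Form.pullback_apply (I := I) φ θ x w).symm.trans
    (this.trans (Form.pullback_apply (I := I) φ θ' x w))
  have hw' : (fun i => (mfderiv I I' φ x (w i) : V')) = v := funext hw
  rw [hw'] at h1
  exact h1

theorem Form.pullback_pullback {n : ℕ} {φ : N → N'} {ψ : N' → N''} (θ : Form I'' N'' n)
    (hφ : MDifferentiable I I' φ) (hψ : MDifferentiable I' I'' ψ) :
    Form.pullback (I := I) φ (Form.pullback (I := I') ψ θ) = Form.pullback (I := I) (ψ ∘ φ) θ := by
  funext x
  refine ContinuousAlternatingMap.ext fun v => ?_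
  refine (Form.pullback_apply (I := I) φ _ x v).trans ?_
  refine (Form.pullback_apply (I := I') ψ _ _ _).trans ?_
  refine Eq.trans ?_ (Form.pullback_apply (I := I) (ψ ∘ φ) θ x v).symm
  refine Form.apply_congr θ rfl ?_
  funext i
  rw [mfderiv_comp x (hψ _) (hφ _)]; rfl

end FormsLibrary

/-! ### Cartan's formula in a normed space. -/

section Cartan

variable {V : Type*} [NormedAddCommGroup V] [NormedSpace ℝ V]

theorem hasFDerivAt_contractSucc {n : ℕ} {α : V → V [⋀^Fin (n + 1)]→L[ℝ] ℝ} {X : V → V} {y : V}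
    (hα : DifferentiableAt ℝ α y) (hX : DifferentiableAt ℝ X y) :
    ∃ D : V →L[ℝ] V [⋀^Fin n]→L[ℝ] ℝ, HasFDerivAt (fun z => contractSucc (α z) (X z)) D y ∧
      ∀ (w : V) (u : Fin n → V), D w u =
        fderiv ℝ α y w (Fin.cons (X y) u) + α y (Fin.cons (fderiv ℝ X y w) u) := by
  let L : (V [⋀^Fin (n + 1)]→L[ℝ] ℝ) →L[ℝ] (V →L[ℝ] V [⋀^Fin n]→L[ℝ] ℝ) :=
    (ContinuousAlternatingMap.curryLeftLI (𝕜 := ℝ) (E := V) (F := ℝ)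
      (n := n)).toContinuousLinearMap
  have h1 : HasFDerivAt (fun z => L (α z)) (L.comp (fderiv ℝ α y)) y :=
    HasFDerivAt.comp (𝕜 := ℝ) (F := V [⋀^Fin (n + 1)]→L[ℝ] ℝ) (G := V →L[ℝ] V [⋀^Fin n]→L[ℝ] ℝ)
      (g := L) y (ContinuousLinearMap.hasFDerivAt (𝕜 := ℝ)
      (E := V [⋀^Fin (n + 1)]→L[ℝ] ℝ) (F := V →L[ℝ] V [⋀^Fin n]→L[ℝ] ℝ) L) hα.hasFDerivAt
  refine ⟨_, h1.clm_apply hX.hasFDerivAt, fun w u => ?_⟩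
  exact add_comm _ _

theorem removeNth_succ_cons {n : ℕ} (i : Fin (n + 1)) (X : V) (v : Fin (n + 1) → V) :
    (i.succ.removeNth (Fin.cons X v : Fin (n + 2) → V) : Fin (n + 1) → V) =
      Fin.cons X (i.removeNth v) := by
  funext j
  refine Fin.cases rfl (fun j => ?_) j
  simp [Fin.removeNth]

theorem fderiv_alternating_apply {n : ℕ} {α : V → V [⋀^Fin n]→L[ℝ] ℝ} {y : V}
    (hα : DifferentiableAt ℝ α y) (u : Fin n → V) (w : V) :
    fderiv ℝ (fun z => α z u) y w = fderiv ℝ α y w u := by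
  have h := (ContinuousAlternatingMap.apply ℝ V ℝ u).hasFDerivAt.comp y hα.hasFDerivAt
  exact congrArg (fun L : V →L[ℝ] ℝ => L w) h.fderiv

theorem cartan_zero {α : V → V [⋀^Fin 0]→L[ℝ] ℝ} {y : V} (hα : DifferentiableAt ℝ α y)
    (X : V) (v : Fin 0 → V) : extDeriv α y (Fin.cons X v) = fderiv ℝ α y X v := by
  rw [extDeriv_apply hα, Fin.sum_univ_succ]
  simp only [fderiv_alternating_apply hα]
  simp

theorem extDeriv_cons {n : ℕ} {α : V → V [⋀^Fin (n + 1)]→L[ℝ] ℝ} {y : V}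
    (hα : DifferentiableAt ℝ α y) (X : V) (v : Fin (n + 1) → V) :
    extDeriv α y (Fin.cons X v) = fderiv ℝ α y X v -
      ∑ i : Fin (n + 1), (-1) ^ i.val • fderiv ℝ α y (v i) (Fin.cons X (i.removeNth v)) := by
  rw [extDeriv_apply hα, Fin.sum_univ_succ]
  simp only [fderiv_alternating_apply hα, removeNth_succ_cons, Fin.cons_succ, Fin.val_succ, pow_succ]
  rw [sub_eq_add_neg, ← Finset.sum_neg_distrib]
  congr 1
  · simp
  · exact Finset.sum_congr rfl fun i _ => by simp

/-- The terms differentiating `α` along `v i` cancel between `d i_X` and `i_X d`. What remains is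
the coordinate form of the Lie derivative. -/
theorem cartan_succ {n : ℕ} {α : V → V [⋀^Fin (n + 1)]→L[ℝ] ℝ} {X : V → V} {y : V}
    (hα : DifferentiableAt ℝ α y) (hX : DifferentiableAt ℝ X y) (v : Fin (n + 1) → V) :
    extDeriv (fun z => contractSucc (α z) (X z)) y v + extDeriv α y (Fin.cons (X y) v) =
      fderiv ℝ α y (X y) v + ∑ i, α y (Function.update v i (fderiv ℝ X y (v i))) := by
  obtain ⟨D, hD, hD'⟩ := hasFDerivAt_contractSucc hα hX
  rw [extDeriv_cons hα, extDeriv_apply hD.differentiableAt]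
  simp only [fderiv_alternating_apply hD.differentiableAt, hD.fderiv, hD', smul_add,
    Finset.sum_add_distrib]
  -- The sign is that of moving the first argument into slot `i`.
  have h : ∀ i : Fin (n + 1), (-1 : ℤ) ^ i.val • (α y) (Fin.cons (fderiv ℝ X y (v i)) (i.removeNth v))
      = α y (Function.update v i (fderiv ℝ X y (v i))) := fun i => by
    rw [← Fin.insertNth_removeNth, ContinuousAlternatingMap.map_insertNth]
    simp [Matrix.vecCons]
  simp only [h]
  ring

end Cartan

/-! ### Vector fields in charts, interior products and Lie derivatives. -/

section Contraction

variable {V : Type*} [NormedAddCommGroup V] [NormedSpace ℝ V] {H : Type*} [TopologicalSpace H]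
  {I : ModelWithCorners ℝ V H} {N : Type*} [TopologicalSpace N] [ChartedSpace H N]
  {V' : Type*} [NormedAddCommGroup V'] [NormedSpace ℝ V'] {H' : Type*} [TopologicalSpace H']
  {I' : ModelWithCorners ℝ V' H'} {N' : Type*} [TopologicalSpace N'] [ChartedSpace H' N']

theorem Form.interiorSucc_apply {n : ℕ} (X : ∀ x : N, TangentSpace I x) (θ : Form I N (n + 1))
    (x : N) (v : Fin n → V) : (Form.interiorSucc X θ x : V [⋀^Fin n]→L[ℝ] ℝ) v =
      (θ x : V [⋀^Fin (n + 1)]→L[ℝ] ℝ) (Fin.cons (X x : V) v) := rfl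

theorem Form.interiorSucc_pullback {n : ℕ} {φ : N → N'} {X : ∀ x : N, TangentSpace I x}
    {X' : ∀ x : N', TangentSpace I' x} (h : ∀ x, mfderiv I I' φ x (X x) = X' (φ x))
    (θ : Form I' N' (n + 1)) : Form.interiorSucc X (Form.pullback (I := I) φ θ) =
      Form.pullback (I := I) φ (Form.interiorSucc X' θ) := by
  funext x
  refine ContinuousAlternatingMap.ext fun v => ?_
  refine (Form.pullback_apply (I := I) φ θ x (Fin.cons (X x : V) v : Fin (n + 1) → V)).trans ?_
  refine Eq.trans ?_ (Form.pullback_apply (I := I) φ (Form.interiorSucc X' θ) x v).symm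
  refine Form.apply_congr θ rfl ?_
  funext i
  refine Fin.cases ?_ (fun i => ?_) i
  · exact h x
  · rfl

/-- A vector field in the preferred chart around `x₀`. -/
noncomputable def vectorFieldInChart (X : ∀ x : N, TangentSpace I x) (x₀ : N) (y : V) : V :=
  mfderiv I 𝓘(ℝ, V) (extChartAt I x₀) ((extChartAt I x₀).symm y) (X ((extChartAt I x₀).symm y))

/-- Smoothness of a vector field, in charts. -/
def IsSmoothVectorField (X : ∀ x : N, TangentSpace I x) : Prop :=
  ∀ (x₀ : N) (y : V), y ∈ (extChartAt I x₀).target →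
    ContDiffAt ℝ ∞ (vectorFieldInChart (I := I) X x₀) y

variable [I.Boundaryless] [I'.Boundaryless] [IsManifold I ∞ N] [IsManifold I' ∞ N']

/-- The preferred trivialization of the tangent bundle at `x₀` is the derivative of the chart at
`x₀`, so its fibre component is the field read in that chart. -/
theorem isSmoothVectorField_of_contMDiff {X : ∀ x : N, TangentSpace I x}
    (hX : ContMDiff I (I.prod 𝓘(ℝ, V)) ∞ (fun x => (⟨x, X x⟩ : TangentBundle I N))) :
    IsSmoothVectorField X := by
  intro x₀ y hy
  have hs := (extChartAt I x₀).map_target hy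
  have hs' : (extChartAt I x₀).symm y ∈ (trivializationAt V (TangentSpace I) x₀).baseSet := by
    rwa [extChartAt_source] at hs
  have h := (Bundle.Trivialization.contMDiffAt_section_iff (IB := I) (n := ∞)
    (trivializationAt V (TangentSpace I) x₀) (s := X) hs').1 (hX _)
  have h2 := ContMDiffAt.comp y h (contMDiffAt_extChartAt_symm hy)
  rw [contMDiffAt_iff_contDiffAt] at h2
  refine h2.congr_of_eventuallyEq ?_
  filter_upwards [(isOpen_extChartAt_target x₀).mem_nhds hy] with z hz
  have hz' := (extChartAt I x₀).map_target hz
  rw [extChartAt_source] at hz'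
  have e := TangentBundle.continuousLinearMapAt_trivializationAt (I := I) hz'
  refine (congrArg (fun L : V →L[ℝ] V => L (X ((extChartAt I x₀).symm z))) e).symm.trans ?_
  exact Trivialization.continuousLinearMapAt_apply_of_mem (R := ℝ) (e := trivializationAt V (TangentSpace I) x₀) hz' _

theorem vectorFieldInChart_self (X : ∀ x : N, TangentSpace I x) (x : N) :
    vectorFieldInChart X x (extChartAt I x x) = (X x : V) := by
  have h : ∀ x', x' = x →
      (mfderiv I 𝓘(ℝ, V) (extChartAt I x) x' (X x') : V) = (X x : V) := by
    rintro x' rfl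
    rw [mfderiv_extChartAt_self]; rfl
  exact h _ (extChartAt_to_inv x)

theorem mfderiv_symm_vectorFieldInChart (X : ∀ x : N, TangentSpace I x) {x₀ : N} {y : V}
    (hy : y ∈ (extChartAt I x₀).target) :
    (mfderiv 𝓘(ℝ, V) I (extChartAt I x₀).symm y : V →L[ℝ] V) (vectorFieldInChart X x₀ y : V) =
      (X ((extChartAt I x₀).symm y) : V) := by
  have h := mfderivWithin_extChartAt_symm_comp_mfderiv_extChartAt' (I := I)
    ((extChartAt I x₀).map_target hy)
  rw [I.range_eq_univ, mfderivWithin_univ, (extChartAt I x₀).right_inv hy] at h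
  exact congrArg (fun L : V →L[ℝ] V => L (X ((extChartAt I x₀).symm y))) h

theorem Form.inChart_interiorSucc {n : ℕ} (X : ∀ x : N, TangentSpace I x) (θ : Form I N (n + 1))
    {x₀ : N} {y : V} (hy : y ∈ (extChartAt I x₀).target) :
    Form.inChart (Form.interiorSucc X θ) x₀ y =
      contractSucc (Form.inChart θ x₀ y) (vectorFieldInChart X x₀ y) := by
  refine ContinuousAlternatingMap.ext fun v => ?_
  refine (Form.inChart_apply _ _ _ _).trans ((Form.interiorSucc_apply X θ _ _).trans ?_)
  refine Eq.trans ?_ (Form.inChart_apply θ x₀ y (Fin.cons (vectorFieldInChart X x₀ y) v)).symm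
  refine Form.apply_congr θ rfl ?_
  funext i
  refine Fin.cases ?_ (fun i => ?_) i
  · exact (mfderiv_symm_vectorFieldInChart X hy).symm
  · rfl

variable [FiniteDimensional ℝ V]

theorem Form.IsSmooth.interiorSucc {n : ℕ} {θ : Form I N (n + 1)} (hθ : Form.IsSmooth θ)
    {X : ∀ x : N, TangentSpace I x} (hX : IsSmoothVectorField X) :
    Form.IsSmooth (Form.interiorSucc X θ) := by
  refine Form.isSmooth_of_contDiffAt fun x => ?_
  have hy := mem_extChartAt_target (I := I) x
  have h : ContDiffAt ℝ ∞ (fun z => contractSucc (Form.inChart θ x z) (vectorFieldInChart X x z))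
      (extChartAt I x x) := by
    refine contDiffAt_alternating_of_apply fun v => ?_
    refine contDiffAt_alternating_apply
      (v := fun z => (Fin.cons (vectorFieldInChart X x z) v : Fin (n + 1) → V))
      (hθ.contDiffAt hy) fun i => ?_
    refine Fin.cases ?_ (fun i => ?_) i
    · exact hX x _ hy
    · exact contDiffAt_const
  refine h.congr_of_eventuallyEq ?_
  filter_upwards [(isOpen_extChartAt_target x).mem_nhds hy] with z hz
  exact Form.inChart_interiorSucc X θ hz

theorem Form.interiorSucc_add {n : ℕ} (X : ∀ x : N, TangentSpace I x) (θ θ' : Form I N (n + 1)) :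
    Form.interiorSucc X (θ + θ') = Form.interiorSucc X θ + Form.interiorSucc X θ' := rfl

theorem Form.interiorSucc_zero {n : ℕ} (X : ∀ x : N, TangentSpace I x) :
    Form.interiorSucc X (0 : Form I N (n + 1)) = 0 := rfl

theorem Form.lieDer_zero_eq (X : ∀ x : N, TangentSpace I x) (θ : Form I N 0) :
    Form.lieDer X θ = Form.interiorSucc X (Form.extDer θ) := rfl

theorem Form.lieDer_succ_eq {n : ℕ} (X : ∀ x : N, TangentSpace I x) (θ : Form I N (n + 1)) :
    Form.lieDer X θ =
      Form.extDer (Form.interiorSucc X θ) + Form.interiorSucc X (Form.extDer θ) := rfl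

theorem Form.IsSmooth.lieDer {n : ℕ} {θ : Form I N n} (hθ : Form.IsSmooth θ)
    {X : ∀ x : N, TangentSpace I x} (hX : IsSmoothVectorField X) :
    Form.IsSmooth (Form.lieDer X θ) := by
  cases n with
  | zero => exact hθ.extDer.interiorSucc hX
  | succ n => exact (hθ.interiorSucc hX).extDer.add (hθ.extDer.interiorSucc hX)

theorem Form.lieDer_add {n : ℕ} {θ θ' : Form I N n} (hθ : Form.IsSmooth θ)
    (hθ' : Form.IsSmooth θ') {X : ∀ x : N, TangentSpace I x} (hX : IsSmoothVectorField X) :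
    Form.lieDer X (θ + θ') = Form.lieDer X θ + Form.lieDer X θ' := by
  cases n with
  | zero => simp only [Form.lieDer_zero_eq, Form.extDer_add hθ hθ', Form.interiorSucc_add]
  | succ n =>
    simp only [Form.lieDer_succ_eq, Form.extDer_add hθ hθ', Form.interiorSucc_add,
      Form.extDer_add (hθ.interiorSucc hX) (hθ'.interiorSucc hX)]
    abel

theorem Form.lieDer_zero {n : ℕ} (X : ∀ x : N, TangentSpace I x) :
    Form.lieDer X (0 : Form I N n) = 0 := by
  cases n with
  | zero => rw [Form.lieDer_zero_eq, Form.extDer_zero, Form.interiorSucc_zero]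
  | succ n => rw [Form.lieDer_succ_eq, Form.extDer_zero, Form.interiorSucc_zero,
      Form.interiorSucc_zero, Form.extDer_zero, add_zero]

theorem Form.lieDer_extDer {n : ℕ} {θ : Form I N n} (hθ : Form.IsSmooth θ)
    {X : ∀ x : N, TangentSpace I x} (hX : IsSmoothVectorField X) :
    Form.lieDer X (Form.extDer θ) = Form.extDer (Form.lieDer X θ) := by
  rw [Form.lieDer_succ_eq, Form.extDer_extDer hθ, Form.interiorSucc_zero, add_zero]
  cases n with
  | zero => rfl
  | succ n =>
    rw [Form.lieDer_succ_eq, Form.extDer_add (hθ.interiorSucc hX).extDer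
      (hθ.extDer.interiorSucc hX), Form.extDer_extDer (hθ.interiorSucc hX), zero_add]

/-- For related vector fields both interior product and `d` commute with pullback, hence so does the
Cartan expression. -/
theorem Form.lieDer_pullback [FiniteDimensional ℝ V'] {n : ℕ} {φ : N → N'}
    (hφ : ContMDiff I I' ∞ φ) {X : ∀ x : N, TangentSpace I x}
    {X' : ∀ x : N', TangentSpace I' x} (h : ∀ x, mfderiv I I' φ x (X x) = X' (φ x))
    (hX' : IsSmoothVectorField X') {θ : Form I' N' n} (hθ : Form.IsSmooth θ) :
    Form.lieDer X (Form.pullback (I := I) φ θ) =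
      Form.pullback (I := I) φ (Form.lieDer X' θ) := by
  cases n with
  | zero =>
    rw [Form.lieDer_zero_eq, Form.extDer_pullback hθ hφ, Form.interiorSucc_pullback h]; rfl
  | succ n =>
    rw [Form.lieDer_succ_eq, Form.extDer_pullback hθ hφ, Form.interiorSucc_pullback h,
      Form.interiorSucc_pullback h, Form.extDer_pullback (hθ.interiorSucc hX') hφ]; rfl

/-- This coordinate expression is the one matched with the derivative of an evaluation map on
`T^{⊕k} M`, and with the derivative of the homothety identity for the Euler field. -/
theorem Form.lieDer_apply {n : ℕ} {θ : Form I N n} (hθ : Form.IsSmooth θ)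
    {X : ∀ x : N, TangentSpace I x} (hX : IsSmoothVectorField X) (x : N) (v : Fin n → V) :
    (Form.lieDer X θ x : V [⋀^Fin n]→L[ℝ] ℝ) v =
      fderiv ℝ (Form.inChart θ x) (extChartAt I x x) (X x) v +
        ∑ i, (θ x : V [⋀^Fin n]→L[ℝ] ℝ) (Function.update v i
          (fderiv ℝ (vectorFieldInChart X x) (extChartAt I x x) (v i))) := by
  have hy := mem_extChartAt_target (I := I) x
  have hα := (hθ.contDiffAt hy).differentiableAt (by simp)
  have hd := (hX x _ hy).differentiableAt (by simp)
  cases n with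
  | zero =>
    refine (cartan_zero hα (X x) v).trans ?_
    simp
  | succ n =>
    have e : Form.inChart (Form.interiorSucc X θ) x =ᶠ[𝓝 (extChartAt I x x)]
        fun z => contractSucc (Form.inChart θ x z) (vectorFieldInChart X x z) := by
      filter_upwards [(isOpen_extChartAt_target x).mem_nhds hy] with z hz
      exact Form.inChart_interiorSucc X θ hz
    have k := cartan_succ hα hd v
    rw [vectorFieldInChart_self, Form.inChart_self, ← e.extDeriv_eq] at k
    exact k

end Contraction

/-! ### Derivatives as linear maps of model spaces. -/

section LocalRepresentation

variable {V : Type*} [NormedAddCommGroup V] [NormedSpace ℝ V] {H : Type*} [TopologicalSpace H]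
  {I : ModelWithCorners ℝ V H} {N : Type*} [TopologicalSpace N] [ChartedSpace H N]
  {V' : Type*} [NormedAddCommGroup V'] [NormedSpace ℝ V'] {H' : Type*} [TopologicalSpace H']
  {I' : ModelWithCorners ℝ V' H'} {N' : Type*} [TopologicalSpace N'] [ChartedSpace H' N']
  {V'' : Type*} [NormedAddCommGroup V''] [NormedSpace ℝ V''] {H'' : Type*} [TopologicalSpace H'']
  {I'' : ModelWithCorners ℝ V'' H''} {N'' : Type*} [TopologicalSpace N''] [ChartedSpace H'' N'']

variable (I I') in
/-- The derivative of a map, as a continuous linear map between the model spaces. -/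
noncomputable def modelDeriv (φ : N → N') (x : N) : V →L[ℝ] V' := mfderiv I I' φ x

theorem modelDeriv_comp {φ : N → N'} {ψ : N' → N''} (x : N)
    (hψ : MDifferentiableAt I' I'' ψ (φ x)) (hφ : MDifferentiableAt I I' φ x) :
    modelDeriv I I'' (ψ ∘ φ) x = (modelDeriv I' I'' ψ (φ x)).comp (modelDeriv I I' φ x) :=
  mfderiv_comp x hψ hφ

theorem modelDeriv_id (x : N) : modelDeriv I I (id : N → N) x = ContinuousLinearMap.id ℝ V :=
  mfderiv_id

theorem modelDeriv_const (x : N) (c : N') : modelDeriv I I' (fun _ : N => c) x = 0 :=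
  mfderiv_const

theorem modelDeriv_congr {φ ψ : N → N'} {x : N} (h : φ =ᶠ[𝓝 x] ψ) :
    modelDeriv I I' φ x = modelDeriv I I' ψ x := h.mfderiv_eq

variable [I.Boundaryless]

theorem modelDeriv_eq_fderiv {φ : N → N'} {x : N} (hφ : MDifferentiableAt I I' φ x) :
    modelDeriv I I' φ x =
      fderiv ℝ (extChartAt I' (φ x) ∘ φ ∘ (extChartAt I x).symm) (extChartAt I x x) := by
  have h : modelDeriv I I' φ x =
      fderivWithin ℝ (writtenInExtChartAt I I' x φ) (range I) (extChartAt I x x) := if_pos hφ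
  rw [h, I.range_eq_univ, fderivWithin_univ]
  rfl

theorem differentiableAt_locRep {φ : N → N'} {x : N} (hφ : MDifferentiableAt I I' φ x) :
    DifferentiableAt ℝ (extChartAt I' (φ x) ∘ φ ∘ (extChartAt I x).symm) (extChartAt I x x) := by
  have := hφ.differentiableWithinAt_writtenInExtChartAt
  rwa [I.range_eq_univ, differentiableWithinAt_univ] at this

end LocalRepresentation

/-! ### Coordinates and derivatives on the total space of a vector bundle. -/

section Coordinates

variable {B : Type*} [NormedAddCommGroup B] [NormedSpace ℝ B]
  {M : Type*} [TopologicalSpace M] [ChartedSpace B M] [IsManifold 𝓘(ℝ, B) ∞ M]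
  {F : Type*} [NormedAddCommGroup F] [NormedSpace ℝ F]
  {E : M → Type*} [TopologicalSpace (TotalSpace F E)] [∀ x, AddCommGroup (E x)]
  [∀ x, Module ℝ (E x)] [∀ x, TopologicalSpace (E x)] [FiberBundle F E] [VectorBundle ℝ F E]
  [ContMDiffVectorBundle ∞ F E 𝓘(ℝ, B)]
  {V : Type*} [NormedAddCommGroup V] [NormedSpace ℝ V] {H : Type*} [TopologicalSpace H]
  {I : ModelWithCorners ℝ V H} {N : Type*} [TopologicalSpace N] [ChartedSpace H N]
  [I.Boundaryless]

variable (F E) in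
/-- The coordinate of a point of the fibre over `x` in the preferred trivialization at `x`. -/
noncomputable def fiberCoord (x : M) : E x ≃L[ℝ] F :=
  (trivializationAt F E x).continuousLinearEquivAt ℝ x (mem_baseSet_trivializationAt F E x)

theorem fiberCoord_apply (x : M) (u : E x) :
    fiberCoord F E x u = (trivializationAt F E x ⟨x, u⟩).2 := rfl

theorem extChartAt_tot_apply (p r : TotalSpace F E)
    (hr : r.1 ∈ (trivializationAt F E p.1).baseSet) :
    extChartAt (totModel B F) p r =
      (extChartAt 𝓘(ℝ, B) p.1 r.1, (trivializationAt F E p.1 r).2) := by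
  rw [FiberBundle.extChartAt]
  refine Prod.ext ?_ rfl
  exact congrArg (extChartAt 𝓘(ℝ, B) p.1) ((trivializationAt F E p.1).coe_fst' hr)

theorem extChartAt_tot_self (p : TotalSpace F E) : extChartAt (totModel B F) p p =
    (extChartAt 𝓘(ℝ, B) p.1 p.1, fiberCoord F E p.1 p.2) :=
  extChartAt_tot_apply p p (mem_baseSet_trivializationAt F E p.1)

/-- The preferred chart depends on the base point only. Hence one chart serves a whole fibre, and
fibrewise homogeneity can be read in fixed coordinates. -/
theorem extChartAt_tot_congr (x : M) (u u' : E x) :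
    extChartAt (totModel B F) (⟨x, u⟩ : TotalSpace F E) = extChartAt (totModel B F) ⟨x, u'⟩ := by
  rw [FiberBundle.extChartAt, FiberBundle.extChartAt]

theorem mem_extChartAt_tot_source (p r : TotalSpace F E) :
    r ∈ (extChartAt (totModel B F) p).source ↔
      r.1 ∈ (trivializationAt F E p.1).baseSet ∧ r.1 ∈ (extChartAt 𝓘(ℝ, B) p.1).source := by
  rw [FiberBundle.extChartAt]
  simp only [PartialEquiv.trans_source, PartialEquiv.prod_source, PartialEquiv.refl_source]
  constructor
  · rintro ⟨h1, h2⟩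
    have h1' : r.1 ∈ (trivializationAt F E p.1).baseSet :=
      (trivializationAt F E p.1).mem_source.1 h1
    refine ⟨h1', ?_⟩
    have h3 : (trivializationAt F E p.1 r).1 ∈ (extChartAt 𝓘(ℝ, B) p.1).source := h2.1
    rwa [(trivializationAt F E p.1).coe_fst' h1'] at h3
  · rintro ⟨h1, h2⟩
    refine ⟨(trivializationAt F E p.1).mem_source.2 h1, ?_, mem_univ _⟩
    show (trivializationAt F E p.1 r).1 ∈ (extChartAt 𝓘(ℝ, B) p.1).source
    rwa [(trivializationAt F E p.1).coe_fst' h1]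

/-- The first component, in the preferred charts, of the derivative of a map to a bundle. -/
theorem modelDeriv_tot_fst {f : N → TotalSpace F E} {x : N} (hf : MDifferentiableAt I (totModel B F) f x)
    (v : V) : ((modelDeriv I (totModel B F) f x) v).1 =
      (modelDeriv I 𝓘(ℝ, B) (fun z => (f z).1) x) v := by
  have hp : MDifferentiableAt I 𝓘(ℝ, B) (fun z => (f z).1) x :=
    ((contMDiff_proj (n := 1) E).mdifferentiableAt one_ne_zero).comp x hf
  rw [modelDeriv_eq_fderiv hf, modelDeriv_eq_fderiv hp]
  have hd := differentiableAt_locRep hf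
  have h1 : HasFDerivAt (fun z => ((extChartAt (totModel B F) (f x) ∘ f ∘ (extChartAt I x).symm) z).1)
      ((ContinuousLinearMap.fst ℝ B F).comp (fderiv ℝ (extChartAt (totModel B F) (f x) ∘ f ∘
        (extChartAt I x).symm) (extChartAt I x x))) (extChartAt I x x) :=
    (ContinuousLinearMap.fst ℝ B F).hasFDerivAt.comp _ hd.hasFDerivAt
  refine congrArg (fun L : V →L[ℝ] B => L v) (h1.fderiv.symm.trans ?_)
  refine Filter.EventuallyEq.fderiv_eq ?_
  have hc : ContinuousAt (fun z => (f z).1) x := hp.continuousAt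
  have hc2 : ContinuousAt (fun z => (f ((extChartAt I x).symm z)).1) (extChartAt I x x) := by
    refine ContinuousAt.comp (g := fun z => (f z).1) ?_ (continuousAt_extChartAt_symm x)
    rwa [extChartAt_to_inv]
  have hb : (f ((extChartAt I x).symm (extChartAt I x x))).1 ∈
      (trivializationAt F E (f x).1).baseSet := by
    rw [extChartAt_to_inv]; exact mem_baseSet_trivializationAt F E _
  filter_upwards [hc2.preimage_mem_nhds ((trivializationAt F E (f x).1).open_baseSet.mem_nhds hb)]
    with z hz
  exact congrArg Prod.fst (extChartAt_tot_apply (f x) (f ((extChartAt I x).symm z)) hz)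

/-- The second component, in the preferred charts, of the derivative of a map to a bundle. -/
theorem modelDeriv_tot_snd {f : N → TotalSpace F E} {x : N} (hf : MDifferentiableAt I (totModel B F) f x)
    (v : V) : ((modelDeriv I (totModel B F) f x) v).2 =
      fderiv ℝ (fun z => (trivializationAt F E (f x).1 (f ((extChartAt I x).symm z))).2)
        (extChartAt I x x) v := by
  rw [modelDeriv_eq_fderiv hf]
  have hd := differentiableAt_locRep hf
  have h1 : HasFDerivAt (fun z => ((extChartAt (totModel B F) (f x) ∘ f ∘ (extChartAt I x).symm) z).2)
      ((ContinuousLinearMap.snd ℝ B F).comp (fderiv ℝ (extChartAt (totModel B F) (f x) ∘ f ∘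
        (extChartAt I x).symm) (extChartAt I x x))) (extChartAt I x x) :=
    (ContinuousLinearMap.snd ℝ B F).hasFDerivAt.comp _ hd.hasFDerivAt
  refine congrArg (fun L : V →L[ℝ] F => L v) (h1.fderiv.symm.trans ?_)
  congr 1

theorem modelDeriv_proj (p : TotalSpace F E) (w : B × F) :
    (modelDeriv (totModel B F) 𝓘(ℝ, B) (TotalSpace.proj : TotalSpace F E → M) p) w =
      w.1 := by
  have h := modelDeriv_tot_fst (f := (id : TotalSpace F E → TotalSpace F E)) (x := p)
    (I := totModel B F) mdifferentiableAt_id w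
  rw [modelDeriv_id] at h
  exact h.symm

theorem contMDiff_fiberLine {x : M} (u w : E x) : ContMDiff 𝓘(ℝ, ℝ) (totModel B F) ∞
    (fun t : ℝ => (⟨x, u + t • w⟩ : TotalSpace F E)) := by
  intro t
  rw [contMDiffAt_totalSpace]
  refine ⟨contMDiffAt_const, ?_⟩
  have h : (fun t : ℝ => (trivializationAt F E x ⟨x, u + t • w⟩).2) =
      fun t : ℝ => fiberCoord F E x u + t • fiberCoord F E x w := by
    funext t
    rw [← fiberCoord_apply, map_add, map_smul]
  show ContMDiffAt 𝓘(ℝ, ℝ) 𝓘(ℝ, F) ∞ (fun t : ℝ => (trivializationAt F E x ⟨x, u + t • w⟩).2) t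
  rw [h, contMDiffAt_iff_contDiffAt]
  fun_prop

theorem modelDeriv_fiberLine {x : M} (u w : E x) :
    (modelDeriv 𝓘(ℝ, ℝ) (totModel B F) (fun t : ℝ => (⟨x, u + t • w⟩ : TotalSpace F E)) 0 :
      ℝ →L[ℝ] B × F) 1 = (0, fiberCoord F E x w) := by
  have hd := (contMDiff_fiberLine (B := B) (F := F) u w).mdifferentiableAt (x := 0) (by simp)
  refine Prod.ext ?_ ?_
  · rw [modelDeriv_tot_fst hd, modelDeriv_const]; rfl
  · rw [modelDeriv_tot_snd hd]
    have h : (fun t : ℝ => (trivializationAt F E x ⟨x, u + t • w⟩).2) =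
        fun t : ℝ => fiberCoord F E x u + t • fiberCoord F E x w := by
      funext t
      rw [← fiberCoord_apply, map_add, map_smul]
    have hs : (fun t : ℝ => (trivializationAt F E x
        ((fun t : ℝ => (⟨x, u + t • w⟩ : TotalSpace F E)) ((extChartAt 𝓘(ℝ, ℝ) (0 : ℝ)).symm t))).2) =
        fun t : ℝ => fiberCoord F E x u + t • fiberCoord F E x w := h
    show fderiv ℝ (fun t : ℝ => (trivializationAt F E x
        ((fun t : ℝ => (⟨x, u + t • w⟩ : TotalSpace F E)) ((extChartAt 𝓘(ℝ, ℝ) (0 : ℝ)).symm t))).2)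
        0 1 = _
    rw [hs]
    refine fderiv_apply_one_eq_deriv.trans ?_
    have hder : HasDerivAt (fun t : ℝ => fiberCoord F E x u + t • fiberCoord F E x w)
        ((1 : ℝ) • fiberCoord F E x w) 0 :=
      ((hasDerivAt_id (0 : ℝ)).smul_const _).const_add _
    simpa using hder.deriv

theorem verticalAtZero_eq {x : M} (u : E x) :
    (verticalAtZero (B := B) F u : B × F) = (0, fiberCoord F E x u) := by
  have h := modelDeriv_fiberLine (B := B) (F := F) 0 u
  have e : (fun t : ℝ => (⟨x, 0 + t • u⟩ : TotalSpace F E)) = fun t : ℝ => ⟨x, t • u⟩ := by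
    funext t
    rw [zero_add]
  rw [e] at h
  exact h

theorem contMDiff_zero_section : ContMDiff 𝓘(ℝ, B) (totModel B F) ∞
    (fun y : M => (⟨y, 0⟩ : TotalSpace F E)) := contMDiff_zeroSection ℝ E

theorem zeroTangent_apply (x : M) (v : B) :
    ((zeroTangent B F E x) v) = (v, 0) := by
  have hd := (contMDiff_zero_section (B := B) (F := F) (E := E)).mdifferentiableAt (x := x)
    (by simp)
  refine Prod.ext ?_ ?_
  · refine (modelDeriv_tot_fst hd v).trans ?_
    show (modelDeriv 𝓘(ℝ, B) 𝓘(ℝ, B) (id : M → M) x) v = v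
    rw [modelDeriv_id]; rfl
  · refine (modelDeriv_tot_snd hd v).trans ?_
    have h : (fun z => (trivializationAt F E x
        (⟨(extChartAt 𝓘(ℝ, B) x).symm z, 0⟩ : TotalSpace F E)).2) =ᶠ[𝓝 (extChartAt 𝓘(ℝ, B) x x)]
        fun _ => 0 := by
      have hb : (extChartAt 𝓘(ℝ, B) x).symm (extChartAt 𝓘(ℝ, B) x x) ∈
          (trivializationAt F E x).baseSet := by
        rw [extChartAt_to_inv]; exact mem_baseSet_trivializationAt F E x
      filter_upwards [(continuousAt_extChartAt_symm (I := 𝓘(ℝ, B)) x).preimage_mem_nhds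
        ((trivializationAt F E x).open_baseSet.mem_nhds hb)] with z hz
      exact congrArg Prod.snd ((trivializationAt F E x).zeroSection ℝ hz)
    exact (congrArg (fun L : B →L[ℝ] F => L v) (h.fderiv_eq.trans (fderiv_const_apply _)))

end Coordinates

/-! ### Homogeneity of degree one implies linearity. -/

section Homogeneous

variable {W : Type*} [NormedAddCommGroup W] [NormedSpace ℝ W]

variable {W' : Type*} [NormedAddCommGroup W'] [NormedSpace ℝ W']

/-- The curve `c ↦ g (c • w) = c • g w` has derivative `g w` at 0 by homogeneity and `Dg(0) w` by
the chain rule, so `g = Dg(0)`. -/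
theorem exists_linear_of_homogeneous {g : W → W'} (hd : DifferentiableAt ℝ g 0)
    (hg : ∀ (c : ℝ) (w : W), g (c • w) = c • g w) : ∃ L : W →L[ℝ] W', ∀ w, g w = L w := by
  refine ⟨fderiv ℝ g 0, fun w => ?_⟩
  have h0 : HasDerivAt (fun c : ℝ => c • w) w 0 := by
    simpa using (hasDerivAt_id (0 : ℝ)).smul_const w
  have hd' : HasFDerivAt g (fderiv ℝ g 0) ((fun c : ℝ => c • w) 0) := by
    simpa using hd.hasFDerivAt
  have h1 : HasDerivAt (g ∘ fun c : ℝ => c • w) (fderiv ℝ g 0 w) 0 := hd'.comp_hasDerivAt 0 h0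
  have h2 : HasDerivAt (fun c : ℝ => c • g w) (g w) 0 := by
    simpa using (hasDerivAt_id (0 : ℝ)).smul_const (g w)
  have e : (g ∘ fun c : ℝ => c • w) = fun c : ℝ => c • g w := funext fun c => hg c w
  rw [e] at h1
  exact h2.unique h1

theorem alternating_cons_snd_add {k : ℕ} (α : (W × W') [⋀^Fin (k + 1)]→L[ℝ] ℝ) (f g : W')
    (w : Fin k → W × W') :
    α (Fin.cons (0, f + g) w) = α (Fin.cons (0, f) w) + α (Fin.cons (0, g) w) := by
  have h := α.toMultilinearMap.cons_add w ((0, f) : W × W') (0, g)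
  have e : ((0, f) : W × W') + (0, g) = (0, f + g) := by simp
  rw [e] at h
  exact h

theorem alternating_cons_snd_smul {k : ℕ} (α : (W × W') [⋀^Fin (k + 1)]→L[ℝ] ℝ) (c : ℝ) (f : W')
    (w : Fin k → W × W') :
    α (Fin.cons (0, c • f) w) = c • α (Fin.cons (0, f) w) := by
  have h := α.toMultilinearMap.cons_smul w c ((0, f) : W × W')
  have e : c • ((0, f) : W × W') = (0, c • f) := by simp
  rw [e] at h
  exact h

end Homogeneous

/-! ### Linear forms, the Euler field and the decomposition into components. -/

section LinearForms

variable {B : Type*} [NormedAddCommGroup B] [NormedSpace ℝ B]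
  {M : Type*} [TopologicalSpace M] [ChartedSpace B M] [IsManifold 𝓘(ℝ, B) ∞ M]
  {F : Type*} [NormedAddCommGroup F] [NormedSpace ℝ F]
  {E : M → Type*} [TopologicalSpace (TotalSpace F E)] [∀ x, AddCommGroup (E x)]
  [∀ x, Module ℝ (E x)] [∀ x, TopologicalSpace (E x)] [FiberBundle F E] [VectorBundle ℝ F E]
  [ContMDiffVectorBundle ∞ F E 𝓘(ℝ, B)]

variable (F E) in
/-- Multiplication by `c` in the fibres. -/
def homothety (c : ℝ) : TotalSpace F E → TotalSpace F E := fun p => ⟨p.1, c • p.2⟩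

theorem trivializationAt_homothety (c : ℝ) {x : M} {p : TotalSpace F E}
    (hp : p.1 ∈ (trivializationAt F E x).baseSet) :
    (trivializationAt F E x (homothety F E c p)).2 = c • (trivializationAt F E x p).2 :=
  (Trivialization.linear ℝ (trivializationAt F E x) hp).map_smul c p.2

theorem contMDiff_homothety (c : ℝ) :
    ContMDiff (totModel B F) (totModel B F) ∞ (homothety F E c) := by
  intro p
  rw [contMDiffAt_totalSpace]
  refine ⟨contMDiffAt_proj E, ?_⟩
  have h := (contMDiffAt_totalSpace (IM := totModel B F) (IB := 𝓘(ℝ, B)) (n := ∞)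
    (f := (id : TotalSpace F E → TotalSpace F E)) (x₀ := p)).1 contMDiffAt_id
  have hc : ContMDiffAt (totModel B F) 𝓘(ℝ, F) ∞
      (fun r : TotalSpace F E => c • (trivializationAt F E p.1 r).2) p :=
    ContMDiffAt.comp (I' := 𝓘(ℝ, F)) (g := fun f : F => c • f) p
      (c • ContinuousLinearMap.id ℝ F).contDiff.contMDiff.contMDiffAt h.2
  refine hc.congr_of_eventuallyEq ?_
  have hb : p.1 ∈ (trivializationAt F E p.1).baseSet := mem_baseSet_trivializationAt F E p.1
  filter_upwards [(FiberBundle.continuous_proj F E).continuousAt.preimage_mem_nhds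
    ((trivializationAt F E p.1).open_baseSet.mem_nhds hb)] with r hr
  exact trivializationAt_homothety c hr

/-- Multiplication by `c` in the second factor of `B × F`. -/
noncomputable def scaleSnd (B F : Type*) [NormedAddCommGroup B] [NormedSpace ℝ B] [NormedAddCommGroup F]
    [NormedSpace ℝ F] (c : ℝ) : B × F →L[ℝ] B × F :=
  (ContinuousLinearMap.fst ℝ B F).prod (c • ContinuousLinearMap.snd ℝ B F)

theorem scaleSnd_apply (c : ℝ) (w : B × F) : scaleSnd B F c w = (w.1, c • w.2) := rfl

theorem extChartAt_tot_symm_base {p : TotalSpace F E} {y : B × F}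
    (hy : y ∈ (extChartAt (totModel B F) p).target) :
    ((extChartAt (totModel B F) p).symm y).1 ∈ (trivializationAt F E p.1).baseSet :=
  ((mem_extChartAt_tot_source p _).1 ((extChartAt (totModel B F) p).map_target hy)).1

theorem extChartAt_tot_symm_eq {p : TotalSpace F E} {y : B × F}
    (hy : y ∈ (extChartAt (totModel B F) p).target) :
    extChartAt 𝓘(ℝ, B) p.1 ((extChartAt (totModel B F) p).symm y).1 = y.1 ∧
      (trivializationAt F E p.1 ((extChartAt (totModel B F) p).symm y)).2 = y.2 := by
  have h := extChartAt_tot_apply (B := B) p _ (extChartAt_tot_symm_base (B := B) hy)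
  rw [(extChartAt (totModel B F) p).right_inv hy] at h
  exact ⟨(congrArg Prod.fst h).symm, (congrArg Prod.snd h).symm⟩

theorem mem_source_homothety (c : ℝ) {p r : TotalSpace F E}
    (hr : r ∈ (extChartAt (totModel B F) p).source) :
    homothety F E c r ∈ (extChartAt (totModel B F) p).source := by
  rw [mem_extChartAt_tot_source] at hr ⊢
  exact hr

theorem locRep_homothety (c : ℝ) {p : TotalSpace F E} {y : B × F}
    (hy : y ∈ (extChartAt (totModel B F) p).target) :
    (extChartAt (totModel B F) p ∘ homothety F E c ∘ (extChartAt (totModel B F) p).symm) y =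
      scaleSnd B F c y := by
  have hb := extChartAt_tot_symm_base (B := B) hy
  obtain ⟨h1, h2⟩ := extChartAt_tot_symm_eq (B := B) hy
  refine (extChartAt_tot_apply (B := B) p
    (homothety F E c ((extChartAt (totModel B F) p).symm y)) hb).trans ?_
  refine Prod.ext h1 ?_
  exact (trivializationAt_homothety c hb).trans (congrArg (c • ·) h2)

/-- In a bundle chart the homothety is `scaleSnd`, which is its own derivative, so linearity of the
form becomes an algebraic identity of coefficients. -/
theorem TotForm.IsLinear.inChart {k : ℕ} {θ : TotForm B F E k} (hl : TotForm.IsLinear θ)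
    {p : TotalSpace F E} {y : B × F} (hy : y ∈ (extChartAt (totModel B F) p).target) (c : ℝ)
    (w : Fin k → B × F) :
    Form.inChart θ p (scaleSnd B F c y) (fun i => scaleSnd B F c (w i)) =
      c * Form.inChart θ p y w := by
  have h1 := Form.inChart_pullback (φ := homothety F E c) θ hy (contMDiff_homothety c _)
    (x₀' := p) (mem_source_homothety c ((extChartAt (totModel B F) p).map_target hy))
  have h2 : Form.pullback (I := totModel B F) (homothety F E c) θ = c • θ := hl c
  have h3 : fderiv ℝ (extChartAt (totModel B F) p ∘ homothety F E c ∘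
      (extChartAt (totModel B F) p).symm) y = scaleSnd B F c := by
    have : (extChartAt (totModel B F) p ∘ homothety F E c ∘
      (extChartAt (totModel B F) p).symm) =ᶠ[𝓝 y] scaleSnd B F c := by
      filter_upwards [(isOpen_extChartAt_target p).mem_nhds hy] with z hz
      exact locRep_homothety c hz
    rw [this.fderiv_eq, ContinuousLinearMap.fderiv]
  rw [h2, h3, locRep_homothety c hy] at h1
  exact (congrArg (fun L : (B × F) [⋀^Fin k]→L[ℝ] ℝ => L w) h1).symm

variable (F) in
theorem mem_target_fiber (x : M) (u₀ : E x) (f : F) :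
    ((extChartAt 𝓘(ℝ, B) x x, f) : B × F) ∈
      (extChartAt (totModel B F) (⟨x, u₀⟩ : TotalSpace F E)).target := by
  rw [FiberBundle.extChartAt_target]
  refine ⟨⟨mem_extChartAt_target x, ?_⟩, mem_univ _⟩
  show (extChartAt 𝓘(ℝ, B) x).symm (extChartAt 𝓘(ℝ, B) x x) ∈ (trivializationAt F E x).baseSet
  rw [extChartAt_to_inv]
  exact mem_baseSet_trivializationAt F E x

theorem Form.inChart_fiber {k : ℕ} (θ : TotForm B F E k) (x : M) (u₀ u : E x) :
    Form.inChart θ (⟨x, u₀⟩ : TotalSpace F E) (extChartAt 𝓘(ℝ, B) x x, fiberCoord F E x u) =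
      θ ⟨x, u⟩ := by
  have h := Form.inChart_self θ (⟨x, u⟩ : TotalSpace F E)
  rw [extChartAt_tot_self] at h
  refine Eq.trans ?_ h
  unfold Form.inChart
  rw [extChartAt_tot_congr x u₀ u]

/-- The Euler vector field. -/
noncomputable def eulerField : ∀ p : TotalSpace F E, TangentSpace (totModel B F) p :=
  fun p => ((0, fiberCoord F E p.1 p.2) : B × F)

/-- The Euler field at `r` is the velocity at 0 of `t ↦ r + t r`, which the chart maps to an affine
line in the second factor. -/
theorem vectorFieldInChart_eulerField {p : TotalSpace F E} {y : B × F}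
    (hy : y ∈ (extChartAt (totModel B F) p).target) :
    vectorFieldInChart (I := totModel B F) (eulerField (B := B)) p y = (0, y.2) := by
  have hb := extChartAt_tot_symm_base (B := B) hy
  obtain ⟨h1, h2⟩ := extChartAt_tot_symm_eq (B := B) hy
  have hs := (extChartAt (totModel B F) p).map_target hy
  set r := (extChartAt (totModel B F) p).symm y with hr
  have hd := (contMDiff_fiberLine (B := B) (F := F) r.2 r.2).mdifferentiableAt (x := 0) (by simp)
  have h0 : (fun t : ℝ => (⟨r.1, r.2 + t • r.2⟩ : TotalSpace F E)) 0 = r := by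
    show (⟨r.1, r.2 + (0 : ℝ) • r.2⟩ : TotalSpace F E) = r
    rw [zero_smul, add_zero]
  have hc : MDifferentiableAt (totModel B F) 𝓘(ℝ, B × F) (extChartAt (totModel B F) p) r := by
    refine mdifferentiableAt_extChartAt ?_
    rwa [extChartAt_source] at hs
  have e1 := modelDeriv_comp (I := 𝓘(ℝ, ℝ)) (I' := totModel B F) (I'' := 𝓘(ℝ, B × F))
    (ψ := extChartAt (totModel B F) p)
    (φ := fun t : ℝ => (⟨r.1, r.2 + t • r.2⟩ : TotalSpace F E)) 0 (cast (congrArg _ h0.symm) hc) hd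
  have e2 : (extChartAt (totModel B F) p ∘
      fun t : ℝ => (⟨r.1, r.2 + t • r.2⟩ : TotalSpace F E)) =
      fun t : ℝ => (y.1, y.2 + t • y.2) := by
    funext t
    refine (extChartAt_tot_apply p (⟨r.1, r.2 + t • r.2⟩ : TotalSpace F E) hb).trans
      (Prod.ext h1 ?_)
    have hl := Trivialization.linear ℝ (trivializationAt F E p.1) hb
    show (trivializationAt F E p.1 ⟨r.1, r.2 + t • r.2⟩).2 = _
    rw [← h2]
    exact (hl.map_add _ _).trans (congrArg _ (hl.map_smul t r.2))
  have e3 : (modelDeriv 𝓘(ℝ, ℝ) 𝓘(ℝ, B × F) (fun t : ℝ => (y.1, y.2 + t • y.2)) 0) 1 = (0, y.2) := by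
    have hder : HasDerivAt (fun t : ℝ => (y.1, y.2 + t • y.2)) ((0, (1 : ℝ) • y.2) : B × F) 0 :=
      (hasDerivAt_const _ _).prodMk (((hasDerivAt_id (0 : ℝ)).smul_const _).const_add _)
    have hf : modelDeriv 𝓘(ℝ, ℝ) 𝓘(ℝ, B × F) (fun t : ℝ => (y.1, y.2 + t • y.2)) 0 =
      fderiv ℝ (fun t : ℝ => (y.1, y.2 + t • y.2)) 0 := mfderiv_eq_fderiv
    rw [hf, fderiv_apply_one_eq_deriv, hder.deriv, one_smul]
  have e4 := congrArg (fun L : ℝ →L[ℝ] B × F => L 1) e1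
  simp only [ContinuousLinearMap.comp_apply, modelDeriv_fiberLine] at e4
  rw [e2, e3] at e4
  -- The line passes through `r` at `t = 0` only up to a propositional equality, so the derivative
  -- has to be transported between the two base points.
  have e5 : ∀ r' : TotalSpace F E, r' = r →
      modelDeriv (totModel B F) 𝓘(ℝ, B × F) (extChartAt (totModel B F) p) r'
        (0, fiberCoord F E r.1 r.2) =
      modelDeriv (totModel B F) 𝓘(ℝ, B × F) (extChartAt (totModel B F) p) r
        (0, fiberCoord F E r.1 r.2) := by
    rintro _ rfl; rfl
  rw [e4]
  exact (e5 _ h0).symm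

theorem isSmoothVectorField_eulerField :
    IsSmoothVectorField (eulerField : ∀ p : TotalSpace F E, TangentSpace (totModel B F) p) := by
  intro p y hy
  have h : ContDiffAt ℝ ∞ (fun z : B × F => ((0, z.2) : B × F)) y := by fun_prop
  refine h.congr_of_eventuallyEq ?_
  filter_upwards [(isOpen_extChartAt_target p).mem_nhds hy] with z hz
  exact vectorFieldInChart_eulerField hz

variable [FiniteDimensional ℝ B] [FiniteDimensional ℝ F]

theorem TotForm.IsLinear.extDer {k : ℕ} {θ : TotForm B F E k} (hs : Form.IsSmooth θ)
    (hl : TotForm.IsLinear θ) : TotForm.IsLinear (Form.extDer θ) := by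
  intro c
  have h := Form.extDer_pullback hs (contMDiff_homothety (F := F) (E := E) c)
  have hc : Form.pullback (I := totModel B F) (homothety F E c) θ = c • θ := hl c
  rw [hc, Form.extDer_smul] at h
  exact h.symm

/-- Scaling by `c` and letting `c → 0` moves the base point to the zero section and kills the fibre
components of the remaining vectors. The value does not change on the way, as the Euler slot absorbs
the factor `c`. -/
theorem TotForm.IsLinear.contract_apply {k : ℕ} {θ : TotForm B F E (k + 1)} (hs : Form.IsSmooth θ)
    (hl : TotForm.IsLinear θ) (x : M) (u : E x) (w : Fin k → B × F) :
    (θ ⟨x, u⟩ : (B × F) [⋀^Fin (k + 1)]→L[ℝ] ℝ) (Fin.cons (0, fiberCoord F E x u) w) =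
      (θ ⟨x, 0⟩ : (B × F) [⋀^Fin (k + 1)]→L[ℝ] ℝ)
        (Fin.cons (0, fiberCoord F E x u) fun i => ((w i).1, 0)) := by
  set y₀ := extChartAt 𝓘(ℝ, B) x x with hy₀
  set f₀ := fiberCoord F E x u with hf₀
  let g : ℝ → ℝ := fun c => Form.inChart θ (⟨x, 0⟩ : TotalSpace F E) (y₀, c • f₀)
    (Fin.cons (0, f₀) fun i => scaleSnd B F c (w i))
  -- Linearity gives a factor `c`, and so does the first slot `(0, c • f₀)`; they cancel for `c ≠
  -- 0`.
  have hg1 : ∀ c : ℝ, c ≠ 0 → g c = Form.inChart θ (⟨x, 0⟩ : TotalSpace F E) (y₀, f₀)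
      (Fin.cons (0, f₀) w) := by
    intro c hc
    have h := hl.inChart (mem_target_fiber F x 0 f₀) c (Fin.cons (0, f₀) w : Fin (k + 1) → B × F)
    have e : (fun i => scaleSnd B F c ((Fin.cons (0, f₀) w : Fin (k + 1) → B × F) i)) =
        Function.update (Fin.cons (0, f₀) fun i => scaleSnd B F c (w i) : Fin (k + 1) → B × F) 0
          (c • ((0, f₀) : B × F)) := by
      funext i
      refine Fin.cases ?_ (fun i => ?_) i
      · simp [scaleSnd_apply]
      · simp
    rw [e, ContinuousAlternatingMap.map_update_smul] at h
    have h' := mul_left_cancel₀ hc h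
    rw [← h']
    show Form.inChart θ (⟨x, 0⟩ : TotalSpace F E) (y₀, c • f₀) _ = _
    rw [Fin.update_cons_zero, scaleSnd_apply]
  have hg2 : ContinuousAt g 0 := by
    have hd : DifferentiableAt ℝ (Form.inChart θ (⟨x, 0⟩ : TotalSpace F E)) (y₀, (0 : ℝ) • f₀) :=
      (hs.contDiffAt (mem_target_fiber F x 0 _)).differentiableAt (by simp)
    have hd1 : DifferentiableAt ℝ (fun c : ℝ =>
        Form.inChart θ (⟨x, 0⟩ : TotalSpace F E) (y₀, c • f₀)) 0 :=
      DifferentiableAt.comp (g := Form.inChart θ (⟨x, 0⟩ : TotalSpace F E)) (0 : ℝ) hd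
        (by fun_prop : DifferentiableAt ℝ (fun c : ℝ => ((y₀, c • f₀) : B × F)) 0)
    refine (DifferentiableAt.continuousAlternatingMap_apply hd1
      (g := fun i c => (Fin.cons (0, f₀) fun i => scaleSnd B F c (w i) : Fin (k + 1) → B × F) i)
      fun i => ?_).continuousAt
    refine Fin.cases ?_ (fun i => ?_) i
    · exact differentiableAt_const _
    · simp only [Fin.cons_succ, scaleSnd_apply]
      fun_prop
  -- A function continuous at 0 and constant away from 0 takes that constant at 0.
  have hg3 : g 0 = Form.inChart θ (⟨x, 0⟩ : TotalSpace F E) (y₀, f₀) (Fin.cons (0, f₀) w) := by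
    have t1 : Filter.Tendsto g (𝓝[≠] 0) (𝓝 (g 0)) := hg2.tendsto.mono_left nhdsWithin_le_nhds
    refine tendsto_nhds_unique t1 (tendsto_const_nhds.congr' ?_)
    filter_upwards [self_mem_nhdsWithin] with c hc
    exact (hg1 c hc).symm
  have e1 := Form.inChart_fiber θ x 0 u
  have e0 := Form.inChart_fiber θ x 0 0
  rw [map_zero] at e0
  refine (congrArg (fun L : (B × F) [⋀^Fin (k + 1)]→L[ℝ] ℝ => L (Fin.cons (0, f₀) w)) e1).symm.trans
    (hg3.symm.trans ?_)
  refine Eq.trans ?_ (congrArg (fun L : (B × F) [⋀^Fin (k + 1)]→L[ℝ] ℝ =>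
    L (Fin.cons (0, f₀) fun i => ((w i).1, 0))) e0)
  show Form.inChart θ (⟨x, 0⟩ : TotalSpace F E) (y₀, (0 : ℝ) • f₀) _ = _
  simp only [zero_smul, scaleSnd_apply]
  rfl

theorem liftForm_apply {n : ℕ} (μ : ∀ x : M, E x → CotangentPower 𝓘(ℝ, B) n x)
    (p : TotalSpace F E) (w : Fin n → B × F) :
    (liftForm F μ p : (B × F) [⋀^Fin n]→L[ℝ] ℝ) w =
      (μ p.1 p.2 : B [⋀^Fin n]→L[ℝ] ℝ) (fun i => (w i).1) := by
  refine congrArg (μ p.1 p.2 : B [⋀^Fin n]→L[ℝ] ℝ) ?_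
  funext i
  exact modelDeriv_proj p (w i)

theorem TotForm.mu_apply {k : ℕ} (θ : TotForm B F E (k + 1)) (x : M) (u : E x) (v : Fin k → B) :
    (TotForm.mu θ x u : B [⋀^Fin k]→L[ℝ] ℝ) v =
      (θ ⟨x, 0⟩ : (B × F) [⋀^Fin (k + 1)]→L[ℝ] ℝ)
        (Fin.cons (0, fiberCoord F E x u) fun i => (v i, 0)) := by
  refine congrArg (θ ⟨x, 0⟩ : (B × F) [⋀^Fin (k + 1)]→L[ℝ] ℝ) ?_
  funext i
  refine Fin.cases ?_ (fun i => ?_) i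
  · exact verticalAtZero_eq u
  · exact zeroTangent_apply x (v i)

theorem TotForm.IsLinear.liftForm_mu {k : ℕ} {θ : TotForm B F E (k + 1)} (hs : Form.IsSmooth θ)
    (hl : TotForm.IsLinear θ) :
    liftForm F (n := k) (TotForm.mu θ) = Form.interiorSucc eulerField θ := by
  funext p
  refine ContinuousAlternatingMap.ext fun w => ?_
  refine (liftForm_apply _ p w).trans ?_
  refine (TotForm.mu_apply θ p.1 p.2 _).trans ?_
  exact (hl.contract_apply hs p.1 p.2 w).symm

/-- This is the derivative of `h_c^* θ = c θ` at `c = 1`: the curve `c ↦ h_c(p)` has velocity the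
Euler field, and scaling the arguments produces the terms with the derivative of that field. -/
theorem TotForm.IsLinear.lieDer_eulerField {k : ℕ} {θ : TotForm B F E k} (hs : Form.IsSmooth θ)
    (hl : TotForm.IsLinear θ) : Form.lieDer eulerField θ = θ := by
  funext p
  refine ContinuousAlternatingMap.ext fun w => ?_
  have hsm := isSmoothVectorField_eulerField (B := B) (F := F) (E := E)
  refine (Form.lieDer_apply hs hsm p w).trans ?_
  have hy := mem_extChartAt_target (I := totModel B F) p
  have hX : fderiv ℝ (vectorFieldInChart (I := totModel B F) eulerField p)
      (extChartAt (totModel B F) p p) =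
        (ContinuousLinearMap.inr ℝ B F).comp (ContinuousLinearMap.snd ℝ B F) := by
    have : vectorFieldInChart (I := totModel B F) eulerField p =ᶠ[𝓝 (extChartAt (totModel B F) p p)]
        (ContinuousLinearMap.inr ℝ B F).comp (ContinuousLinearMap.snd ℝ B F) := by
      filter_upwards [(isOpen_extChartAt_target p).mem_nhds hy] with z hz
      exact vectorFieldInChart_eulerField hz
    rw [this.fderiv_eq, ContinuousLinearMap.fderiv]
  rw [hX]
  set z := extChartAt (totModel B F) p p with hz
  have hz2 : (eulerField p : B × F) = (0, z.2) := by
    rw [hz, extChartAt_tot_self]; rfl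
  have hd : HasFDerivAt (Form.inChart θ p) (fderiv ℝ (Form.inChart θ p) z) (scaleSnd B F 1 z) := by
    have : scaleSnd B F 1 z = z := by rw [scaleSnd_apply, one_smul]
    rw [this]
    exact ((hs.contDiffAt hy).differentiableAt (by simp)).hasFDerivAt
  have hsc : ∀ w' : B × F, HasDerivAt (fun c : ℝ => scaleSnd B F c w') (0, w'.2) 1 := by
    intro w'
    have := (hasDerivAt_const (1 : ℝ) w'.1).prodMk ((hasDerivAt_id (1 : ℝ)).smul_const w'.2)
    simpa [scaleSnd_apply] using this
  have h1 : HasDerivAt (fun c : ℝ => Form.inChart θ p (scaleSnd B F c z))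
      (fderiv ℝ (Form.inChart θ p) z (0, z.2)) 1 :=
    HasFDerivAt.comp_hasDerivAt (l := Form.inChart θ p) (f := fun c : ℝ => scaleSnd B F c z)
      1 hd (hsc z)
  have h2 := HasFDerivAt.continuousAlternatingMap_apply h1.hasFDerivAt
    (fun i => (hsc (w i)).hasFDerivAt)
  have hid : scaleSnd B F 1 = ContinuousLinearMap.id ℝ (B × F) := by
    ext w' <;> simp [scaleSnd_apply]
  have h3 : HasDerivAt (fun c : ℝ => c * Form.inChart θ p z w) (Form.inChart θ p z w) 1 := by
    simpa using (hasDerivAt_id (1 : ℝ)).mul_const (Form.inChart θ p z w)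
  have e : (fun c : ℝ => Form.inChart θ p (scaleSnd B F c z) (fun i => scaleSnd B F c (w i))) =
      fun c : ℝ => c * Form.inChart θ p z w := funext fun c => hl.inChart hy c w
  rw [e] at h2
  have h4 := h2.hasDerivAt.unique h3
  simp only [hid, add_apply, sum_apply,
    ContinuousLinearMap.comp_apply, ContinuousLinearMap.toSpanSingleton_apply, one_smul,
    ContinuousLinearMap.id_apply] at h4
  have hself : Form.inChart θ p z = θ p := Form.inChart_self θ p
  rw [hself] at h4
  rw [hz2]
  exact h4

/-- Cartan's formula for `L_𝓔 θ = θ`, with `i_𝓔 θ = Λ_μ` and `i_𝓔 dθ = Λ_η`; in degree 0 only the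
second term exists. -/
theorem TotForm.IsLinear.hasComponents {k : ℕ} {θ : TotForm B F E k} (hs : Form.IsSmooth θ)
    (hl : TotForm.IsLinear θ) : TotForm.HasComponents θ θ.mu θ.eta := by
  have h := hl.lieDer_eulerField hs
  have he : liftForm F θ.eta = Form.interiorSucc eulerField (Form.extDer θ) :=
    TotForm.IsLinear.liftForm_mu hs.extDer (hl.extDer hs)
  cases k with
  | zero =>
    show θ = liftForm F θ.eta
    rw [he]; exact h.symm
  | succ k =>
    show θ = Form.extDer (liftForm F (n := k) θ.mu) + liftForm F θ.eta
    rw [he, hl.liftForm_mu hs]; exact h.symm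

theorem TotForm.IsLinear.exists_eval_eq {k : ℕ} {θ : TotForm B F E k} (hs : Form.IsSmooth θ)
    (hl : TotForm.IsLinear θ) (b : TangentPower B M k) :
    ∃ L : F × (Fin k → F) →L[ℝ] ℝ, ∀ w : PowFiber F E b,
      θ.eval b w = L (fiberCoord F E b.1 w.1, w.2) := by
  let y₀ : B := extChartAt 𝓘(ℝ, B) b.1 b.1
  let v : Fin k → B := fun i => b.vec i
  -- With the base vectors fixed, linearity of the form makes this function homogeneous of degree
  -- one jointly in the fibre point and the fibre components.
  let g : F × (Fin k → F) → ℝ := fun a =>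
    Form.inChart θ (⟨b.1, 0⟩ : TotalSpace F E) (y₀, a.1) (fun i => (v i, a.2 i))
  have hd : DifferentiableAt ℝ g 0 := by
    have h1 : DifferentiableAt ℝ (Form.inChart θ (⟨b.1, 0⟩ : TotalSpace F E))
        (y₀, (0 : F × (Fin k → F)).1) :=
      (hs.contDiffAt (mem_target_fiber F b.1 0 _)).differentiableAt (by simp)
    have h2 : DifferentiableAt ℝ (fun a : F × (Fin k → F) =>
        Form.inChart θ (⟨b.1, 0⟩ : TotalSpace F E) (y₀, a.1)) 0 :=
      DifferentiableAt.comp (g := Form.inChart θ (⟨b.1, 0⟩ : TotalSpace F E))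
        (0 : F × (Fin k → F)) h1
        (by fun_prop : DifferentiableAt ℝ (fun a : F × (Fin k → F) => ((y₀, a.1) : B × F)) 0)
    exact DifferentiableAt.continuousAlternatingMap_apply h2
      (g := fun i (a : F × (Fin k → F)) => ((v i, a.2 i) : B × F)) fun i => by fun_prop
  obtain ⟨L, hL⟩ := exists_linear_of_homogeneous hd fun c a => by
    refine Eq.trans ?_ (hl.inChart (mem_target_fiber F b.1 0 a.1) c (fun i => (v i, a.2 i)))
    rfl
  refine ⟨L, fun w => ?_⟩
  rw [← hL]
  exact (congrArg (fun L : (B × F) [⋀^Fin k]→L[ℝ] ℝ => L (fun i => (v i, w.2 i)))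
    (Form.inChart_fiber θ b.1 0 w.1)).symm

theorem TotForm.IsLinear.eval_add {k : ℕ} {θ : TotForm B F E k} (hs : Form.IsSmooth θ)
    (hl : TotForm.IsLinear θ) (b : TangentPower B M k) (w w' : PowFiber F E b) :
    θ.eval b (w + w') = θ.eval b w + θ.eval b w' := by
  obtain ⟨L, hL⟩ := hl.exists_eval_eq hs b
  rw [hL, hL, hL, ← map_add, Prod.fst_add, map_add]
  rfl

theorem TotForm.IsLinear.eval_smul {k : ℕ} {θ : TotForm B F E k} (hs : Form.IsSmooth θ)
    (hl : TotForm.IsLinear θ) (b : TangentPower B M k) (c : ℝ) (w : PowFiber F E b) :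
    θ.eval b (c • w) = c * θ.eval b w := by
  obtain ⟨L, hL⟩ := hl.exists_eval_eq hs b
  rw [hL, hL, ← smul_eq_mul, ← map_smul, Prod.smul_fst, map_smul]
  rfl

/-- The map `M → E` given by a section. -/
noncomputable def sectionMap (e : Sec (B := B) F E) : M → TotalSpace F E := fun x => ⟨x, e x⟩

theorem contMDiff_sectionMap (e : Sec (B := B) F E) :
    ContMDiff 𝓘(ℝ, B) (totModel B F) ∞ (sectionMap e) := e.contMDiff

theorem modelDeriv_sectionMap_fst (e : Sec (B := B) F E) (x : M) (v : B) :
    (modelDeriv 𝓘(ℝ, B) (totModel B F) (sectionMap e) x v).1 = v := by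
  refine (modelDeriv_tot_fst ((contMDiff_sectionMap e).mdifferentiableAt (by simp)) v).trans ?_
  show (modelDeriv 𝓘(ℝ, B) 𝓘(ℝ, B) (id : M → M) x) v = v
  rw [modelDeriv_id]; rfl

theorem pullback_sectionMap_liftForm {n : ℕ} (ν : ∀ x : M, E x → CotangentPower 𝓘(ℝ, B) n x)
    (e : Sec (B := B) F E) :
    Form.pullback (I := 𝓘(ℝ, B)) (sectionMap e) (liftForm F ν) = fun x => ν x (e x) := by
  funext x
  refine ContinuousAlternatingMap.ext fun v => ?_
  refine (liftForm_apply ν (sectionMap e x) _).trans ?_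
  refine congrArg (ν x (e x) : B [⋀^Fin n]→L[ℝ] ℝ) ?_
  funext i
  exact modelDeriv_sectionMap_fst e x (v i)

theorem TotForm.mu_zero_degree (θ : TotForm B F E 0) (x : M) (u : E x) : TotForm.mu θ x u = 0 := by
  refine ContinuousAlternatingMap.ext fun v => ?_
  rfl

theorem TotForm.IsLinear.isFormValuedMorphism_mu {k : ℕ} {θ : TotForm B F E k}
    (hs : Form.IsSmooth θ) (hl : TotForm.IsLinear θ) : IsFormValuedMorphism F θ.mu := by
  cases k with
  | zero =>
    refine ⟨fun x u v => ?_, fun x c u => ?_, fun e => ?_⟩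
    · simp only [TotForm.mu_zero_degree, add_zero]
    · simp only [TotForm.mu_zero_degree, smul_zero]
    · simp only [TotForm.mu_zero_degree]
      exact Form.isSmooth_zero
  | succ k =>
    refine ⟨fun x u v => ContinuousAlternatingMap.ext fun w => ?_,
      fun x c u => ContinuousAlternatingMap.ext fun w => ?_, fun e => ?_⟩
    · refine (TotForm.mu_apply θ x (u + v) w).trans ?_
      refine Eq.trans ?_ (congrArg₂ (· + ·) (TotForm.mu_apply θ x u w)
        (TotForm.mu_apply θ x v w)).symm
      rw [map_add]
      exact alternating_cons_snd_add (θ ⟨x, 0⟩ : (B × F) [⋀^Fin (k + 1)]→L[ℝ] ℝ) _ _ _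
    · refine (TotForm.mu_apply θ x (c • u) w).trans ?_
      refine Eq.trans ?_ (congrArg (c • ·) (TotForm.mu_apply θ x u w)).symm
      rw [map_smul]
      exact alternating_cons_snd_smul (θ ⟨x, 0⟩ : (B × F) [⋀^Fin (k + 1)]→L[ℝ] ℝ) _ _ _
    · have h := pullback_sectionMap_liftForm (n := k) θ.mu e
      rw [hl.liftForm_mu hs] at h
      have h2 : Form.IsSmooth (Form.pullback (I := 𝓘(ℝ, B)) (sectionMap e)
          (Form.interiorSucc eulerField θ)) :=
        (hs.interiorSucc isSmoothVectorField_eulerField).pullback (contMDiff_sectionMap e)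
      rw [h] at h2
      exact h2

/-- The component `η` of a form is by definition the component `μ` of its exterior derivative. -/
theorem TotForm.IsLinear.isFormValuedMorphism_eta {k : ℕ} {θ : TotForm B F E k}
    (hs : Form.IsSmooth θ) (hl : TotForm.IsLinear θ) : IsFormValuedMorphism F θ.eta :=
  TotForm.IsLinear.isFormValuedMorphism_mu hs.extDer (hl.extDer hs)

theorem TotForm.IsLinear.pullback_section_zero {θ : TotForm B F E 0} (hs : Form.IsSmooth θ)
    (hl : TotForm.IsLinear θ) (e : Sec (B := B) F E) :
    Form.pullback (I := 𝓘(ℝ, B)) (sectionMap e) θ = fun x => θ.eta x (e x) := by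
  have h : θ = liftForm F θ.eta := hl.hasComponents hs
  rw [← pullback_sectionMap_liftForm θ.eta e, ← h]

/-- Pulling back `θ = dΛ_μ + Λ_η` along a section turns `Λ_ν` into `ν(e)`, and `d` commutes with
pullback. -/
theorem TotForm.IsLinear.pullback_section_succ {k : ℕ} {θ : TotForm B F E (k + 1)}
    (hs : Form.IsSmooth θ) (hl : TotForm.IsLinear θ) (e : Sec (B := B) F E) :
    Form.pullback (I := 𝓘(ℝ, B)) (sectionMap e) θ =
      Form.extDer (n := k) (fun x => θ.mu x (e x)) + fun x => θ.eta x (e x) := by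
  have h : θ = Form.extDer (liftForm F (n := k) θ.mu) + liftForm F θ.eta := hl.hasComponents hs
  have hsm : Form.IsSmooth (liftForm F (n := k) θ.mu) := by
    rw [hl.liftForm_mu hs]
    exact hs.interiorSucc isSmoothVectorField_eulerField
  have h1 := Form.extDer_pullback hsm (contMDiff_sectionMap e)
  have h2 : Form.pullback (I := 𝓘(ℝ, B)) (sectionMap e) θ =
      Form.pullback (I := 𝓘(ℝ, B)) (sectionMap e) (Form.extDer (liftForm F (n := k) θ.mu)) +
        Form.pullback (I := 𝓘(ℝ, B)) (sectionMap e) (liftForm F θ.eta) := by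
    conv_lhs => rw [h]
    rfl
  rw [h2, ← h1, pullback_sectionMap_liftForm, pullback_sectionMap_liftForm]

end LinearForms

/-! ### Charts of `T^{⊕k} M` and evaluation of forms of the base. -/

section TangentPowers

variable {B : Type*} [NormedAddCommGroup B] [NormedSpace ℝ B]
  {M : Type*} [TopologicalSpace M] [ChartedSpace B M] [IsManifold 𝓘(ℝ, B) ∞ M]

theorem trivializationAt_tangent_snd {x₀ x : M} (hx : x ∈ (chartAt B x₀).source) (v : B) :
    (trivializationAt B (TangentSpace 𝓘(ℝ, B)) x₀ ⟨x, v⟩).2 =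
      modelDeriv 𝓘(ℝ, B) 𝓘(ℝ, B) (extChartAt 𝓘(ℝ, B) x₀) x v := by
  have e := TangentBundle.continuousLinearMapAt_trivializationAt (I := 𝓘(ℝ, B)) hx
  refine Eq.trans ?_ (congrArg (fun L : B →L[ℝ] B => L v) e)
  exact (Trivialization.continuousLinearMapAt_apply_of_mem (R := ℝ)
    (e := trivializationAt B (TangentSpace 𝓘(ℝ, B)) x₀) hx _).symm

theorem fiberCoord_tangentSpace (x : M) (v : B) :
    fiberCoord B (TangentSpace 𝓘(ℝ, B)) x v = v := by
  refine (trivializationAt_tangent_snd (mem_chart_source B x) v).trans ?_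
  exact congrArg (fun L : B →L[ℝ] B => L v) (mfderiv_extChartAt_self (I := 𝓘(ℝ, B)) (x := x))

variable (B M) in
/-- The fibres of `T^{⊕k} M`. -/
abbrev PowTangent (k : ℕ) : M → Type _ :=
  fun x : M => Bundle.Trivial M (Fin k → ℝ) x →L[ℝ] TangentSpace 𝓘(ℝ, B) x

/-- The source bundle is trivial, so the trivialization of the bundle of linear maps acts on each
tangent vector separately, by the derivative of the chart. -/
theorem trivializationAt_tangentPower_snd {k : ℕ} {x₀ : M} {c : TangentPower B M k}
    (hc : c.1 ∈ (chartAt B x₀).source) (i : Fin k) :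
    (trivializationAt ((Fin k → ℝ) →L[ℝ] B) (PowTangent B M k) x₀ c).2 (Pi.single i (1 : ℝ)) =
      modelDeriv 𝓘(ℝ, B) 𝓘(ℝ, B) (extChartAt 𝓘(ℝ, B) x₀) c.1 (c.vec i) := by
  have h : (trivializationAt ((Fin k → ℝ) →L[ℝ] B) (PowTangent B M k) x₀ c).2
      (Pi.single i (1 : ℝ)) =
      (trivializationAt B (TangentSpace 𝓘(ℝ, B)) x₀).continuousLinearMapAt ℝ c.1 (c.2
        ((trivializationAt (Fin k → ℝ) (Bundle.Trivial M (Fin k → ℝ)) x₀).symmL ℝ c.1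
          (Pi.single i (1 : ℝ)))) := rfl
  have h2 : (trivializationAt (Fin k → ℝ) (Bundle.Trivial M (Fin k → ℝ)) x₀).symmL ℝ c.1
      (Pi.single i (1 : ℝ)) = (Pi.single i (1 : ℝ) : Fin k → ℝ) := by
    have := Bundle.Trivial.symmL_trivialization (𝕜 := ℝ) M (Fin k → ℝ) c.1
    exact congrArg (fun L : (Fin k → ℝ) →L[ℝ] (Fin k → ℝ) => L (Pi.single i (1 : ℝ))) this
  rw [h, h2]
  exact congrArg (fun L : B →L[ℝ] B => L (c.vec i))
    (TangentBundle.continuousLinearMapAt_trivializationAt (I := 𝓘(ℝ, B)) hc)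

theorem mem_baseSet_tangentPower {k : ℕ} {x₀ x : M} (hc : x ∈ (chartAt B x₀).source) :
    x ∈ (trivializationAt ((Fin k → ℝ) →L[ℝ] B) (PowTangent B M k) x₀).baseSet :=
  ⟨mem_univ _, hc⟩

/-- The expression in a chart of `T^{⊕k} M` of the evaluation of a form. -/
noncomputable def evalInChart {n k : ℕ} (β : Form 𝓘(ℝ, B) M n) (σ : Fin n → Fin k) (x₀ : M) :
    B × ((Fin k → ℝ) →L[ℝ] B) → ℝ :=
  fun z => Form.inChart β x₀ z.1 fun i => z.2 (Pi.single (σ i) (1 : ℝ))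

theorem evalInChart_extChartAt {n k : ℕ} (β : Form 𝓘(ℝ, B) M n) (σ : Fin n → Fin k)
    {b c : TangentPower B M k} (hc : c.1 ∈ (chartAt B b.1).source) :
    evalInChart β σ b.1 (extChartAt (powModel B k) b c) =
      (β c.1 : B [⋀^Fin n]→L[ℝ] ℝ) (fun i => c.vec (σ i)) := by
  have hs : c.1 ∈ (extChartAt 𝓘(ℝ, B) b.1).source := by rwa [extChartAt_source]
  have h := extChartAt_tot_apply (B := B) (F := (Fin k → ℝ) →L[ℝ] B) (E := PowTangent B M k) b c
    (mem_baseSet_tangentPower hc)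
  rw [h]
  refine (Form.inChart_apply β b.1 _ _).trans ?_
  refine Form.apply_congr β ((extChartAt 𝓘(ℝ, B) b.1).left_inv hs) ?_
  funext i
  refine (congrArg _ (trivializationAt_tangentPower_snd hc (σ i))).trans ?_
  have h3 := mfderivWithin_extChartAt_symm_comp_mfderiv_extChartAt' (I := 𝓘(ℝ, B)) hs
  rw [modelWithCornersSelf_coe, range_id, mfderivWithin_univ] at h3
  exact congrArg (fun L : B →L[ℝ] B => L (c.vec (σ i))) h3

variable [FiniteDimensional ℝ B]

theorem hasFDerivAt_evalInChart {n k : ℕ} {β : Form 𝓘(ℝ, B) M n} (hβ : Form.IsSmooth β)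
    (σ : Fin n → Fin k) {x₀ : M} {z : B × ((Fin k → ℝ) →L[ℝ] B)}
    (hz : z.1 ∈ (extChartAt 𝓘(ℝ, B) x₀).target) :
    ∃ D : B × ((Fin k → ℝ) →L[ℝ] B) →L[ℝ] ℝ, HasFDerivAt (evalInChart β σ x₀) D z ∧
      ∀ X Z, D (X, Z) = fderiv ℝ (Form.inChart β x₀) z.1 X (fun i => z.2 (Pi.single (σ i) 1)) +
        ∑ i, Form.inChart β x₀ z.1 (Function.update (fun i => z.2 (Pi.single (σ i) 1)) i
          (Z (Pi.single (σ i) 1))) := by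
  have h1 : HasFDerivAt (fun z : B × ((Fin k → ℝ) →L[ℝ] B) => Form.inChart β x₀ z.1)
      ((fderiv ℝ (Form.inChart β x₀) z.1).comp (ContinuousLinearMap.fst ℝ _ _)) z :=
    HasFDerivAt.comp (g := Form.inChart β x₀) z
      ((hβ.contDiffAt hz).differentiableAt (by simp)).hasFDerivAt hasFDerivAt_fst
  have h2 : ∀ i : Fin n, HasFDerivAt
      (fun z : B × ((Fin k → ℝ) →L[ℝ] B) => z.2 (Pi.single (σ i) (1 : ℝ)))
      ((ContinuousLinearMap.apply ℝ B (Pi.single (σ i) (1 : ℝ) : Fin k → ℝ)).comp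
        (ContinuousLinearMap.snd ℝ _ _)) z := fun i =>
    ((ContinuousLinearMap.apply ℝ B (Pi.single (σ i) (1 : ℝ) : Fin k → ℝ)).comp
        (ContinuousLinearMap.snd ℝ B ((Fin k → ℝ) →L[ℝ] B))).hasFDerivAt
  refine ⟨_, HasFDerivAt.continuousAlternatingMap_apply h1 h2, fun X Z => ?_⟩
  simp only [add_apply, sum_apply, ContinuousLinearMap.comp_apply]
  rfl

theorem eval_eventuallyEq {n k : ℕ} (β : Form 𝓘(ℝ, B) M n) (σ : Fin n → Fin k)
    (b : TangentPower B M k) :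
    (fun c : TangentPower B M k => (β c.1 : B [⋀^Fin n]→L[ℝ] ℝ) (fun i => c.vec (σ i))) =ᶠ[𝓝 b]
      evalInChart β σ b.1 ∘ extChartAt (powModel B k) b := by
  have hb : b.1 ∈ (chartAt B b.1).source := mem_chart_source B b.1
  filter_upwards [(FiberBundle.continuous_proj ((Fin k → ℝ) →L[ℝ] B)
    (PowTangent B M k)).continuousAt.preimage_mem_nhds ((chartAt B b.1).open_source.mem_nhds hb)]
    with c hc
  exact (evalInChart_extChartAt β σ hc).symm

/-- The product rule for a coefficient applied to vectors. The map `σ` selects which of the `k`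
vectors enter, as needed when a core lift has used up a slot. -/
theorem hasMFDerivAt_eval {n k : ℕ} {β : Form 𝓘(ℝ, B) M n} (hβ : Form.IsSmooth β)
    (σ : Fin n → Fin k) (b : TangentPower B M k) :
    ∃ D : B × ((Fin k → ℝ) →L[ℝ] B) →L[ℝ] ℝ,
      HasMFDerivAt (powModel B k) 𝓘(ℝ, ℝ)
        (fun c : TangentPower B M k => (β c.1 : B [⋀^Fin n]→L[ℝ] ℝ) (fun i => c.vec (σ i))) b D ∧
      ∀ (X : B) Z, D (X, Z) =
        fderiv ℝ (Form.inChart β b.1) (extChartAt 𝓘(ℝ, B) b.1 b.1) X (fun i => b.vec (σ i)) +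
        ∑ i, (β b.1 : B [⋀^Fin n]→L[ℝ] ℝ) (Function.update (fun i => (b.vec (σ i) : B)) i
          (Z (Pi.single (σ i) 1))) := by
  have h0 : extChartAt (powModel B k) b b = (extChartAt 𝓘(ℝ, B) b.1 b.1,
      (trivializationAt ((Fin k → ℝ) →L[ℝ] B) (PowTangent B M k) b.1 b).2) :=
    extChartAt_tot_apply (B := B) (F := (Fin k → ℝ) →L[ℝ] B) (E := PowTangent B M k) b b
      (mem_baseSet_tangentPower (mem_chart_source B b.1))
  have hz : (extChartAt (powModel B k) b b).1 ∈ (extChartAt 𝓘(ℝ, B) b.1).target := by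
    rw [h0]; exact mem_extChartAt_target b.1
  obtain ⟨D, hD, hDa⟩ := hasFDerivAt_evalInChart hβ σ hz
  refine ⟨D, ?_, fun X Z => ?_⟩
  · have h1 : HasMFDerivAt (powModel B k) 𝓘(ℝ, B × ((Fin k → ℝ) →L[ℝ] B))
        (extChartAt (powModel B k) b) b (ContinuousLinearMap.id ℝ _) := by
      have h2 : MDifferentiableAt (powModel B k) 𝓘(ℝ, B × ((Fin k → ℝ) →L[ℝ] B))
          (extChartAt (powModel B k) b) b := mdifferentiableAt_extChartAt (mem_chart_source _ b)
      have h3 := h2.hasMFDerivAt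
      rwa [mfderiv_extChartAt_self] at h3
    have h4 := HasMFDerivAt.comp b hD.hasMFDerivAt h1
    exact h4.congr_of_eventuallyEq (eval_eventuallyEq β σ b)
  · rw [hDa, h0]
    have hv : ∀ i : Fin k, (trivializationAt ((Fin k → ℝ) →L[ℝ] B) (PowTangent B M k) b.1 b).2
        (Pi.single i (1 : ℝ)) = b.vec i := fun i =>
      (trivializationAt_tangentPower_snd (mem_chart_source B b.1) i).trans
        (congrArg (fun L : B →L[ℝ] B => L (b.vec i))
          (mfderiv_extChartAt_self (I := 𝓘(ℝ, B)) (x := b.1)))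
    simp only [hv]
    rw [Form.inChart_self]
    rfl

end TangentPowers

/-! ### The anchor of `T^{⊕k} A` on tangent lifts and core lifts. -/

section Anchors

variable {B : Type*} [NormedAddCommGroup B] [NormedSpace ℝ B]
  {M : Type*} [TopologicalSpace M] [ChartedSpace B M] [IsManifold 𝓘(ℝ, B) ∞ M]
  {F : Type*} [NormedAddCommGroup F] [NormedSpace ℝ F]
  {E : M → Type*} [TopologicalSpace (TotalSpace F E)] [∀ x, AddCommGroup (E x)]
  [∀ x, Module ℝ (E x)] [∀ x, TopologicalSpace (E x)] [FiberBundle F E] [VectorBundle ℝ F E]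
  [ContMDiffVectorBundle ∞ F E 𝓘(ℝ, B)] [FiniteDimensional ℝ B] [FiniteDimensional ℝ F]

theorem modelDeriv_homothety (c : ℝ) (p : TotalSpace F E) :
    modelDeriv (totModel B F) (totModel B F) (homothety F E c) p = scaleSnd B F c := by
  have hd : MDifferentiableAt (totModel B F) (totModel B F) (homothety F E c) p :=
    (contMDiff_homothety c).mdifferentiableAt (by simp)
  rw [modelDeriv_eq_fderiv hd]
  have : (extChartAt (totModel B F) (homothety F E c p) ∘ homothety F E c ∘
      (extChartAt (totModel B F) p).symm) =ᶠ[𝓝 (extChartAt (totModel B F) p p)]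
      scaleSnd B F c := by
    filter_upwards [(isOpen_extChartAt_target p).mem_nhds (mem_extChartAt_target p)] with z hz
    refine Eq.trans ?_ (locRep_homothety (B := B) c hz)
    exact congrArg (fun f : PartialEquiv (TotalSpace F E) (B × F) =>
      f (homothety F E c ((extChartAt (totModel B F) p).symm z)))
      (extChartAt_tot_congr (B := B) p.1 (c • p.2) p.2)
  rw [this.fderiv_eq, ContinuousLinearMap.fderiv]

/-- The map `E → TM` underlying the anchor. -/
noncomputable def LieAlgebroid.anchorMap (A : LieAlgebroid (B := B) F E) :
    TotalSpace F E → TangentBundle 𝓘(ℝ, B) M := fun r => ⟨r.1, A.anchor r.1 r.2⟩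

theorem LieAlgebroid.contMDiff_anchorMap (A : LieAlgebroid (B := B) F E) :
    ContMDiff (totModel B F) (totModel B B) ∞ A.anchorMap := A.anchor_smooth

theorem LieAlgebroid.mdifferentiableAt_anchorMap (A : LieAlgebroid (B := B) F E)
    (p : TotalSpace F E) : MDifferentiableAt (totModel B F) (totModel B B) A.anchorMap p :=
  A.contMDiff_anchorMap.mdifferentiableAt (by simp)

theorem LieAlgebroid.anchorTangent_eq (A : LieAlgebroid (B := B) F E) (p : TotalSpace F E)
    (W : B × F) : A.anchorTangent (p := p) W =
      (modelDeriv (totModel B F) (totModel B B) A.anchorMap p W).2 := rfl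

/-- The anchor commutes with the homotheties of `E` and of `TM`; this is the derivative of that
relation. -/
theorem LieAlgebroid.anchorTangent_smul (A : LieAlgebroid (B := B) F E) (x : M) (u : E x)
    (c : ℝ) (v : B) (f : F) :
    A.anchorTangent (p := (⟨x, c • u⟩ : TotalSpace F E)) ((v, c • f) : B × F) =
      c • A.anchorTangent (p := (⟨x, u⟩ : TotalSpace F E)) ((v, f) : B × F) := by
  have h1 := modelDeriv_comp (I := totModel B F) (I' := totModel B F) (I'' := totModel B B)
    (ψ := A.anchorMap) (φ := homothety F E c) ⟨x, u⟩ (A.mdifferentiableAt_anchorMap _)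
    ((contMDiff_homothety c).mdifferentiableAt (by simp))
  have h2 := modelDeriv_comp (I := totModel B F) (I' := totModel B B) (I'' := totModel B B)
    (ψ := homothety B (TangentSpace 𝓘(ℝ, B) (M := M)) c) (φ := A.anchorMap) ⟨x, u⟩
    ((contMDiff_homothety c).mdifferentiableAt (by simp)) (A.mdifferentiableAt_anchorMap _)
  have e : A.anchorMap ∘ homothety F E c =
      homothety B (TangentSpace 𝓘(ℝ, B) (M := M)) c ∘ A.anchorMap := by
    funext r
    show (⟨r.1, A.anchor r.1 (c • r.2)⟩ : TangentBundle 𝓘(ℝ, B) M) = ⟨r.1, c • A.anchor r.1 r.2⟩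
    rw [map_smul]
  rw [e, h2, modelDeriv_homothety, modelDeriv_homothety] at h1
  exact (congrArg (fun L : B × F →L[ℝ] B × B => (L (v, f)).2) h1).symm

/-- Differentiability and homogeneity give linearity in the fibre data, which makes the anchor of
`T^{⊕k} A` linear on fibres. -/
theorem LieAlgebroid.exists_anchorTangent_eq (A : LieAlgebroid (B := B) F E) (x : M) (v : B) :
    ∃ L : F × F →L[ℝ] B, ∀ (u : E x) (f : F),
      A.anchorTangent (p := (⟨x, u⟩ : TotalSpace F E)) ((v, f) : B × F) =
        L (fiberCoord F E x u, f) := by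
  let y₀ : B := extChartAt 𝓘(ℝ, B) x x
  let K : B × F → B × B := extChartAt (totModel B B) (⟨x, 0⟩ : TangentBundle 𝓘(ℝ, B) M) ∘
    A.anchorMap ∘ (extChartAt (totModel B F) (⟨x, 0⟩ : TotalSpace F E)).symm
  -- Since charts depend on base points only, a single coordinate expression `K` computes the
  -- derivative at all points of the fibre.
  have hK : ∀ u : E x, modelDeriv (totModel B F) (totModel B B) A.anchorMap ⟨x, u⟩ =
      fderiv ℝ K (y₀, fiberCoord F E x u) := by
    intro u
    rw [modelDeriv_eq_fderiv (A.mdifferentiableAt_anchorMap _), extChartAt_tot_self]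
    have h1 := extChartAt_tot_congr (B := B) (F := F) x u 0
    have h2 := extChartAt_tot_congr (B := B) (F := B) (E := TangentSpace 𝓘(ℝ, B)) x (A.anchor x u) 0
    rw [h1]
    refine congrArg (fun f => fderiv ℝ (f ∘ A.anchorMap ∘
      (extChartAt (totModel B F) (⟨x, 0⟩ : TotalSpace F E)).symm) (y₀, fiberCoord F E x u)) ?_
    exact congrArg (fun f : PartialEquiv (TangentBundle 𝓘(ℝ, B) M) (B × B) => ⇑f) h2
  have hs : ContDiffAt ℝ ∞ K (y₀, (0 : F)) := by
    refine contDiffAt_locRep (mem_target_fiber F x 0 0) A.contMDiff_anchorMap.contMDiffAt ?_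
    have h := (extChartAt (totModel B F) (⟨x, 0⟩ : TotalSpace F E)).map_target
      (mem_target_fiber F x 0 (0 : F))
    have h' := ((mem_extChartAt_tot_source _ _).1 h).2
    exact (mem_extChartAt_tot_source _ _).2 ⟨by rwa [extChartAt_source] at h', h'⟩
  have hd : DifferentiableAt ℝ (fun a : F × F => (fderiv ℝ K (y₀, a.1) (v, a.2)).2) 0 := by
    have h1 : DifferentiableAt ℝ (fderiv ℝ K) (y₀, (0 : F × F).1) :=
      (hs.fderiv_right (m := ∞) (by rfl)).differentiableAt (by simp)
    have h2 : DifferentiableAt ℝ (fun a : F × F => fderiv ℝ K (y₀, a.1)) 0 :=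
      DifferentiableAt.comp (g := fderiv ℝ K) (0 : F × F) h1
        (by fun_prop : DifferentiableAt ℝ (fun a : F × F => ((y₀, a.1) : B × F)) 0)
    have h3 : DifferentiableAt ℝ (fun a : F × F => fderiv ℝ K (y₀, a.1) (v, a.2)) 0 :=
      h2.clm_apply (by fun_prop)
    exact h3.snd
  obtain ⟨L, hL⟩ := exists_linear_of_homogeneous hd fun c a => by
    have h := A.anchorTangent_smul x ((fiberCoord F E x).symm a.1) c v a.2
    simp only [LieAlgebroid.anchorTangent_eq, hK] at h
    rw [map_smul, ContinuousLinearEquiv.apply_symm_apply] at h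
    exact h
  refine ⟨L, fun u f => ?_⟩
  rw [LieAlgebroid.anchorTangent_eq, hK, ← hL]

theorem powAnchor_snd_single (A : LieAlgebroid (B := B) F E) {k : ℕ} (b : TangentPower B M k)
    (w : PowFiber F E b) (i : Fin k) :
    (A.powAnchor b w : B × ((Fin k → ℝ) →L[ℝ] B)).2 (Pi.single i 1) =
      A.anchorTangent (PowFiber.vec w i) := by
  have h : (A.powAnchor b w : B × ((Fin k → ℝ) →L[ℝ] B)).2 =
    ∑ i : Fin k, (ContinuousLinearMap.proj (R := ℝ) (φ := fun _ : Fin k => ℝ) i).smulRight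
      (A.anchorTangent (PowFiber.vec w i)) := rfl
  rw [h, sum_apply, Finset.sum_eq_single i]
  · simp
  · intro j _ hj
    simp [Pi.single_eq_of_ne hj]
  · simp

theorem clm_pi_ext {k : ℕ} {L L' : (Fin k → ℝ) →L[ℝ] B}
    (h : ∀ i, L (Pi.single i 1) = L' (Pi.single i 1)) : L = L' := by
  refine ContinuousLinearMap.coe_injective (LinearMap.pi_ext' fun i => ?_)
  refine LinearMap.ext_ring ?_
  exact h i

theorem powAnchor_add (A : LieAlgebroid (B := B) F E) {k : ℕ} (b : TangentPower B M k)
    (w w' : PowFiber F E b) :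
    A.powAnchor b (w + w') = A.powAnchor b w + A.powAnchor b w' := by
  refine Prod.ext (map_add _ _ _) (clm_pi_ext fun i => ?_)
  obtain ⟨L, hL⟩ := A.exists_anchorTangent_eq b.1 (b.vec i)
  refine (powAnchor_snd_single A b _ i).trans ((hL _ _).trans ?_)
  refine Eq.trans ?_ (congrArg₂ (· + ·) ((powAnchor_snd_single A b w i).trans (hL _ _))
    ((powAnchor_snd_single A b w' i).trans (hL _ _))).symm
  rw [← map_add, Prod.fst_add, map_add]
  rfl

theorem powAnchor_smul (A : LieAlgebroid (B := B) F E) {k : ℕ} (b : TangentPower B M k)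
    (c : ℝ) (w : PowFiber F E b) : A.powAnchor b (c • w) = c • A.powAnchor b w := by
  refine Prod.ext (map_smul _ _ _) (clm_pi_ext fun i => ?_)
  obtain ⟨L, hL⟩ := A.exists_anchorTangent_eq b.1 (b.vec i)
  refine (powAnchor_snd_single A b _ i).trans ((hL _ _).trans ?_)
  refine Eq.trans ?_ (congrArg (c • ·) ((powAnchor_snd_single A b w i).trans (hL _ _))).symm
  rw [← map_smul, Prod.smul_fst, map_smul]
  rfl

/-- By the chain rule `Tρ ∘ Te = T(ρ(e))`, whose fibre component is the derivative of `ρ(e)` in the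
chart. -/
theorem anchorTangent_tangentLift (A : LieAlgebroid (B := B) F E) {k : ℕ} (e : Sec (B := B) F E)
    (b : TangentPower B M k) (i : Fin k) :
    A.anchorTangent (PowFiber.vec (tangentLift k e b) i) =
      fderiv ℝ (vectorFieldInChart (A.rho e) b.1) (extChartAt 𝓘(ℝ, B) b.1 b.1) (b.vec i) := by
  have hs := (contMDiff_sectionMap e).mdifferentiableAt (x := b.1) (by simp)
  have h1 : A.anchorTangent (PowFiber.vec (tangentLift k e b) i) =
      (modelDeriv (totModel B F) (totModel B B) A.anchorMap (sectionMap e b.1)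
        (modelDeriv 𝓘(ℝ, B) (totModel B F) (sectionMap e) b.1 (b.vec i))).2 := by
    have h2 : (PowFiber.vec (tangentLift k e b) i : B × F) =
        modelDeriv 𝓘(ℝ, B) (totModel B F) (sectionMap e) b.1 (b.vec i) :=
      Prod.ext (modelDeriv_sectionMap_fst e b.1 (b.vec i)).symm rfl
    exact congrArg (fun W : B × F => (modelDeriv (totModel B F) (totModel B B) A.anchorMap
      (sectionMap e b.1) W).2) h2
  have h3 := modelDeriv_comp (I := 𝓘(ℝ, B)) (I' := totModel B F) (I'' := totModel B B)
    (ψ := A.anchorMap) (φ := sectionMap e) b.1 (A.mdifferentiableAt_anchorMap _) hs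
  rw [h1]
  refine (congrArg (fun L : B →L[ℝ] B × B => (L (b.vec i)).2) h3).symm.trans ?_
  refine (modelDeriv_tot_snd ((A.mdifferentiableAt_anchorMap _).comp b.1 hs) (b.vec i)).trans ?_
  refine congrArg (fun L : B →L[ℝ] B => L (b.vec i)) (Filter.EventuallyEq.fderiv_eq ?_)
  filter_upwards [(isOpen_extChartAt_target b.1).mem_nhds (mem_extChartAt_target b.1)] with z hz
  have hz' := (extChartAt 𝓘(ℝ, B) b.1).map_target hz
  rw [extChartAt_source] at hz'
  exact trivializationAt_tangent_snd hz' _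

/-- At the zero section a vector splits into a horizontal part, preserved because `ρ` maps zero
section to zero section, and a vertical part, on which `Tρ` is `ρ` by linearity. -/
theorem anchorTangent_vertical (A : LieAlgebroid (B := B) F E) (x : M) (v : B) (u : E x) :
    A.anchorTangent (p := (⟨x, 0⟩ : TotalSpace F E)) ((v, fiberCoord F E x u) : B × F) =
      A.anchor x u := by
  have hz := (contMDiff_zero_section (B := B) (F := F) (E := E)).mdifferentiableAt (x := x)
    (by simp)
  have e0 : A.anchorMap ∘ (fun y : M => (⟨y, 0⟩ : TotalSpace F E)) =
      fun y : M => (⟨y, 0⟩ : TangentBundle 𝓘(ℝ, B) M) := by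
    funext y
    show (⟨y, A.anchor y 0⟩ : TangentBundle 𝓘(ℝ, B) M) = _
    rw [map_zero]
  have h1 := modelDeriv_comp (I := 𝓘(ℝ, B)) (I' := totModel B F) (I'' := totModel B B)
    (ψ := A.anchorMap) (φ := fun y : M => (⟨y, 0⟩ : TotalSpace F E)) x
    (A.mdifferentiableAt_anchorMap _) hz
  rw [e0] at h1
  have h2 : (modelDeriv (totModel B F) (totModel B B) A.anchorMap (⟨x, 0⟩ : TotalSpace F E)
      (v, 0)) = (v, 0) := by
    refine (congrArg (fun W : B × F => modelDeriv (totModel B F) (totModel B B) A.anchorMap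
      (⟨x, 0⟩ : TotalSpace F E) W) (zeroTangent_apply (F := F) (E := E) x v)).symm.trans ?_
    refine (congrArg (fun L : B →L[ℝ] B × B => L v) h1).symm.trans ?_
    exact zeroTangent_apply (F := B) (E := TangentSpace 𝓘(ℝ, B)) x v
  have hl := (contMDiff_fiberLine (B := B) (F := F) 0 u).mdifferentiableAt (x := 0) (by simp)
  have h3 := modelDeriv_comp (I := 𝓘(ℝ, ℝ)) (I' := totModel B F) (I'' := totModel B B)
    (ψ := A.anchorMap) (φ := fun t : ℝ => (⟨x, 0 + t • u⟩ : TotalSpace F E)) 0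
    (A.mdifferentiableAt_anchorMap _) hl
  have e3 : A.anchorMap ∘ (fun t : ℝ => (⟨x, 0 + t • u⟩ : TotalSpace F E)) =
      fun t : ℝ => (⟨x, 0 + t • A.anchor x u⟩ : TangentBundle 𝓘(ℝ, B) M) := by
    funext t
    show (⟨x, A.anchor x (0 + t • u)⟩ : TangentBundle 𝓘(ℝ, B) M) = _
    rw [map_add, map_smul, map_zero]
  rw [e3] at h3
  have h4 : modelDeriv (totModel B F) (totModel B B) A.anchorMap
      (⟨x, 0 + (0 : ℝ) • u⟩ : TotalSpace F E) (0, fiberCoord F E x u) = (0, A.anchor x u) := by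
    refine (congrArg (fun W : B × F => modelDeriv (totModel B F) (totModel B B) A.anchorMap
      (⟨x, 0 + (0 : ℝ) • u⟩ : TotalSpace F E) W) (modelDeriv_fiberLine (B := B) 0 u)).symm.trans ?_
    refine (congrArg (fun L : ℝ →L[ℝ] B × B => L 1) h3).symm.trans ?_
    refine (modelDeriv_fiberLine (B := B) (F := B) (E := TangentSpace 𝓘(ℝ, B)) 0
      (A.anchor x u)).trans ?_
    exact congrArg (fun f : B => ((0, f) : B × B)) (fiberCoord_tangentSpace (B := B) x (A.anchor x u))
  rw [zero_smul, add_zero] at h4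
  have h5 : ((v, fiberCoord F E x u) : B × F) = (v, 0) + (0, fiberCoord F E x u) := by simp
  refine (congrArg (fun W : B × F => (modelDeriv (totModel B F) (totModel B B) A.anchorMap
    (⟨x, 0⟩ : TotalSpace F E) W).2) h5).trans ?_
  rw [map_add, h2, Prod.snd_add, h4]
  exact zero_add (A.anchor x u)

theorem coreLift_vec {k : ℕ} (j : Fin k) (e : Sec (B := B) F E) (b : TangentPower B M k)
    (i : Fin k) : (PowFiber.vec (coreLift j e b) i : B × F) =
      (b.vec i, if i = j then fiberCoord F E b.1 (e b.1) else 0) := by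
  refine Prod.ext rfl ?_
  show ((zeroTangent B F E b.1 (b.vec i)) : B × F).2 +
      (if i = j then ((verticalAtZero (B := B) F (e b.1)) : B × F).2 else 0) = _
  rw [verticalAtZero_eq]
  have h : ((zeroTangent B F E b.1 (b.vec i)) : B × F).2 = 0 :=
    congrArg Prod.snd (zeroTangent_apply (B := B) (F := F) (E := E) b.1 (b.vec i))
  rw [h, zero_add]

theorem anchorTangent_coreLift (A : LieAlgebroid (B := B) F E) {k : ℕ} (j : Fin k)
    (e : Sec (B := B) F E) (b : TangentPower B M k) (i : Fin k) :
    A.anchorTangent (PowFiber.vec (coreLift j e b) i) = if i = j then A.rho e b.1 else 0 := by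
  refine (congrArg (fun W : B × F => A.anchorTangent (p := (⟨b.1, 0⟩ : TotalSpace F E)) W)
    (coreLift_vec j e b i)).trans ?_
  by_cases h : i = j
  · simp only [h, if_true]
    exact anchorTangent_vertical A b.1 (b.vec j) (e b.1)
  · simp only [h, if_false]
    have := anchorTangent_vertical A b.1 (b.vec i) (0 : E b.1)
    rwa [map_zero, map_zero] at this

theorem LieAlgebroid.isSmoothVectorField_rho (A : LieAlgebroid (B := B) F E)
    (e : Sec (B := B) F E) : IsSmoothVectorField (I := 𝓘(ℝ, B)) (A.rho e) :=
  isSmoothVectorField_of_contMDiff (A.contMDiff_anchorMap.comp (contMDiff_sectionMap e))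

/-- The anchor of `T e` is the tangent lift of `ρ(e)`, so the product rule gives the coordinate
formula for the Lie derivative. -/
theorem dirDeriv_eval_tangentLift (A : LieAlgebroid (B := B) F E) {n k : ℕ}
    {β : Form 𝓘(ℝ, B) M n} (hβ : Form.IsSmooth β) (σ : Fin n → Fin k) (e : Sec (B := B) F E)
    (b : TangentPower B M k) :
    dirDeriv (powModel B k) (fun c : TangentPower B M k =>
      (β c.1 : B [⋀^Fin n]→L[ℝ] ℝ) (fun i => c.vec (σ i))) b (A.powAnchor b (tangentLift k e b)) =
    (Form.lieDer (A.rho e) β b.1 : B [⋀^Fin n]→L[ℝ] ℝ) (fun i => b.vec (σ i)) := by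
  obtain ⟨D, hD, hDa⟩ := hasMFDerivAt_eval hβ σ b
  refine (congrArg (fun L : B × ((Fin k → ℝ) →L[ℝ] B) →L[ℝ] ℝ =>
    L (A.powAnchor b (tangentLift k e b))) hD.mfderiv).trans ?_
  refine (hDa _ _).trans ((Form.lieDer_apply hβ (A.isSmoothVectorField_rho e) b.1 _).trans ?_).symm
  refine congrArg₂ (· + ·) rfl (Finset.sum_congr rfl fun i _ => ?_)
  refine congrArg (fun z : B => (β b.1 : B [⋀^Fin n]→L[ℝ] ℝ)
    (Function.update (fun i => (b.vec (σ i) : B)) i z)) ?_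
  exact ((powAnchor_snd_single A b _ (σ i)).trans (anchorTangent_tangentLift A e b (σ i))).symm

/-- The anchor of a core lift is vertical, with `ρ(e)` in slot `j` only; the derivative replaces the
vector in that slot. -/
theorem dirDeriv_eval_coreLift (A : LieAlgebroid (B := B) F E) {n k : ℕ}
    {β : Form 𝓘(ℝ, B) M n} (hβ : Form.IsSmooth β) (σ : Fin n → Fin k) (j : Fin k)
    (e : Sec (B := B) F E) (b : TangentPower B M k) :
    dirDeriv (powModel B k) (fun c : TangentPower B M k =>
      (β c.1 : B [⋀^Fin n]→L[ℝ] ℝ) (fun i => c.vec (σ i))) b (A.powAnchor b (coreLift j e b)) =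
    ∑ i, if σ i = j then (β b.1 : B [⋀^Fin n]→L[ℝ] ℝ)
      (Function.update (fun i => (b.vec (σ i) : B)) i (A.rho e b.1)) else 0 := by
  obtain ⟨D, hD, hDa⟩ := hasMFDerivAt_eval hβ σ b
  refine (congrArg (fun L : B × ((Fin k → ℝ) →L[ℝ] B) →L[ℝ] ℝ =>
    L (A.powAnchor b (coreLift j e b))) hD.mfderiv).trans ?_
  refine (hDa _ _).trans ?_
  have h0 : (A.powAnchor b (coreLift j e b) : B × ((Fin k → ℝ) →L[ℝ] B)).1 = 0 :=
    map_zero (A.anchor b.1)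
  have h1 : ∀ i, (A.powAnchor b (coreLift j e b) : B × ((Fin k → ℝ) →L[ℝ] B)).2
      (Pi.single i 1) = if i = j then A.rho e b.1 else 0 := fun i =>
    (powAnchor_snd_single A b _ i).trans (anchorTangent_coreLift A j e b i)
  have h2 : fderiv ℝ (Form.inChart β b.1) (extChartAt 𝓘(ℝ, B) b.1 b.1)
      (A.powAnchor b (coreLift j e b) : B × ((Fin k → ℝ) →L[ℝ] B)).1
      (fun i => (b.vec (σ i) : B)) = 0 := by
    rw [h0, map_zero]; rfl
  refine (congrArg₂ (· + ·) h2 rfl).trans ((zero_add _).trans ?_)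
  refine Finset.sum_congr rfl fun i _ => ?_
  refine (congrArg (fun z : B => (β b.1 : B [⋀^Fin n]→L[ℝ] ℝ)
    (Function.update (fun i => (b.vec (σ i) : B)) i z)) (h1 (σ i))).trans ?_
  by_cases h : σ i = j
  · simp only [h, if_true]
  · simp only [h, if_false]
    exact ContinuousAlternatingMap.map_update_zero _ _ _

theorem mdifferentiableAt_eval {n k : ℕ} {β : Form 𝓘(ℝ, B) M n} (hβ : Form.IsSmooth β)
    (σ : Fin n → Fin k) (b : TangentPower B M k) :
    MDifferentiableAt (powModel B k) 𝓘(ℝ, ℝ) (fun c : TangentPower B M k =>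
      (β c.1 : B [⋀^Fin n]→L[ℝ] ℝ) (fun i => c.vec (σ i))) b := by
  obtain ⟨D, hD, -⟩ := hasMFDerivAt_eval hβ σ b
  exact hD.mdifferentiableAt

end Anchors

/-! ### Rules for directional derivatives. -/

section DirectionalDerivatives

variable {V : Type*} [NormedAddCommGroup V] [NormedSpace ℝ V] {H : Type*} [TopologicalSpace H]
  {I : ModelWithCorners ℝ V H} {N : Type*} [TopologicalSpace N] [ChartedSpace H N]

theorem dirDeriv_add {f g : N → ℝ} {x : N} (hf : MDifferentiableAt I 𝓘(ℝ, ℝ) f x)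
    (hg : MDifferentiableAt I 𝓘(ℝ, ℝ) g x) (v : TangentSpace I x) :
    dirDeriv I (fun y => f y + g y) x v = dirDeriv I f x v + dirDeriv I g x v :=
  congrArg (fun L : V →L[ℝ] ℝ => L v) (hf.hasMFDerivAt.add hg.hasMFDerivAt).mfderiv

theorem dirDeriv_mul {f g : N → ℝ} {x : N} (hf : MDifferentiableAt I 𝓘(ℝ, ℝ) f x)
    (hg : MDifferentiableAt I 𝓘(ℝ, ℝ) g x) (v : TangentSpace I x) :
    dirDeriv I (fun y => f y * g y) x v = f x * dirDeriv I g x v + g x * dirDeriv I f x v :=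
  congrArg (fun L : V →L[ℝ] ℝ => L v) (hf.hasMFDerivAt.mul hg.hasMFDerivAt).mfderiv

theorem dirDeriv_const_mul {f : N → ℝ} {x : N} (hf : MDifferentiableAt I 𝓘(ℝ, ℝ) f x) (c : ℝ)
    (v : TangentSpace I x) :
    dirDeriv I (fun y => c * f y) x v = c * dirDeriv I f x v :=
  congrArg (fun L : V →L[ℝ] ℝ => L v) (hf.hasMFDerivAt.const_smul c).mfderiv

theorem dirDeriv_vector_add (f : N → ℝ) (x : N) (v w : TangentSpace I x) :
    dirDeriv I f x (v + w) = dirDeriv I f x v + dirDeriv I f x w :=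
  map_add (mfderiv I 𝓘(ℝ, ℝ) f x) v w

theorem dirDeriv_vector_smul (f : N → ℝ) (x : N) (c : ℝ) (v : TangentSpace I x) :
    dirDeriv I f x (c • v) = c * dirDeriv I f x v :=
  map_smul (mfderiv I 𝓘(ℝ, ℝ) f x) c v

end DirectionalDerivatives

/-! ### Values of a linear form on the generators, and their derivatives. -/

section Evaluation

variable {B : Type*} [NormedAddCommGroup B] [NormedSpace ℝ B]
  {M : Type*} [TopologicalSpace M] [ChartedSpace B M] [IsManifold 𝓘(ℝ, B) ∞ M]
  {F : Type*} [NormedAddCommGroup F] [NormedSpace ℝ F]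
  {E : M → Type*} [TopologicalSpace (TotalSpace F E)] [∀ x, AddCommGroup (E x)]
  [∀ x, Module ℝ (E x)] [∀ x, TopologicalSpace (E x)] [FiberBundle F E] [VectorBundle ℝ F E]
  [ContMDiffVectorBundle ∞ F E 𝓘(ℝ, B)] [FiniteDimensional ℝ B] [FiniteDimensional ℝ F]

/-- The form `μ(e)` for a section `e`. -/
noncomputable def TotForm.muSec {n : ℕ} (θ : TotForm B F E (n + 1)) (e : Sec (B := B) F E) :
    Form 𝓘(ℝ, B) M n := fun x => TotForm.mu θ x (e x)

/-- The form `η(e)` for a section `e`. -/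
noncomputable def TotForm.etaSec {n : ℕ} (θ : TotForm B F E n) (e : Sec (B := B) F E) :
    Form 𝓘(ℝ, B) M n := fun x => TotForm.eta θ x (e x)

theorem TotForm.IsLinear.isSmooth_muSec {n : ℕ} {θ : TotForm B F E (n + 1)} (hs : Form.IsSmooth θ)
    (hl : TotForm.IsLinear θ) (e : Sec (B := B) F E) : Form.IsSmooth (θ.muSec e) :=
  (hl.isFormValuedMorphism_mu hs).smooth e

theorem TotForm.IsLinear.isSmooth_etaSec {n : ℕ} {θ : TotForm B F E n} (hs : Form.IsSmooth θ)
    (hl : TotForm.IsLinear θ) (e : Sec (B := B) F E) : Form.IsSmooth (θ.etaSec e) :=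
  (hl.isFormValuedMorphism_eta hs).smooth e

theorem TotForm.eval_tangentLift {k : ℕ} (θ : TotForm B F E k) (e : Sec (B := B) F E)
    (b : TangentPower B M k) : θ.eval b (tangentLift k e b) =
      (Form.pullback (I := 𝓘(ℝ, B)) (sectionMap e) θ b.1 : B [⋀^Fin k]→L[ℝ] ℝ)
        (fun i => b.vec i) := by
  refine Eq.trans ?_ (Form.pullback_apply (I := 𝓘(ℝ, B)) (sectionMap e) θ b.1 _).symm
  refine congrArg (θ (sectionMap e b.1) : (B × F) [⋀^Fin k]→L[ℝ] ℝ) ?_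
  funext i
  exact Prod.ext (modelDeriv_sectionMap_fst e b.1 (b.vec i)).symm rfl

/-- The case `c = 0` of linearity: the restriction of a linear form to the zero section vanishes. -/
theorem TotForm.IsLinear.apply_horizontal {k : ℕ} {θ : TotForm B F E k} (hl : TotForm.IsLinear θ)
    (x : M) (v : Fin k → B) :
    (θ ⟨x, 0⟩ : (B × F) [⋀^Fin k]→L[ℝ] ℝ) (fun i => (v i, 0)) = 0 := by
  have h := hl.inChart (mem_target_fiber F x 0 0) 0 (fun i => ((v i, 0) : B × F))
  simp only [scaleSnd_apply, smul_zero, zero_mul] at h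
  have h0 := Form.inChart_fiber θ x 0 0
  rw [map_zero] at h0
  exact (congrArg (fun L : (B × F) [⋀^Fin k]→L[ℝ] ℝ => L fun i => (v i, 0)) h0).symm.trans h

theorem alternating_update {W : Type*} [NormedAddCommGroup W] [NormedSpace ℝ W] {n : ℕ}
    (α : W [⋀^Fin (n + 1)]→L[ℝ] ℝ) (v : Fin (n + 1) → W) (j : Fin (n + 1)) (x : W) :
    α (Function.update v j x) =
      (-1) ^ (j : ℕ) * α (Fin.cons x fun i => v (j.succAbove i)) := by
  rw [← Fin.insertNth_removeNth, ContinuousAlternatingMap.map_insertNth, zsmul_eq_mul]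
  push_cast
  rfl

/-- Expanding slot `j` as horizontal plus vertical, the horizontal part contributes nothing; moving
the vertical vector to the front gives the sign. -/
theorem TotForm.IsLinear.eval_coreLift {n : ℕ} {θ : TotForm B F E (n + 1)}
    (hl : TotForm.IsLinear θ) (j : Fin (n + 1)) (e : Sec (B := B) F E)
    (b : TangentPower B M (n + 1)) : θ.eval b (coreLift j e b) = (-1) ^ (j : ℕ) *
      (θ.muSec e b.1 : B [⋀^Fin n]→L[ℝ] ℝ) (fun i => b.vec (j.succAbove i)) := by
  let w : Fin (n + 1) → B := fun i => b.vec i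
  let v : Fin (n + 1) → B × F := fun i => (w i, 0)
  let α : (B × F) [⋀^Fin (n + 1)]→L[ℝ] ℝ := θ ⟨b.1, 0⟩
  let f : F := fiberCoord F E b.1 (e b.1)
  have h1 : θ.eval b (coreLift j e b) = α (Function.update v j (v j + (0, f))) := by
    refine congrArg α ?_
    funext i
    refine (coreLift_vec j e b i).trans ?_
    show ((w i, if i = j then f else 0) : B × F) = Function.update v j (v j + (0, f)) i
    by_cases h : i = j
    · subst h
      simp [v]
    · simp [v, h]
  have h2 : α (Function.update v j (v j)) = 0 := by
    rw [Function.update_eq_self]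
    exact hl.apply_horizontal b.1 (fun i => b.vec i)
  rw [h1, ContinuousAlternatingMap.map_update_add, h2, zero_add, alternating_update]
  refine congrArg _ ?_
  exact (TotForm.mu_apply θ b.1 (e b.1) _).symm

variable (A : LieAlgebroid (B := B) F E)

theorem dirDeriv_evalCore_tangentLift {n : ℕ} {θ : TotForm B F E (n + 1)} (hs : Form.IsSmooth θ)
    (hl : TotForm.IsLinear θ) (j : Fin (n + 1)) (e₁ e₂ : Sec (B := B) F E)
    (b : TangentPower B M (n + 1)) :
    dirDeriv (powModel B (n + 1)) (fun c => θ.eval c (coreLift j e₂ c)) b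
      (A.powAnchor b (tangentLift (n + 1) e₁ b)) = (-1) ^ (j : ℕ) *
      (Form.lieDer (A.rho e₁) (θ.muSec e₂) b.1 : B [⋀^Fin n]→L[ℝ] ℝ)
        (fun i => b.vec (j.succAbove i)) := by
  simp only [hl.eval_coreLift]
  refine (dirDeriv_const_mul (mdifferentiableAt_eval (hl.isSmooth_muSec hs e₂) j.succAbove b)
    _ _).trans ?_
  exact congrArg _ (dirDeriv_eval_tangentLift A (hl.isSmooth_muSec hs e₂) j.succAbove e₁ b)

theorem dirDeriv_evalTangent_coreLift {n : ℕ} {θ : TotForm B F E (n + 1)} (hs : Form.IsSmooth θ)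
    (j : Fin (n + 1)) (e₁ e₂ : Sec (B := B) F E) (b : TangentPower B M (n + 1)) :
    dirDeriv (powModel B (n + 1)) (fun c => θ.eval c (tangentLift (n + 1) e₁ c)) b
      (A.powAnchor b (coreLift j e₂ b)) = (-1) ^ (j : ℕ) *
      (Form.interiorSucc (A.rho e₂) (Form.pullback (I := 𝓘(ℝ, B)) (sectionMap e₁) θ) b.1 :
        B [⋀^Fin n]→L[ℝ] ℝ) (fun i => b.vec (j.succAbove i)) := by
  simp only [TotForm.eval_tangentLift]
  refine (dirDeriv_eval_coreLift A (hs.pullback (contMDiff_sectionMap e₁)) id j e₂ b).trans ?_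
  rw [Finset.sum_eq_single j]
  · rw [if_pos (by rfl)]
    exact alternating_update (W := B) (Form.pullback (I := 𝓘(ℝ, B)) (sectionMap e₁) θ b.1 :
      B [⋀^Fin (n + 1)]→L[ℝ] ℝ) _ j _
  · intro i _ hi
    exact if_neg hi
  · simp

theorem dirDeriv_evalTangent_tangentLift {k : ℕ} {θ : TotForm B F E k} (hs : Form.IsSmooth θ)
    (e₁ e₂ : Sec (B := B) F E) (b : TangentPower B M k) :
    dirDeriv (powModel B k) (fun c => θ.eval c (tangentLift k e₂ c)) b
      (A.powAnchor b (tangentLift k e₁ b)) =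
      (Form.lieDer (A.rho e₁) (Form.pullback (I := 𝓘(ℝ, B)) (sectionMap e₂) θ) b.1 :
        B [⋀^Fin k]→L[ℝ] ℝ) (fun i => b.vec i) := by
  simp only [TotForm.eval_tangentLift]
  exact dirDeriv_eval_tangentLift A (hs.pullback (contMDiff_sectionMap e₂)) id e₁ b

/-- The function differentiated does not involve the vector in slot `j`, the only one that moves. -/
theorem dirDeriv_evalCore_coreLift_self {n : ℕ} {θ : TotForm B F E (n + 1)}
    (hs : Form.IsSmooth θ) (hl : TotForm.IsLinear θ) (j : Fin (n + 1)) (e₁ e₂ : Sec (B := B) F E)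
    (b : TangentPower B M (n + 1)) :
    dirDeriv (powModel B (n + 1)) (fun c => θ.eval c (coreLift j e₂ c)) b
      (A.powAnchor b (coreLift j e₁ b)) = 0 := by
  simp only [hl.eval_coreLift]
  refine (dirDeriv_const_mul (mdifferentiableAt_eval (hl.isSmooth_muSec hs e₂) j.succAbove b)
    _ _).trans ?_
  refine mul_eq_zero_of_right _ ?_
  refine (dirDeriv_eval_coreLift A (hl.isSmooth_muSec hs e₂) j.succAbove j e₁ b).trans ?_
  exact Finset.sum_eq_zero fun i _ => if_neg (Fin.succAbove_ne j i)

/-- Every slot other than `j` is `j.succAbove l`. Its position among the slots left after removing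
`j` is `l`, hence the exponent. -/
theorem dirDeriv_evalCore_coreLift {n : ℕ} {θ : TotForm B F E (n + 2)}
    (hs : Form.IsSmooth θ) (hl : TotForm.IsLinear θ) (j : Fin (n + 2)) (l : Fin (n + 1))
    (e₁ e₂ : Sec (B := B) F E) (b : TangentPower B M (n + 2)) :
    dirDeriv (powModel B (n + 2)) (fun c => θ.eval c (coreLift j e₂ c)) b
      (A.powAnchor b (coreLift (j.succAbove l) e₁ b)) = (-1) ^ (j + l : ℕ) *
      (Form.interiorSucc (A.rho e₁) (θ.muSec e₂) b.1 : B [⋀^Fin n]→L[ℝ] ℝ)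
        (fun i => b.vec (j.succAbove (l.succAbove i))) := by
  simp only [hl.eval_coreLift]
  refine (dirDeriv_const_mul (mdifferentiableAt_eval (hl.isSmooth_muSec hs e₂) j.succAbove b)
    _ _).trans ?_
  rw [pow_add, mul_assoc]
  refine congrArg _ ?_
  refine (dirDeriv_eval_coreLift A (hl.isSmooth_muSec hs e₂) j.succAbove (j.succAbove l)
    e₁ b).trans ?_
  rw [Finset.sum_eq_single l]
  · rw [if_pos rfl]
    exact alternating_update (W := B) (θ.muSec e₂ b.1 : B [⋀^Fin (n + 1)]→L[ℝ] ℝ) _ l _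
  · intro i _ hi
    exact if_neg fun h => hi (Fin.succAbove_right_injective h)
  · simp

/-- The point of `T^{⊕k} M` with prescribed vectors. -/
noncomputable def tangentPowerMk {k : ℕ} (x : M) (v : Fin k → B) : TangentPower B M k :=
  ⟨x, (∑ i : Fin k, (ContinuousLinearMap.proj (R := ℝ) (φ := fun _ : Fin k => ℝ) i).smulRight (v i) :
    (Fin k → ℝ) →L[ℝ] B)⟩

theorem tangentPowerMk_vec {k : ℕ} (x : M) (v : Fin k → B) (i : Fin k) :
    ((tangentPowerMk x v).vec i : B) = v i := by
  show (∑ i : Fin k, (ContinuousLinearMap.proj (R := ℝ) (φ := fun _ : Fin k => ℝ) i).smulRight (v i) :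
    (Fin k → ℝ) →L[ℝ] B) (Pi.single i 1) = v i
  rw [sum_apply, Finset.sum_eq_single i]
  · simp
  · intro j _ hj
    simp [Pi.single_eq_of_ne hj]
  · simp

end Evaluation

/-! ### The tangent-tangent equation modulo the equation for `μ`. -/

section FormIdentity

variable {V : Type*} [NormedAddCommGroup V] [NormedSpace ℝ V] {H : Type*} [TopologicalSpace H]
  {I : ModelWithCorners ℝ V H} {N : Type*} [TopologicalSpace N] [ChartedSpace H N]
  [I.Boundaryless] [IsManifold I ∞ N] [FiniteDimensional ℝ V]

/-- Here `a` stands for `μ` and `c` for `η`, at `e₁`, `e₂` and `[e₁, e₂]`. Applying `d` to the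
equation for `μ` gives exactly the exact terms of the tangent-tangent equation, and cancelling them
leaves the equation for `η`. -/
theorem extDer_add_eq_lieDer_iff {n : ℕ} {X Y : ∀ x : N, TangentSpace I x}
    (hX : IsSmoothVectorField X) (hY : IsSmoothVectorField Y) {a₁ a₂ a₃ : Form I N n}
    {c₁ c₂ c₃ : Form I N (n + 1)} (ha₁ : Form.IsSmooth a₁) (ha₂ : Form.IsSmooth a₂)
    (hc₁ : Form.IsSmooth c₁) (hc₂ : Form.IsSmooth c₂)
    (h : a₃ = Form.lieDer X a₂ - Form.interiorSucc Y (Form.extDer a₁) - Form.interiorSucc Y c₁) :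
    Form.extDer a₃ + c₃ = Form.lieDer X (Form.extDer a₂ + c₂) - Form.lieDer Y (Form.extDer a₁ + c₁) ↔
      c₃ = Form.lieDer X c₂ - Form.interiorSucc Y (Form.extDer c₁) := by
  have h1 : Form.extDer a₃ = Form.extDer (Form.lieDer X a₂) -
      Form.extDer (Form.interiorSucc Y (Form.extDer a₁)) -
      Form.extDer (Form.interiorSucc Y c₁) := by
    rw [h, Form.extDer_sub ((ha₂.lieDer hX).sub (ha₁.extDer.interiorSucc hY))
      (hc₁.interiorSucc hY), Form.extDer_sub (ha₂.lieDer hX) (ha₁.extDer.interiorSucc hY)]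
  have h2 : Form.lieDer X (Form.extDer a₂ + c₂) =
      Form.extDer (Form.lieDer X a₂) + Form.lieDer X c₂ := by
    rw [Form.lieDer_add ha₂.extDer hc₂ hX, Form.lieDer_extDer ha₂ hX]
  have h3 : Form.lieDer Y (Form.extDer a₁ + c₁) =
      Form.extDer (Form.interiorSucc Y (Form.extDer a₁)) +
      (Form.extDer (Form.interiorSucc Y c₁) + Form.interiorSucc Y (Form.extDer c₁)) := by
    rw [Form.lieDer_add ha₁.extDer hc₁ hY, Form.lieDer_succ_eq, Form.lieDer_succ_eq,
      Form.extDer_extDer ha₁, Form.interiorSucc_zero, add_zero]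
  rw [h1, h2, h3]
  constructor
  · intro h4
    have h5 := eq_sub_of_add_eq' h4
    rw [h5]
    abel
  · rintro rfl
    abel

end FormIdentity

/-! ### A linear form is morphic if and only if its components are an IM form. -/

section Equivalence

variable {B : Type*} [NormedAddCommGroup B] [NormedSpace ℝ B]
  {M : Type*} [TopologicalSpace M] [ChartedSpace B M] [IsManifold 𝓘(ℝ, B) ∞ M]
  {F : Type*} [NormedAddCommGroup F] [NormedSpace ℝ F]
  {E : M → Type*} [TopologicalSpace (TotalSpace F E)] [∀ x, AddCommGroup (E x)]
  [∀ x, Module ℝ (E x)] [∀ x, TopologicalSpace (E x)] [FiberBundle F E] [VectorBundle ℝ F E]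
  [ContMDiffVectorBundle ∞ F E 𝓘(ℝ, B)] [FiniteDimensional ℝ B] [FiniteDimensional ℝ F]

/-- As `σ` is injective, prescribed vectors extend by zero to a full tuple in `T^{⊕k} M`, so every
value of the forms is tested. -/
theorem Form.ext_of_tangentPower {n k : ℕ} {β β' : Form 𝓘(ℝ, B) M n} {σ : Fin n → Fin k}
    (hσ : Function.Injective σ) (h : ∀ b : TangentPower B M k,
      (β b.1 : B [⋀^Fin n]→L[ℝ] ℝ) (fun i => b.vec (σ i)) =
        (β' b.1 : B [⋀^Fin n]→L[ℝ] ℝ) (fun i => b.vec (σ i))) : β = β' := by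
  funext x
  refine ContinuousAlternatingMap.ext fun w => ?_
  have hv : (fun i => ((tangentPowerMk (M := M) x (Function.extend σ w 0 : Fin k → B)).vec (σ i) : B)) =
      w := funext fun i => (tangentPowerMk_vec x _ (σ i)).trans (hσ.extend_apply _ _ _)
  refine (congrArg (β x : B [⋀^Fin n]→L[ℝ] ℝ) hv).symm.trans ((h (tangentPowerMk x (Function.extend σ w 0))).trans ?_)
  exact congrArg (β' x : B [⋀^Fin n]→L[ℝ] ℝ) hv

variable {A : LieAlgebroid (B := B) F E}

theorem dirDeriv_evalCore_coreLift_sub {n : ℕ} {θ : TotForm B F E (n + 2)}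
    (hs : Form.IsSmooth θ) (hl : TotForm.IsLinear θ) (j : Fin (n + 2)) (l : Fin (n + 1))
    (e₁ e₂ : Sec (B := B) F E) (b : TangentPower B M (n + 2)) :
    dirDeriv (powModel B (n + 2)) (fun c => θ.eval c (coreLift j e₂ c)) b
      (A.powAnchor b (coreLift (j.succAbove l) e₁ b)) -
    dirDeriv (powModel B (n + 2)) (fun c => θ.eval c (coreLift (j.succAbove l) e₁ c)) b
      (A.powAnchor b (coreLift j e₂ b)) = (-1) ^ (j + l : ℕ) *
      ((Form.interiorSucc (A.rho e₁) (θ.muSec e₂) b.1 : B [⋀^Fin n]→L[ℝ] ℝ)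
        (fun i => b.vec (j.succAbove (l.succAbove i))) +
      (Form.interiorSucc (A.rho e₂) (θ.muSec e₁) b.1 : B [⋀^Fin n]→L[ℝ] ℝ)
        (fun i => b.vec (j.succAbove (l.succAbove i)))) := by
  have h1 := dirDeriv_evalCore_coreLift A hs hl j l e₁ e₂ b
  have h2 := dirDeriv_evalCore_coreLift A hs hl (j.succAbove l) (l.predAbove j) e₂ e₁ b
  -- Removing the same two slots in the opposite order leaves the same vectors but reverses the
  -- sign, so the difference of derivatives becomes a sum of contractions.
  rw [Fin.succAbove_succAbove_predAbove, Fin.neg_one_pow_succAbove_add_predAbove] at h2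
  simp only [Fin.succAbove_succAbove_succAbove_predAbove] at h2
  rw [h1, h2]
  ring

theorem TotForm.IsLinear.eval_zero {k : ℕ} {θ : TotForm B F E k} (hs : Form.IsSmooth θ)
    (hl : TotForm.IsLinear θ) (b : TangentPower B M k) : θ.eval b 0 = 0 := by
  have h := hl.eval_smul hs b 0 0
  rwa [zero_smul, zero_mul] at h

theorem TotForm.IsMorphic.isIMForm {k : ℕ} {θ : TotForm B F E k} (h : θ.IsMorphic A) :
    IsIMForm A θ.mu θ.eta := by
  have hs := h.smooth
  have hl := h.linear
  have hr := A.isSmoothVectorField_rho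
  cases k with
  | zero =>
    refine ⟨hl.isFormValuedMorphism_mu hs, hl.isFormValuedMorphism_eta hs, fun e₁ e₂ => ?_,
      fun e₁ e₂ => ?_, fun e₁ e₂ => ?_⟩
    · exact (neg_zero (G := Form 𝓘(ℝ, B) M 0)).symm
    · have h0 : ∀ e : Sec (B := B) F E, (fun x => θ.mu x (e x)) = (0 : Form 𝓘(ℝ, B) M 0) :=
        fun e => funext fun x => TotForm.mu_zero_degree θ x (e x)
      rw [h0, h0, h0, Form.lieDer_zero, Form.extDer_zero, Form.interiorSucc_zero]
      have h1 : Form.interior (A.rho e₂) (fun x => θ.eta x (e₁ x)) = (0 : Form 𝓘(ℝ, B) M 0) := rfl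
      rw [h1]
      exact ((sub_zero _).trans (sub_zero (0 : Form 𝓘(ℝ, B) M 0))).symm
    · have hk : θ.etaSec (A.bracket e₁ e₂) =
          Form.lieDer (A.rho e₁) (θ.etaSec e₂) - Form.lieDer (A.rho e₂) (θ.etaSec e₁) := by
        refine Form.ext_of_tangentPower (σ := id) Function.injective_id fun b => ?_
        have hb := h.eval_bracket _ _ _ (.tangent_tangent e₁ e₂) b
        rw [dirDeriv_evalTangent_tangentLift A hs, dirDeriv_evalTangent_tangentLift A hs,
          TotForm.eval_tangentLift] at hb
        simp only [hl.pullback_section_zero hs] at hb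
        exact hb
      exact hk
  | succ n =>
    have hmu : ∀ e₁ e₂, θ.muSec (A.bracket e₁ e₂) = Form.lieDer (A.rho e₁) (θ.muSec e₂) -
        Form.interiorSucc (A.rho e₂) (Form.extDer (θ.muSec e₁)) -
        Form.interiorSucc (A.rho e₂) (θ.etaSec e₁) := by
      intro e₁ e₂
      refine Form.ext_of_tangentPower (σ := (0 : Fin (n + 1)).succAbove)
        Fin.succAbove_right_injective fun b => ?_
      -- Slot 0 already carries all the information, and its sign is `+1`.
      have hb := h.eval_bracket _ _ _ (.tangent_core 0 e₁ e₂) b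
      rw [dirDeriv_evalCore_tangentLift A hs hl, dirDeriv_evalTangent_coreLift A hs,
        hl.eval_coreLift, hl.pullback_section_succ hs, Form.interiorSucc_add] at hb
      simp only [Fin.val_zero, pow_zero, one_mul] at hb
      exact hb.trans (sub_add_eq_sub_sub _ _ _)
    refine ⟨hl.isFormValuedMorphism_mu hs, hl.isFormValuedMorphism_eta hs, fun e₁ e₂ => ?_,
      hmu, fun e₁ e₂ => ?_⟩
    · cases n with
      | zero => exact (neg_zero (G := Form 𝓘(ℝ, B) M 0)).symm
      | succ n =>
        have hk : Form.interiorSucc (A.rho e₁) (θ.muSec e₂) =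
            -Form.interiorSucc (A.rho e₂) (θ.muSec e₁) := by
          refine Form.ext_of_tangentPower
            (σ := fun i => (0 : Fin (n + 2)).succAbove ((0 : Fin (n + 1)).succAbove i))
            (fun i j hij => Fin.succAbove_right_injective (Fin.succAbove_right_injective hij))
            fun b => ?_
          -- Core lifts in slots 1 and 0, the first pair of distinct slots; for `k = 1` there is
          -- none, and both contractions of 0-forms vanish.
          have hb := h.eval_bracket _ _ _
            (.core_core ((0 : Fin (n + 2)).succAbove (0 : Fin (n + 1))) 0 e₁ e₂) b
          rw [dirDeriv_evalCore_coreLift_sub hs hl] at hb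
          have hb2 := hb.symm.trans (hl.eval_zero hs b)
          simp only [Fin.val_zero, add_zero, pow_zero, one_mul] at hb2
          exact eq_neg_of_add_eq_zero_left hb2
        exact hk
    · refine (extDer_add_eq_lieDer_iff (hr e₁) (hr e₂) (hl.isSmooth_muSec hs e₁)
        (hl.isSmooth_muSec hs e₂) (hl.isSmooth_etaSec hs e₁) (hl.isSmooth_etaSec hs e₂)
        (hmu e₁ e₂)).1 ?_
      refine Form.ext_of_tangentPower (σ := id) Function.injective_id fun b => ?_
      have hb := h.eval_bracket _ _ _ (.tangent_tangent e₁ e₂) b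
      rw [dirDeriv_evalTangent_tangentLift A hs, dirDeriv_evalTangent_tangentLift A hs,
        TotForm.eval_tangentLift] at hb
      simp only [hl.pullback_section_succ hs] at hb
      exact hb

theorem TotForm.IsLinear.mdifferentiableAt_evalTangent {k : ℕ} {θ : TotForm B F E k}
    (hs : Form.IsSmooth θ) (e : Sec (B := B) F E) (b : TangentPower B M k) :
    MDifferentiableAt (powModel B k) 𝓘(ℝ, ℝ) (fun c => θ.eval c (tangentLift k e c)) b := by
  simp only [TotForm.eval_tangentLift]
  exact mdifferentiableAt_eval (hs.pullback (contMDiff_sectionMap e)) id b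

theorem TotForm.IsLinear.mdifferentiableAt_evalCore {k : ℕ} {θ : TotForm B F E k}
    (hs : Form.IsSmooth θ) (hl : TotForm.IsLinear θ) (j : Fin k) (e : Sec (B := B) F E)
    (b : TangentPower B M k) :
    MDifferentiableAt (powModel B k) 𝓘(ℝ, ℝ) (fun c => θ.eval c (coreLift j e c)) b := by
  cases k with
  | zero => exact j.elim0
  | succ n =>
    simp only [hl.eval_coreLift]
    exact (mdifferentiableAt_eval (hl.isSmooth_muSec hs e) j.succAbove b).const_smul _

/-- The bracket condition for morphic forms, on the generating sections. -/
theorem TotForm.IsLinear.isMorphic_of_generators {k : ℕ} {θ : TotForm B F E k}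
    (hs : Form.IsSmooth θ) (hl : TotForm.IsLinear θ)
    (htt : ∀ e₁ e₂ b, θ.eval b (tangentLift k (A.bracket e₁ e₂) b) =
      dirDeriv (powModel B k) (fun c => θ.eval c (tangentLift k e₂ c)) b
        (A.powAnchor b (tangentLift k e₁ b)) -
      dirDeriv (powModel B k) (fun c => θ.eval c (tangentLift k e₁ c)) b
        (A.powAnchor b (tangentLift k e₂ b)))
    (htc : ∀ j e₁ e₂ b, θ.eval b (coreLift j (A.bracket e₁ e₂) b) =
      dirDeriv (powModel B k) (fun c => θ.eval c (coreLift j e₂ c)) b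
        (A.powAnchor b (tangentLift k e₁ b)) -
      dirDeriv (powModel B k) (fun c => θ.eval c (tangentLift k e₁ c)) b
        (A.powAnchor b (coreLift j e₂ b)))
    (hcc : ∀ i j e₁ e₂ b,
      dirDeriv (powModel B k) (fun c => θ.eval c (coreLift j e₂ c)) b
        (A.powAnchor b (coreLift i e₁ b)) -
      dirDeriv (powModel B k) (fun c => θ.eval c (coreLift i e₁ c)) b
        (A.powAnchor b (coreLift j e₂ b)) = 0) : θ.IsMorphic A := by
  refine ⟨hs, hl, hl.eval_add hs, hl.eval_smul hs, fun S₁ S₂ S₃ hS => ?_⟩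
  -- Differentiability of both evaluated functions is carried through the induction: the additive
  -- and Leibniz cases differentiate sums and products, while the sections in the bracket relation
  -- are not assumed smooth.
  suffices H : (∀ b, MDifferentiableAt (powModel B k) 𝓘(ℝ, ℝ) (fun c => θ.eval c (S₁ c)) b) ∧
      (∀ b, MDifferentiableAt (powModel B k) 𝓘(ℝ, ℝ) (fun c => θ.eval c (S₂ c)) b) ∧
      ∀ b : TangentPower B M k, θ.eval b (S₃ b) =
        dirDeriv (powModel B k) (fun c => θ.eval c (S₂ c)) b (A.powAnchor b (S₁ b)) -
        dirDeriv (powModel B k) (fun c => θ.eval c (S₁ c)) b (A.powAnchor b (S₂ b)) from H.2.2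
  have dt := fun e b => TotForm.IsLinear.mdifferentiableAt_evalTangent (B := B) (k := k) hs e b
  have dc := fun j e b => hl.mdifferentiableAt_evalCore hs j e b
  induction hS with
  | tangent_tangent e₁ e₂ => exact ⟨dt e₁, dt e₂, htt e₁ e₂⟩
  | tangent_core j e₁ e₂ => exact ⟨dt e₁, dc j e₂, htc j e₁ e₂⟩
  | core_core i j e₁ e₂ =>
    exact ⟨dc i e₁, dc j e₂, fun b => (hl.eval_zero hs b).trans (hcc i j e₁ e₂ b).symm⟩
  | @skew S₁ S₂ S₃ _ ih =>
    refine ⟨ih.2.1, ih.1, fun b => ?_⟩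
    have h1 := hl.eval_smul hs b (-1) (S₃ b)
    rw [neg_one_smul, ih.2.2 b] at h1
    refine h1.trans ?_
    ring
  | @add S S₁ S₂ R₁ R₂ _ _ ih₁ ih₂ =>
    refine ⟨ih₁.1, fun b => ?_, fun b => ?_⟩
    · have : (fun c => θ.eval c ((S₁ + S₂) c)) = fun c => θ.eval c (S₁ c) + θ.eval c (S₂ c) :=
        funext fun c => hl.eval_add hs c _ _
      rw [this]
      exact (ih₁.2.1 b).add (ih₂.2.1 b)
    · have : (fun c => θ.eval c ((S₁ + S₂) c)) = fun c => θ.eval c (S₁ c) + θ.eval c (S₂ c) :=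
        funext fun c => hl.eval_add hs c _ _
      have ha : A.powAnchor b ((S₁ + S₂) b) = A.powAnchor b (S₁ b) + A.powAnchor b (S₂ b) :=
        powAnchor_add A b _ _
      rw [this, dirDeriv_add (ih₁.2.1 b) (ih₂.2.1 b), ha, dirDeriv_vector_add]
      refine (hl.eval_add hs b _ _).trans ?_
      rw [ih₁.2.2 b, ih₂.2.2 b]
      ring
  | @leibniz S₁ S₂ S₃ f _ ih =>
    have hf : ∀ b, MDifferentiableAt (powModel B k) 𝓘(ℝ, ℝ) f b := fun b =>
      f.contMDiff.mdifferentiableAt (by simp)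
    have e : (fun c => θ.eval c (f c • S₂ c)) = fun c => f c * θ.eval c (S₂ c) :=
      funext fun c => hl.eval_smul hs c _ _
    refine ⟨ih.1, fun b => ?_, fun b => ?_⟩
    · rw [e]
      exact (hf b).mul (ih.2.1 b)
    · rw [e, dirDeriv_mul (hf b) (ih.2.1 b), powAnchor_smul, dirDeriv_vector_smul,
        hl.eval_add hs, hl.eval_smul hs, hl.eval_smul hs, ih.2.2 b]
      ring

/-- The computations for generators are read backwards. Unlike in the converse every slot has to be
treated, but the slots differ only by a common sign. -/
theorem IsIMForm.isMorphic {k : ℕ} {θ : TotForm B F E k} (hs : Form.IsSmooth θ)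
    (hl : TotForm.IsLinear θ) (h : IsIMForm A θ.mu θ.eta) : θ.IsMorphic A := by
  have hr := A.isSmoothVectorField_rho
  refine hl.isMorphic_of_generators hs (fun e₁ e₂ b => ?_) (fun j e₁ e₂ b => ?_)
    (fun i j e₁ e₂ b => ?_)
  · rw [dirDeriv_evalTangent_tangentLift A hs, dirDeriv_evalTangent_tangentLift A hs,
      TotForm.eval_tangentLift]
    cases k with
    | zero =>
      simp only [hl.pullback_section_zero hs]
      exact congrArg (fun β : Form 𝓘(ℝ, B) M 0 => (β b.1 : B [⋀^Fin 0]→L[ℝ] ℝ)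
        (fun i => b.vec i)) (h.im_eta e₁ e₂)
    | succ n =>
      have hk := (extDer_add_eq_lieDer_iff (hr e₁) (hr e₂) (hl.isSmooth_muSec hs e₁)
        (hl.isSmooth_muSec hs e₂) (hl.isSmooth_etaSec hs e₁) (hl.isSmooth_etaSec hs e₂)
        (h.im_mu e₁ e₂)).2 (h.im_eta e₁ e₂)
      simp only [hl.pullback_section_succ hs]
      exact congrArg (fun β : Form 𝓘(ℝ, B) M (n + 1) => (β b.1 : B [⋀^Fin (n + 1)]→L[ℝ] ℝ)
        (fun i => b.vec i)) hk
  · cases k with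
    | zero => exact j.elim0
    | succ n =>
      rw [dirDeriv_evalCore_tangentLift A hs hl, dirDeriv_evalTangent_coreLift A hs,
        hl.eval_coreLift, hl.pullback_section_succ hs, Form.interiorSucc_add, ← mul_sub]
      refine congrArg _ ?_
      have hk := congrArg (fun β : Form 𝓘(ℝ, B) M n => (β b.1 : B [⋀^Fin n]→L[ℝ] ℝ)
        (fun i => b.vec (j.succAbove i))) (h.im_mu e₁ e₂)
      exact hk.trans (sub_add_eq_sub_sub _ _ _).symm
  · cases k with
    | zero => exact j.elim0
    | succ n =>
      by_cases hij : i = j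
      · subst hij
        rw [dirDeriv_evalCore_coreLift_self A hs hl, dirDeriv_evalCore_coreLift_self A hs hl,
          sub_zero]
      · cases n with
        -- For `k = 1` there is a single slot, so distinct slots do not occur.
        | zero => exact absurd (Fin.ext (by omega)) hij
        | succ n =>
          obtain ⟨l, rfl⟩ := Fin.exists_succAbove_eq hij
          rw [dirDeriv_evalCore_coreLift_sub hs hl]
          refine mul_eq_zero_of_right _ ?_
          have hk := congrArg (fun β : Form 𝓘(ℝ, B) M n => (β b.1 : B [⋀^Fin n]→L[ℝ] ℝ)
            (fun i => b.vec (j.succAbove (l.succAbove i)))) (h.im_skew e₁ e₂)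
          exact add_eq_zero_iff_eq_neg.2 hk

end Equivalence

/-! ### Surjectivity of the derivative of a submersion. -/

section Submersions

variable {B : Type*} [NormedAddCommGroup B] [NormedSpace ℝ B]
  {M : Type*} [TopologicalSpace M] [ChartedSpace B M] [IsManifold 𝓘(ℝ, B) ∞ M]
  {B' : Type*} [NormedAddCommGroup B'] [NormedSpace ℝ B']
  {M' : Type*} [TopologicalSpace M'] [ChartedSpace B' M'] [IsManifold 𝓘(ℝ, B') ∞ M']

/-- In adapted charts the submersion is a linear projection, and a slice with constant complementary
coordinate is a local section through `x`. -/
theorem exists_local_rightInverse_of_isSubmersion {f : M → M'}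
    (hf : Manifold.IsSubmersion 𝓘(ℝ, B) 𝓘(ℝ, B') ∞ f) (x : M) :
    ∃ r : M' → M, MDifferentiableAt 𝓘(ℝ, B') 𝓘(ℝ, B) r (f x) ∧ r (f x) = x ∧
      ∀ᶠ z in 𝓝 (f x), f (r z) = z := by
  have h := hf.isSubmersionAt x
  have hw : ∀ p ∈ h.domChart.target, h.codChart (f (h.domChart.symm p)) = (h.equiv p).1 := by
    intro p hp
    have hp' : p ∈ (h.domChart.extend 𝓘(ℝ, B)).target := by
      rw [OpenPartialHomeomorph.extend_target]
      exact ⟨hp, mem_range_self p⟩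
    exact h.writtenInCharts hp'
  have hx := h.mem_domChart_source
  have hfx := h.mem_codChart_source
  have hxt : h.domChart x ∈ h.domChart.target := h.domChart.map_source hx
  have hx1 : h.codChart (f x) = (h.equiv (h.domChart x)).1 := by
    have := hw _ hxt
    rwa [h.domChart.left_inv hx] at this
  -- The complementary coordinate is frozen at its value at `x`, so that the section passes through
  -- `x`.
  let j : B' → B := fun y => h.equiv.symm (y, (h.equiv (h.domChart x)).2)
  have hj : j (h.codChart (f x)) = h.domChart x := by
    show h.equiv.symm (h.codChart (f x), _) = _
    rw [hx1]
    exact h.equiv.symm_apply_apply _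
  have hjd : Differentiable ℝ j := by
    intro y
    exact h.equiv.symm.differentiableAt.comp y
      (differentiableAt_id.prodMk (differentiableAt_const _))
  have hc : MDifferentiableAt 𝓘(ℝ, B') 𝓘(ℝ, B') h.codChart (f x) :=
    (contMDiffAt_of_mem_maximalAtlas h.codChart_mem_maximalAtlas hfx).mdifferentiableAt (by simp)
  have hs : MDifferentiableAt 𝓘(ℝ, B) 𝓘(ℝ, B) h.domChart.symm (j (h.codChart (f x))) := by
    rw [hj]
    exact (contMDiffAt_symm_of_mem_maximalAtlas h.domChart_mem_maximalAtlas hxt).mdifferentiableAt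
      (by simp)
  refine ⟨fun z => h.domChart.symm (j (h.codChart z)), ?_, ?_, ?_⟩
  · exact MDifferentiableAt.comp (I' := 𝓘(ℝ, B)) (g := h.domChart.symm)
      (f := fun z => j (h.codChart z)) (f x) hs
      (MDifferentiableAt.comp (I' := 𝓘(ℝ, B')) (g := j) (f x)
        (hjd _).mdifferentiableAt hc)
  · show h.domChart.symm (j (h.codChart (f x))) = x
    rw [hj, h.domChart.left_inv hx]
  · have hcont : ContinuousAt (fun z => j (h.codChart z)) (f x) :=
      ContinuousAt.comp (g := j) hjd.continuous.continuousAt hc.continuousAt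
    have h1 : ∀ᶠ z in 𝓝 (f x), j (h.codChart z) ∈ h.domChart.target :=
      hcont.preimage_mem_nhds (h.domChart.open_target.mem_nhds (by rw [hj]; exact hxt))
    filter_upwards [h1, h.codChart.open_source.mem_nhds hfx] with z hz hz'
    refine h.codChart.injOn (h.source_subset_preimage_source
      (h.domChart.map_target hz)) hz' ?_
    rw [hw _ hz]
    show (h.equiv (h.equiv.symm (h.codChart z, _))).1 = _
    rw [ContinuousLinearEquiv.apply_symm_apply]

theorem modelDeriv_surjective_of_isSubmersion {f : M → M'}
    (hf : Manifold.IsSubmersion 𝓘(ℝ, B) 𝓘(ℝ, B') ∞ f) (x : M) :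
    Function.Surjective (modelDeriv 𝓘(ℝ, B) 𝓘(ℝ, B') f x) := by
  obtain ⟨r, hr, hrx, hfr⟩ := exists_local_rightInverse_of_isSubmersion hf x
  have hfd : MDifferentiableAt 𝓘(ℝ, B) 𝓘(ℝ, B') f (r (f x)) :=
    hf.contMDiff.mdifferentiableAt (by simp)
  have h1 := modelDeriv_comp (I := 𝓘(ℝ, B')) (I' := 𝓘(ℝ, B)) (I'' := 𝓘(ℝ, B')) (f x) hfd hr
  have h2 : modelDeriv 𝓘(ℝ, B') 𝓘(ℝ, B') (f ∘ r) (f x) = ContinuousLinearMap.id ℝ B' := 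
    (modelDeriv_congr (φ := f ∘ r) (ψ := (id : M' → M')) hfr).trans (modelDeriv_id _)
  rw [h2, hrx] at h1
  intro v
  exact ⟨modelDeriv 𝓘(ℝ, B') 𝓘(ℝ, B) r (f x) v,
    (congrArg (fun L : B' →L[ℝ] B' => L v) h1).symm⟩

end Submersions

/-! ### Simple quotients: surjectivity and lifting of sections. -/

section Quotients

variable {B : Type*} [NormedAddCommGroup B] [NormedSpace ℝ B] [FiniteDimensional ℝ B]
  {M : Type*} [TopologicalSpace M] [ChartedSpace B M] [IsManifold 𝓘(ℝ, B) ∞ M]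
  {F : Type*} [NormedAddCommGroup F] [NormedSpace ℝ F] [FiniteDimensional ℝ F]
  {E : M → Type*} [TopologicalSpace (TotalSpace F E)] [∀ x, AddCommGroup (E x)]
  [∀ x, Module ℝ (E x)] [∀ x, TopologicalSpace (E x)] [FiberBundle F E] [VectorBundle ℝ F E]
  [ContMDiffVectorBundle ∞ F E 𝓘(ℝ, B)]
  {B' : Type*} [NormedAddCommGroup B'] [NormedSpace ℝ B'] [FiniteDimensional ℝ B']
  {M' : Type*} [TopologicalSpace M'] [ChartedSpace B' M'] [IsManifold 𝓘(ℝ, B') ∞ M']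
  {F' : Type*} [NormedAddCommGroup F'] [NormedSpace ℝ F'] [FiniteDimensional ℝ F']
  {E' : M' → Type*} [TopologicalSpace (TotalSpace F' E')] [∀ x, AddCommGroup (E' x)]
  [∀ x, Module ℝ (E' x)] [∀ x, TopologicalSpace (E' x)] [FiberBundle F' E'] [VectorBundle ℝ F' E']
  [ContMDiffVectorBundle ∞ F' E' 𝓘(ℝ, B')]

theorem BundleMorphism.contMDiff_total (q : BundleMorphism B F E B' F' E') :
    ContMDiff (totModel B F) (totModel B' F') ∞ q.total := q.smooth_total

theorem BundleMorphism.modelDeriv_total_fst (q : BundleMorphism B F E B' F' E')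
    (p : TotalSpace F E) (w : B × F) :
    (modelDeriv (totModel B F) (totModel B' F') q.total p w).1 =
      modelDeriv 𝓘(ℝ, B) 𝓘(ℝ, B') q.base p.1 w.1 := by
  have hd := q.contMDiff_total.mdifferentiableAt (x := p) (by simp)
  have hb : MDifferentiableAt 𝓘(ℝ, B) 𝓘(ℝ, B') q.base p.1 :=
    q.smooth_base.mdifferentiableAt (by simp)
  have hp : MDifferentiableAt (totModel B F) 𝓘(ℝ, B) (TotalSpace.proj : TotalSpace F E → M) p :=
    (contMDiff_proj (n := 1) E).mdifferentiableAt one_ne_zero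
  refine (modelDeriv_tot_fst hd w).trans ?_
  have h := modelDeriv_comp (I := totModel B F) (I' := 𝓘(ℝ, B)) (I'' := 𝓘(ℝ, B')) (ψ := q.base)
    (φ := (TotalSpace.proj : TotalSpace F E → M)) p hb hp
  refine (congrArg (fun L : B × F →L[ℝ] B' => L w) h).trans ?_
  exact congrArg (modelDeriv 𝓘(ℝ, B) 𝓘(ℝ, B') q.base p.1) (modelDeriv_proj p w)

theorem BundleMorphism.modelDeriv_total_vertical (q : BundleMorphism B F E B' F' E')
    (x : M) (u w : E x) :
    modelDeriv (totModel B F) (totModel B' F') q.total ⟨x, u⟩ (0, fiberCoord F E x w) =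
      (0, fiberCoord F' E' (q.base x) (q.fiber x w)) := by
  have hl := (contMDiff_fiberLine (B := B) (F := F) u w).mdifferentiableAt (x := 0) (by simp)
  have h := modelDeriv_comp (I := 𝓘(ℝ, ℝ)) (I' := totModel B F) (I'' := totModel B' F')
    (ψ := q.total) (φ := fun t : ℝ => (⟨x, u + t • w⟩ : TotalSpace F E)) 0
    (q.contMDiff_total.mdifferentiableAt (by simp)) hl
  have e : q.total ∘ (fun t : ℝ => (⟨x, u + t • w⟩ : TotalSpace F E)) =
      fun t : ℝ => (⟨q.base x, q.fiber x u + t • q.fiber x w⟩ : TotalSpace F' E') := by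
    funext t
    show (⟨q.base x, q.fiber x (u + t • w)⟩ : TotalSpace F' E') = _
    rw [map_add, map_smul]
  rw [e] at h
  have h2 := (congrArg (fun L : ℝ →L[ℝ] B' × F' => L 1) h).symm.trans
    (modelDeriv_fiberLine (B := B') (q.fiber x u) (q.fiber x w))
  have h3 := (congrArg (fun W : B × F => modelDeriv (totModel B F) (totModel B' F') q.total
    (⟨x, u + (0 : ℝ) • w⟩ : TotalSpace F E) W) (modelDeriv_fiberLine (B := B) u w)).symm.trans h2
  rwa [zero_smul, add_zero] at h3

theorem BundleMorphism.IsSimpleQuotient.modelDeriv_base_surjective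
    {q : BundleMorphism B F E B' F' E'} (hq : q.IsSimpleQuotient) (x : M) :
    Function.Surjective (modelDeriv 𝓘(ℝ, B) 𝓘(ℝ, B') q.base x) :=
  modelDeriv_surjective_of_isSubmersion hq.base_submersion x

/-- The base component is reached because the base map is a submersion; the error in the fibre
component is corrected by a vertical vector, on which the derivative is `q` itself. -/
theorem BundleMorphism.IsSimpleQuotient.modelDeriv_total_surjective
    {q : BundleMorphism B F E B' F' E'} (hq : q.IsSimpleQuotient) (p : TotalSpace F E) :
    Function.Surjective (modelDeriv (totModel B F) (totModel B' F') q.total p) := by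
  rintro ⟨v', f'⟩
  obtain ⟨v, hv⟩ := hq.modelDeriv_base_surjective p.1 v'
  let g : B' × F' := modelDeriv (totModel B F) (totModel B' F') q.total p (v, 0)
  obtain ⟨w, hw⟩ := hq.fiber_surjective p.1 ((fiberCoord F' E' (q.base p.1)).symm (f' - g.2))
  refine ⟨(v, 0) + (0, fiberCoord F E p.1 w), ?_⟩
  rw [map_add]
  refine (congrArg₂ (· + ·) (rfl : _ = g) (q.modelDeriv_total_vertical p.1 p.2 w)).trans ?_
  rw [hw, ContinuousLinearEquiv.apply_symm_apply]
  refine Prod.ext ?_ (add_sub_cancel _ _)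
  exact (add_zero _).trans ((q.modelDeriv_total_fst p (v, 0)).trans hv)

theorem BundleMorphism.IsSimpleQuotient.total_surjective
    {q : BundleMorphism B F E B' F' E'} (hq : q.IsSimpleQuotient) :
    Function.Surjective q.total := by
  rintro ⟨y, u'⟩
  obtain ⟨x, rfl⟩ := hq.base_surjective y
  obtain ⟨u, rfl⟩ := hq.fiber_surjective x u'
  exact ⟨⟨x, u⟩, rfl⟩

/-- Sections of the quotient bundle lift. -/
theorem BundleMorphism.IsSimpleQuotient.exists_lift [T2Space M] [SigmaCompactSpace M]
    {q : BundleMorphism B F E B' F' E'} (hq : q.IsSimpleQuotient) (s : Sec (B := B') F' E') :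
    ∃ e : Sec (B := B) F E, ∀ x, q.fiber x (e x) = s (q.base x) := by
  -- The lifts of a given value form an affine subspace of each fibre, hence a convex set, so local
  -- lifts are glued by a partition of unity.
  refine exists_contMDiffSection_forall_mem_convex_of_local (n := ⊤) 𝓘(ℝ, B) E
    (fun x => {u | q.fiber x u = s (q.base x)}) (fun x => ?_) (fun x₀ => ?_)
  · intro u hu w hw a b _ _ hab
    show q.fiber x (a • u + b • w) = s (q.base x)
    have hu' : q.fiber x u = s (q.base x) := hu
    have hw' : q.fiber x w = s (q.base x) := hw
    rw [map_add, map_smul, map_smul, hu', hw', ← add_smul, hab, one_smul]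
  · let τ := trivializationAt F E x₀
    let τ' := trivializationAt F' E' (q.base x₀)
    -- The map `q` in local trivializations. A right inverse `R` of `Q x₀` is corrected near `x₀` to
    -- the right inverse `R ∘ (Q x ∘ R)⁻¹` of `Q x`.
    let Q : ∀ x, F →ₗ[ℝ] F' := fun x =>
      (τ'.linearMapAt ℝ (q.base x)).comp ((q.fiber x).comp (τ.symmₗ ℝ x))
    have hQa : ∀ x ∈ τ.baseSet, ∀ f,
        Q x f = τ'.linearMapAt ℝ (q.base x) (q.fiber x (τ.symm x f)) := fun x hx f =>
      congrArg (fun u => τ'.linearMapAt ℝ (q.base x) (q.fiber x u)) (τ.symmₗ_apply (R := ℝ) hx f)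
    let U₀ : Set M := τ.baseSet ∩ q.base ⁻¹' τ'.baseSet
    have hU₀ : IsOpen U₀ :=
      τ.open_baseSet.inter (τ'.open_baseSet.preimage q.smooth_base.continuous)
    have hx₀ : x₀ ∈ U₀ := ⟨mem_baseSet_trivializationAt F E x₀,
      mem_baseSet_trivializationAt F' E' (q.base x₀)⟩
    have hsym : ∀ g : M → F, ∀ x ∈ U₀, ContMDiffAt 𝓘(ℝ, B) 𝓘(ℝ, F) ∞ g x →
        ContMDiffAt 𝓘(ℝ, B) (totModel B F) ∞
          (fun y => (⟨y, τ.symm y (g y)⟩ : TotalSpace F E)) x := by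
      intro g x hx hg
      refine (Bundle.Trivialization.contMDiffAt_section_iff (IB := 𝓘(ℝ, B)) (n := ∞) τ
        (s := fun y => τ.symm y (g y)) hx.1).2 ?_
      refine hg.congr_of_eventuallyEq ?_
      filter_upwards [hU₀.mem_nhds hx] with y hy
      exact congrArg Prod.snd (τ.apply_mk_symm hy.1 (g y))
    have hτ' : ∀ (G : M → TotalSpace F' E') (x : M), (G x).1 ∈ τ'.baseSet →
        ContMDiffAt 𝓘(ℝ, B) (totModel B' F') ∞ G x →
        ContMDiffAt 𝓘(ℝ, B) 𝓘(ℝ, F') ∞ (fun y => (τ' (G y)).2) x := by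
      intro G x hx hG
      have h1 : ContMDiffAt (totModel B' F') (𝓘(ℝ, B').prod 𝓘(ℝ, F')) ∞ τ' (G x) :=
        (τ'.contMDiffOn (IB := 𝓘(ℝ, B')) (n := ∞)).contMDiffAt
          (τ'.open_source.mem_nhds (τ'.mem_source.2 hx))
      exact contMDiffAt_snd.comp x (h1.comp x hG)
    have hQ : ∀ f : F, ∀ x ∈ U₀, ContMDiffAt 𝓘(ℝ, B) 𝓘(ℝ, F') ∞ (fun y => Q y f) x := by
      intro f x hx
      refine (hτ' (fun y => q.total ⟨y, τ.symm y f⟩) x hx.2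
        ((q.contMDiff_total _).comp x (hsym (fun _ => f) x hx contMDiffAt_const))).congr_of_eventuallyEq ?_
      filter_upwards [hU₀.mem_nhds hx] with y hy
      exact (hQa y hy.1 f).trans (congrFun (τ'.coe_linearMapAt_of_mem (R := ℝ) hy.2) _)
    have hQs : Function.Surjective (Q x₀) := by
      intro f'
      obtain ⟨u, hu⟩ := hq.fiber_surjective x₀ (τ'.symmₗ ℝ (q.base x₀) f')
      refine ⟨τ.linearMapAt ℝ x₀ u, ?_⟩
      show τ'.linearMapAt ℝ (q.base x₀) (q.fiber x₀ (τ.symmₗ ℝ x₀ (τ.linearMapAt ℝ x₀ u))) = f'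
      rw [τ.symmₗ_linearMapAt hx₀.1, hu, τ'.linearMapAt_symmₗ hx₀.2]
    obtain ⟨R, hR⟩ := (Q x₀).exists_rightInverse_of_surjective (LinearMap.range_eq_top.2 hQs)
    let bs := Module.finBasis ℝ F'
    let C : M → F' →L[ℝ] F' := fun x => LinearMap.toContinuousLinearMap ((Q x).comp R)
    have hC : ∀ x ∈ U₀, ContMDiffAt 𝓘(ℝ, B) 𝓘(ℝ, F' →L[ℝ] F') ∞ C x := by
      intro x hx
      -- Expanding over a basis of `F'` reduces smoothness of `C` to that of `Q y f` for fixed `f`.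
      have e : C = fun y => ∑ i, ContinuousLinearMap.smulRightL ℝ F' F'
          (LinearMap.toContinuousLinearMap (bs.coord i)) (Q y (R (bs i))) := by
        funext y
        refine ContinuousLinearMap.ext fun v => ?_
        have h1 : C y v = Q y (R v) := rfl
        rw [h1, sum_apply]
        conv_lhs => rw [← bs.sum_repr v]
        rw [map_sum, map_sum]
        refine Finset.sum_congr rfl fun i _ => ?_
        rw [map_smul, map_smul]
        rfl
      rw [e]
      refine ContMDiffAt.sum fun i _ => ?_
      exact ContMDiffAt.comp (I' := 𝓘(ℝ, F')) x
        (ContinuousLinearMap.contMDiff _).contMDiffAt (hQ (R (bs i)) x hx)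
    -- Invertibility is an open condition, and `C x₀` is the identity.
    let U : Set M := U₀ ∩ C ⁻¹' range ((↑) : (F' ≃L[ℝ] F') → F' →L[ℝ] F')
    have hU : IsOpen U := ContinuousOn.isOpen_inter_preimage
      (fun x hx => (hC x hx).continuousAt.continuousWithinAt) hU₀ ContinuousLinearEquiv.isOpen
    have hxU : x₀ ∈ U := by
      refine ⟨hx₀, ContinuousLinearEquiv.refl ℝ F', ?_⟩
      refine ContinuousLinearMap.ext fun v => ?_
      exact (congrArg (fun L : F' →ₗ[ℝ] F' => L v) hR).symm
    let g : M → F := fun x => R ((C x).inverse (τ' ⟨q.base x, s (q.base x)⟩).2)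
    refine ⟨U, hU.mem_nhds hxU, fun x => τ.symm x (g x), fun x hx => ?_, fun x hx => ?_⟩
    · refine (hsym g x hx.1 ?_).contMDiffWithinAt
      obtain ⟨c, hc⟩ := hx.2
      have hinv : ContMDiffAt 𝓘(ℝ, B) 𝓘(ℝ, F' →L[ℝ] F') ∞ (fun y => (C y).inverse) x := by
        have h1 : ContDiffAt ℝ ∞ ContinuousLinearMap.inverse (C x) := by
          rw [← hc]; exact contDiffAt_map_inverse c
        exact ContMDiffAt.comp (I' := 𝓘(ℝ, F' →L[ℝ] F')) x h1.contMDiffAt (hC x hx.1)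
      have hs : ContMDiffAt 𝓘(ℝ, B) 𝓘(ℝ, F') ∞
          (fun y => (τ' ⟨q.base y, s (q.base y)⟩).2) x :=
        hτ' (fun y => sectionMap s (q.base y)) x hx.1.2
          ((contMDiff_sectionMap s _).comp x (q.smooth_base x))
      exact ContMDiffAt.comp (I' := 𝓘(ℝ, F')) x
        ((LinearMap.toContinuousLinearMap R).contMDiff).contMDiffAt (hinv.clm_apply hs)
    · obtain ⟨c, hc⟩ := hx.2
      show q.fiber x (τ.symm x (g x)) = s (q.base x)
      have h1 : Q x (g x) = (τ' ⟨q.base x, s (q.base x)⟩).2 := by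
        show C x ((C x).inverse _) = _
        rw [← hc, ContinuousLinearMap.inverse_equiv]
        exact c.apply_symm_apply _
      have h2 : τ'.linearMapAt ℝ (q.base x) (q.fiber x (τ.symm x (g x))) =
          τ'.linearMapAt ℝ (q.base x) (s (q.base x)) :=
        (hQa x hx.1.1 (g x)).symm.trans <| h1.trans (congrFun (τ'.coe_linearMapAt_of_mem (R := ℝ) hx.1.2) _).symm
      rw [← τ'.symmₗ_linearMapAt (R := ℝ) hx.1.2 (q.fiber x (τ.symm x (g x))), h2,
        τ'.symmₗ_linearMapAt hx.1.2]

end Quotients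

/-! ### Interior products and related vector fields, in all degrees. -/

section InteriorPullback

variable {V : Type*} [NormedAddCommGroup V] [NormedSpace ℝ V] {H : Type*} [TopologicalSpace H]
  {I : ModelWithCorners ℝ V H} {N : Type*} [TopologicalSpace N] [ChartedSpace H N]
  {V' : Type*} [NormedAddCommGroup V'] [NormedSpace ℝ V'] {H' : Type*} [TopologicalSpace H']
  {I' : ModelWithCorners ℝ V' H'} {N' : Type*} [TopologicalSpace N'] [ChartedSpace H' N']

theorem Form.interior_pullback {n : ℕ} {φ : N → N'} {X : ∀ x : N, TangentSpace I x}
    {X' : ∀ x : N', TangentSpace I' x} (h : ∀ x, mfderiv I I' φ x (X x) = X' (φ x))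
    (θ : Form I' N' n) :
    Form.interior X (Form.pullback (I := I) φ θ) =
      Form.pullback (I := I) φ (Form.interior X' θ) := by
  cases n with
  | zero => rfl
  | succ n => exact Form.interiorSucc_pullback h θ

end InteriorPullback

/-! ### Uniqueness of the quotient structures and descent of the IM equations. -/

section Quotients

variable {B : Type*} [NormedAddCommGroup B] [NormedSpace ℝ B] [FiniteDimensional ℝ B]
  {M : Type*} [TopologicalSpace M] [ChartedSpace B M] [IsManifold 𝓘(ℝ, B) ∞ M]
  {F : Type*} [NormedAddCommGroup F] [NormedSpace ℝ F] [FiniteDimensional ℝ F]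
  {E : M → Type*} [TopologicalSpace (TotalSpace F E)] [∀ x, AddCommGroup (E x)]
  [∀ x, Module ℝ (E x)] [∀ x, TopologicalSpace (E x)] [FiberBundle F E] [VectorBundle ℝ F E]
  [ContMDiffVectorBundle ∞ F E 𝓘(ℝ, B)]
  {B' : Type*} [NormedAddCommGroup B'] [NormedSpace ℝ B'] [FiniteDimensional ℝ B']
  {M' : Type*} [TopologicalSpace M'] [ChartedSpace B' M'] [IsManifold 𝓘(ℝ, B') ∞ M']
  {F' : Type*} [NormedAddCommGroup F'] [NormedSpace ℝ F'] [FiniteDimensional ℝ F']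
  {E' : M' → Type*} [TopologicalSpace (TotalSpace F' E')] [∀ x, AddCommGroup (E' x)]
  [∀ x, Module ℝ (E' x)] [∀ x, TopologicalSpace (E' x)] [FiberBundle F' E'] [VectorBundle ℝ F' E']
  [ContMDiffVectorBundle ∞ F' E' 𝓘(ℝ, B')]

theorem LieAlgebroid.ext_of_apply {A A' : LieAlgebroid (B := B) F E}
    (ha : ∀ x u, A.anchor x u = A'.anchor x u)
    (hb : ∀ s t x, A.bracket s t x = A'.bracket s t x) : A = A' := by
  have h1 : A.anchor = A'.anchor := funext fun x => LinearMap.ext (ha x)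
  have h2 : A.bracket = A'.bracket :=
    funext fun s => funext fun t => ContMDiffSection.ext (hb s t)
  cases A
  cases A'
  cases h1
  cases h2
  rfl

variable {q : BundleMorphism B F E B' F' E'} {A : LieAlgebroid (B := B) F E}

theorem LieAlgebroid.IsPushforward.fiber_bracket {A' : LieAlgebroid (B := B') F' E'}
    (h : A.IsPushforward q A') {e₁ e₂ : Sec (B := B) F E} {s t : Sec (B := B') F' E'}
    (h₁ : ∀ x, q.fiber x (e₁ x) = s (q.base x)) (h₂ : ∀ x, q.fiber x (e₂ x) = t (q.base x))
    (x : M) : q.fiber x (A.bracket e₁ e₂ x) = A'.bracket s t (q.base x) := by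
  -- Related sections are decompositions with one term and coefficient 1, whose derivative vanishes.
  have h3 := h.bracket_comp e₁ e₂ 1 1 (fun _ => 1) (fun _ => s) (fun _ => 1) (fun _ => t)
    (fun x => by simpa using h₁ x) (fun x => by simpa using h₂ x) x
  have h0 : ∀ v, dirDeriv 𝓘(ℝ, B) (1 : M → ℝ) x v = 0 := fun v =>
    congrArg (fun L : B →L[ℝ] ℝ => L v)
      (mfderiv_const (I := 𝓘(ℝ, B)) (I' := 𝓘(ℝ, ℝ)) (c := (1 : ℝ)) (x := x))
  simpa [h0] using h3

theorem LieAlgebroid.IsPushforward.mfderiv_rho {A' : LieAlgebroid (B := B') F' E'}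
    (h : A.IsPushforward q A') {e : Sec (B := B) F E} {s : Sec (B := B') F' E'}
    (hs : ∀ x, q.fiber x (e x) = s (q.base x)) (x : M) :
    mfderiv 𝓘(ℝ, B) 𝓘(ℝ, B') q.base x (A.rho e x) = A'.rho s (q.base x) := by
  refine (h.anchor_comp x (e x)).trans ?_
  rw [hs]
  rfl

/-- The anchor is determined by fibrewise surjectivity. The bracket is determined because any two
sections lift and the bracket of the lifts is related to theirs. -/
theorem LieAlgebroid.IsPushforward.unique [T2Space M] [SigmaCompactSpace M]
    (hq : q.IsSimpleQuotient) {A₁ A₂ : LieAlgebroid (B := B') F' E'}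
    (h₁ : A.IsPushforward q A₁) (h₂ : A.IsPushforward q A₂) : A₁ = A₂ := by
  refine LieAlgebroid.ext_of_apply (fun y u' => ?_) (fun s t y => ?_)
  · obtain ⟨x, rfl⟩ := hq.base_surjective y
    obtain ⟨u, rfl⟩ := hq.fiber_surjective x u'
    exact (h₁.anchor_comp x u).symm.trans (h₂.anchor_comp x u)
  · obtain ⟨x, rfl⟩ := hq.base_surjective y
    obtain ⟨e₁, he₁⟩ := hq.exists_lift s
    obtain ⟨e₂, he₂⟩ := hq.exists_lift t
    exact (h₁.fiber_bracket he₁ he₂ x).symm.trans (h₂.fiber_bracket he₁ he₂ x)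

theorem TotForm.IsPushforward.unique (hq : q.IsSimpleQuotient) {k : ℕ} {θ : TotForm B F E k}
    {θ₁ θ₂ : TotForm B' F' E' k} (h₁ : θ.IsPushforward q θ₁) (h₂ : θ.IsPushforward q θ₂) :
    θ₁ = θ₂ :=
  Form.pullback_injective hq.total_surjective hq.modelDeriv_total_surjective
    (h₁.2.symm.trans h₂.2)

/-- Homotheties commute with `q`, so the linearity equation holds after pullback, and pullback is
injective. -/
theorem TotForm.IsPushforward.isLinear (hq : q.IsSimpleQuotient) {k : ℕ} {θ : TotForm B F E k}
    {θ' : TotForm B' F' E' k} (h : θ.IsPushforward q θ') (hl : θ.IsLinear) : θ'.IsLinear := by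
  intro c
  refine Form.pullback_injective (I := totModel B F) hq.total_surjective
    hq.modelDeriv_total_surjective ?_
  have hd : MDifferentiable (totModel B F) (totModel B' F') q.total :=
    q.contMDiff_total.mdifferentiable (by simp)
  have h1 : Form.pullback (I := totModel B F) q.total
      (Form.pullback (I := totModel B' F') (homothety F' E' c) θ') =
      Form.pullback (I := totModel B F) (homothety F E c)
        (Form.pullback (I := totModel B F) q.total θ') := by
    rw [Form.pullback_pullback _ hd ((contMDiff_homothety c).mdifferentiable (by simp)),
      Form.pullback_pullback _ ((contMDiff_homothety c).mdifferentiable (by simp)) hd]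
    have e : homothety F' E' c ∘ q.total = q.total ∘ homothety F E c := by
      funext p
      show (⟨q.base p.1, c • q.fiber p.1 p.2⟩ : TotalSpace F' E') =
        ⟨q.base p.1, q.fiber p.1 (c • p.2)⟩
      rw [map_smul]
    rw [e]
  refine h1.trans ?_
  rw [← h.2]
  refine (hl c).trans ?_
  rw [h.2]
  rfl

theorem BundleMorphism.modelDeriv_total_horizontal (q : BundleMorphism B F E B' F' E')
    (x : M) (v : B) :
    modelDeriv (totModel B F) (totModel B' F') q.total (⟨x, 0⟩ : TotalSpace F E) (v, 0) =
      (modelDeriv 𝓘(ℝ, B) 𝓘(ℝ, B') q.base x v, 0) := by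
  have hz := (contMDiff_zero_section (B := B) (F := F) (E := E)).mdifferentiableAt (x := x)
    (by simp)
  have hz' := (contMDiff_zero_section (B := B') (F := F') (E := E')).mdifferentiableAt
    (x := q.base x) (by simp)
  have h1 := modelDeriv_comp (I := 𝓘(ℝ, B)) (I' := totModel B F) (I'' := totModel B' F')
    (ψ := q.total) (φ := fun y : M => (⟨y, 0⟩ : TotalSpace F E)) x
    (q.contMDiff_total.mdifferentiableAt (by simp)) hz
  have h2 := modelDeriv_comp (I := 𝓘(ℝ, B)) (I' := 𝓘(ℝ, B')) (I'' := totModel B' F')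
    (ψ := fun y : M' => (⟨y, 0⟩ : TotalSpace F' E')) (φ := q.base) x hz'
    (q.smooth_base.mdifferentiableAt (by simp))
  have e : q.total ∘ (fun y : M => (⟨y, 0⟩ : TotalSpace F E)) =
      (fun y : M' => (⟨y, 0⟩ : TotalSpace F' E')) ∘ q.base := by
    funext y
    show (⟨q.base y, q.fiber y 0⟩ : TotalSpace F' E') = ⟨q.base y, 0⟩
    rw [map_zero]
  rw [e] at h1
  have h3 := congrArg (fun L : B →L[ℝ] B' × F' => L v) (h1.symm.trans h2)
  refine (congrArg (fun W : B × F => modelDeriv (totModel B F) (totModel B' F') q.total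
    (⟨x, 0⟩ : TotalSpace F E) W) (zeroTangent_apply (F := F) (E := E) x v)).symm.trans ?_
  exact h3.trans (zeroTangent_apply (F := F') (E := E') (q.base x) _)

/-- The derivative of `q` sends vertical vectors at the zero section to vertical ones by `q`, and
vectors tangent to the zero section to such vectors by the derivative of the base map. -/
theorem TotForm.mu_pullback {k : ℕ} (θ' : TotForm B' F' E' k) (x : M) (u : E x) :
    TotForm.mu (Form.pullback (I := totModel B F) q.total θ') x u =
      (θ'.mu (q.base x) (q.fiber x u)).compContinuousLinearMap
        (mfderiv 𝓘(ℝ, B) 𝓘(ℝ, B') q.base x) := by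
  cases k with
  | zero =>
    refine ContinuousAlternatingMap.ext fun v => ?_
    rfl
  | succ n =>
    refine ContinuousAlternatingMap.ext fun v => ?_
    refine (TotForm.mu_apply (B := B) (Form.pullback (I := totModel B F) q.total θ') x u v).trans ?_
    refine Eq.trans ?_ (TotForm.mu_apply θ' (q.base x) (q.fiber x u)
      (fun i => modelDeriv 𝓘(ℝ, B) 𝓘(ℝ, B') q.base x (v i))).symm
    have h0 : q.total (⟨x, 0⟩ : TotalSpace F E) = ⟨q.base x, 0⟩ := by
      show (⟨q.base x, q.fiber x 0⟩ : TotalSpace F' E') = _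
      rw [map_zero]
    refine (Form.pullback_apply (I := totModel B F) q.total θ' ⟨x, 0⟩ _).trans ?_
    refine Form.apply_congr θ' h0 ?_
    funext i
    refine Fin.cases ?_ (fun i => ?_) i
    · exact q.modelDeriv_total_vertical x 0 u
    · exact q.modelDeriv_total_horizontal x (v i)

/-- The statement for `μ`, applied to the exterior derivative, which commutes with pullback. -/
theorem TotForm.eta_pullback {k : ℕ} {θ' : TotForm B' F' E' k} (hs : Form.IsSmooth θ')
    (x : M) (u : E x) :
    TotForm.eta (Form.pullback (I := totModel B F) q.total θ') x u =
      (θ'.eta (q.base x) (q.fiber x u)).compContinuousLinearMap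
        (mfderiv 𝓘(ℝ, B) 𝓘(ℝ, B') q.base x) := by
  refine Eq.trans ?_ (TotForm.mu_pullback (q := q) (Form.extDer θ') x u)
  rw [← Form.extDer_pullback hs q.contMDiff_total]
  rfl

/-- For lifted sections each IM equation upstairs is the pullback along the base map of the same
equation downstairs, since anchors are related vector fields; injectivity of pullback removes it. -/
theorem IsIMForm.of_pullback [T2Space M] [SigmaCompactSpace M] (hq : q.IsSimpleQuotient)
    {A' : LieAlgebroid (B := B') F' E'} (hA : A.IsPushforward q A') {k : ℕ}
    {μ : ∀ x : M, E x → CotangentPower 𝓘(ℝ, B) (k - 1) x}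
    {η : ∀ x : M, E x → CotangentPower 𝓘(ℝ, B) k x}
    {μ' : ∀ x : M', E' x → CotangentPower 𝓘(ℝ, B') (k - 1) x}
    {η' : ∀ x : M', E' x → CotangentPower 𝓘(ℝ, B') k x}
    (hμ : ∀ x u, μ x u = (μ' (q.base x) (q.fiber x u)).compContinuousLinearMap
      (mfderiv 𝓘(ℝ, B) 𝓘(ℝ, B') q.base x))
    (hη : ∀ x u, η x u = (η' (q.base x) (q.fiber x u)).compContinuousLinearMap
      (mfderiv 𝓘(ℝ, B) 𝓘(ℝ, B') q.base x))
    (hμ' : IsFormValuedMorphism F' μ') (hη' : IsFormValuedMorphism F' η')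
    (h : IsIMForm A μ η) : IsIMForm A' μ' η' := by
  have hinj : ∀ n, Function.Injective
      (Form.pullback (I := 𝓘(ℝ, B)) (I' := 𝓘(ℝ, B')) (n := n) q.base) := fun n =>
    Form.pullback_injective hq.base_surjective hq.modelDeriv_base_surjective
  have hμs : ∀ (e : Sec (B := B) F E) (s : Sec (B := B') F' E'),
      (∀ x, q.fiber x (e x) = s (q.base x)) → (fun x => μ x (e x)) =
        Form.pullback (I := 𝓘(ℝ, B)) q.base (fun y => μ' y (s y)) := by
    intro e s hes
    funext x
    rw [hμ, hes]
    rfl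
  have hηs : ∀ (e : Sec (B := B) F E) (s : Sec (B := B') F' E'),
      (∀ x, q.fiber x (e x) = s (q.base x)) → (fun x => η x (e x)) =
        Form.pullback (I := 𝓘(ℝ, B)) q.base (fun y => η' y (s y)) := by
    intro e s hes
    funext x
    rw [hη, hes]
    rfl
  refine ⟨hμ', hη', fun s t => ?_, fun s t => ?_, fun s t => ?_⟩ <;>
  · obtain ⟨e₁, he₁⟩ := hq.exists_lift s
    obtain ⟨e₂, he₂⟩ := hq.exists_lift t
    have hr₁ := hA.mfderiv_rho he₁
    have hr₂ := hA.mfderiv_rho he₂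
    have hv₁ := A'.isSmoothVectorField_rho s
    have hv₂ := A'.isSmoothVectorField_rho t
    have hb := hA.fiber_bracket he₁ he₂
    refine hinj _ ?_
    -- The three equations share their preparation and differ in the pullback rules that they need.
    first
    | have h1 := h.im_skew e₁ e₂
      rw [hμs e₁ s he₁, hμs e₂ t he₂, Form.interior_pullback hr₁, Form.interior_pullback hr₂] at h1
      exact h1
    | have h1 := h.im_mu e₁ e₂
      rw [hμs e₁ s he₁, hμs e₂ t he₂, hμs _ _ hb, hηs e₁ s he₁,
        Form.lieDer_pullback q.smooth_base hr₁ hv₁ (hμ'.smooth t),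
        Form.extDer_pullback (hμ'.smooth s) q.smooth_base,
        Form.interiorSucc_pullback hr₂, Form.interior_pullback hr₂] at h1
      exact h1
    | have h1 := h.im_eta e₁ e₂
      rw [hηs e₁ s he₁, hηs e₂ t he₂, hηs _ _ hb,
        Form.lieDer_pullback q.smooth_base hr₁ hv₁ (hη'.smooth t),
        Form.extDer_pullback (hη'.smooth s) q.smooth_base,
        Form.interiorSucc_pullback hr₂] at h1
      exact h1

end Quotients

end SimpleQuotients

/-! ### The main theorem. -/

theorem mainTheorem5
    {B : Type*} [NormedAddCommGroup B] [NormedSpace ℝ B] [FiniteDimensional ℝ B]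
    {M : Type*} [TopologicalSpace M] [ChartedSpace B M] [IsManifold 𝓘(ℝ, B) ∞ M]
    [T2Space M] [SecondCountableTopology M]
    {F : Type*} [NormedAddCommGroup F] [NormedSpace ℝ F] [FiniteDimensional ℝ F]
    {E : M → Type*} [TopologicalSpace (Bundle.TotalSpace F E)] [∀ x, AddCommGroup (E x)]
    [∀ x, Module ℝ (E x)] [∀ x, TopologicalSpace (E x)] [FiberBundle F E] [VectorBundle ℝ F E]
    [ContMDiffVectorBundle ∞ F E 𝓘(ℝ, B)]
    {B' : Type*} [NormedAddCommGroup B'] [NormedSpace ℝ B'] [FiniteDimensional ℝ B']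
    {M' : Type*} [TopologicalSpace M'] [ChartedSpace B' M'] [IsManifold 𝓘(ℝ, B') ∞ M']
    [T2Space M'] [SecondCountableTopology M']
    {F' : Type*} [NormedAddCommGroup F'] [NormedSpace ℝ F'] [FiniteDimensional ℝ F']
    {E' : M' → Type*} [TopologicalSpace (Bundle.TotalSpace F' E')] [∀ x, AddCommGroup (E' x)]
    [∀ x, Module ℝ (E' x)] [∀ x, TopologicalSpace (E' x)] [FiberBundle F' E']
    [VectorBundle ℝ F' E'] [ContMDiffVectorBundle ∞ F' E' 𝓘(ℝ, B')]
    (q : SimpleQuotients.BundleMorphism B F E B' F' E') (hq : q.IsSimpleQuotient)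
    (A : SimpleQuotients.LieAlgebroid (B := B) F E) {k : ℕ}
    (θ : SimpleQuotients.TotForm B F E k) (hθ : θ.IsMorphic A)
    (hAq : A.IsBasic q) (hθq : θ.IsBasic q) :
    (∃! A' : SimpleQuotients.LieAlgebroid (B := B') F' E', A.IsPushforward q A') ∧
    (∃! θ' : SimpleQuotients.TotForm B' F' E' k, θ.IsPushforward q θ') ∧
    ∀ (A' : SimpleQuotients.LieAlgebroid (B := B') F' E')
      (θ' : SimpleQuotients.TotForm B' F' E' k), A.IsPushforward q A' → θ.IsPushforward q θ' →
      θ'.IsMorphic A' ∧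
      θ'.HasComponents θ'.mu θ'.eta ∧
      (∀ (x : M) (u : E x),
        θ.mu x u = (θ'.mu (q.base x) (q.fiber x u)).compContinuousLinearMap
          (mfderiv 𝓘(ℝ, B) 𝓘(ℝ, B') q.base x) ∧
        θ.eta x u = (θ'.eta (q.base x) (q.fiber x u)).compContinuousLinearMap
          (mfderiv 𝓘(ℝ, B) 𝓘(ℝ, B') q.base x)) ∧
      SimpleQuotients.IsIMForm A' θ'.mu θ'.eta := by
  -- Local compactness and second countability give σ-compactness, required by the partition of
  -- unity that lifts sections.
  have hσ : SigmaCompactSpace M := by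
    have := Manifold.locallyCompact_of_finiteDimensional (M := M) 𝓘(ℝ, B)
    infer_instance
  obtain ⟨A₀, hA₀⟩ := hAq
  obtain ⟨θ₀, hθ₀⟩ := hθq
  refine ⟨⟨A₀, hA₀, fun A₁ h₁ => h₁.unique hq hA₀⟩, ⟨θ₀, hθ₀, fun θ₁ h₁ => h₁.unique hq hθ₀⟩,
    fun A' θ' hA' hθ' => ?_⟩
  have hl := hθ'.isLinear hq hθ.linear
  have hs := hθ'.1
  have hμ : ∀ (x : M) (u : E x), θ.mu x u =
      (θ'.mu (q.base x) (q.fiber x u)).compContinuousLinearMap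
        (mfderiv 𝓘(ℝ, B) 𝓘(ℝ, B') q.base x) := fun x u => by
    rw [hθ'.2]
    exact SimpleQuotients.TotForm.mu_pullback θ' x u
  have hη : ∀ (x : M) (u : E x), θ.eta x u =
      (θ'.eta (q.base x) (q.fiber x u)).compContinuousLinearMap
        (mfderiv 𝓘(ℝ, B) 𝓘(ℝ, B') q.base x) := fun x u => by
    rw [hθ'.2]
    exact SimpleQuotients.TotForm.eta_pullback hs x u
  have him : SimpleQuotients.IsIMForm A' θ'.mu θ'.eta :=
    SimpleQuotients.IsIMForm.of_pullback hq hA' hμ hη (hl.isFormValuedMorphism_mu hs)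
      (hl.isFormValuedMorphism_eta hs) hθ.isIMForm
  exact ⟨him.isMorphic hs hl, hl.hasComponents hs, fun x u => ⟨hμ x u, hη x u⟩, him⟩
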